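/- Let $B=\mathbb{R}^2\times(-\infty,0)$, with boundary $\partial B\simeq\mathbb{R}^2$. Let $\Gamma\subset\partial B$ be a Jordan curve of class $C^2$, let $\Omega_-$ be the bounded domain enclosed by $\Gamma$, $\Omega_+$ the unbounded exterior domain, and $\nu$ the unit normal to $\Gamma$ pointing out of $\Omega_-$. For a function $f$ on $\partial B\setminus\Gamma$ and $x\in\Gamma$ put $$[\![f]\!](x)=\lim_{\varepsilon\searrow0}\bigl(f(x-\varepsilon\nu(x))-f(x+\varepsilon\nu(x))\bigr).$$ Let $g\in C^0(\Gamma)$ be a real function with $\int_\Gamma g\,\nu\,\mathrm{d}s=0$. A classical solution is a quadruple $(v,q,u,p)$ of functions $v\colon\overline B\setminus\Gamma\to\mathbb{R}^3$, $q\colon\overline B\setminus\Gamma\to\mathbb{R}$, $u\colon\partial B\setminus\Gamma\to\mathbb{R}^2$, $p\colon\partial B\setminus\Gamma\to\mathbb{R}$ such that the following hold, where $v_\parallel=(v_1,v_2)$. 1. Regularity: $v\in C^2(B)\cap C^1(\overline B\setminus\Gamma)$, $q\in C^1(B)\cap C^0(\overline B\setminus\Gamma)$, and $u,p\in C^1(\overline{\Omega_-})\cap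 C^1(\overline{\Omega_+})$, that is, on each of $\Omega_-$ and $\Omega_+$ the functions $u,p$ are $C^1$ and they and their first derivatives extend continuously to the closure. 2. Decay: as $|x|\to\infty$, $|v|=\mathcal{O}(|x|^{-2})$, $|\nabla v|=\mathcal{O}(|x|^{-3})$, $|q|=\mathcal{O}(|x|^{-3})$, $|\nabla q|=\mathcal{O}(|x|^{-4})$ uniformly for $x\in B$, and $|u|=\mathcal{O}(|x|^{-2})$, $|p|=\mathcal{O}(|x|^{-2})$ uniformly for $x\in\partial B\setminus\Gamma$. 3. Finite energy: $\int_B|\nabla v|^2\,\mathrm{d}x<\infty$ and $\int_B|\nabla q|^2\,\mathrm{d}x<\infty$. 4. Equations: pointwise, $$\begin{aligned} -\Delta v+\nabla q&=0, & \nabla\cdot v&=0 && \text{in } B,\\ v_3&=0, & v_\parallel&=u && \text{on } \partial B\setminus\Gamma,\\ \nabla p&=-\partial_{x_3}v_\parallel, & \nabla\cdot u&=0 && \text{on } \partial B\setminus\Gamma,\\ [\![u\cdot\nu]\!]&=0, & [\![p]\!]&=g && \text{on } \Gamma. \end{aligned}$$ Then there is at most one classical solution: if $(v_1,q_1,u_1,p_1)$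 and $(v_2,q_2,u_2,p_2)$ are classical solutions for the same $\Gamma$ and $g$, then $v_1=v_2$ and $q_1=q_2$ on $\overline B\setminus\Gamma$, and $u_1=u_2$ and $p_1=p_2$ on $\partial B\setminus\Gamma$. -/

import Mathlib

open Set Filter Topology Asymptotics MeasureTheory InnerProductSpace

namespace Langmuir

/-- The plane `ℝ²`, identified with the boundary `∂B` of the subfluid. -/
abbrev Plane := EuclideanSpace ℝ (Fin 2)

/-- The space `ℝ³`. -/
abbrev Space := EuclideanSpace ℝ (Fin 3)

/-- The subfluid `B = ℝ² × (-∞, 0)`. -/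
def subfluid : Set Space := {x | x 2 < 0}

/-- The identification `y ↦ (y₁, y₂, 0)` of `ℝ²` with `∂B`. -/
noncomputable def onBoundary (y : Plane) : Space := !₂[y 0, y 1, 0]

/-- The set `closure B \ Γ`, for a set `Γ` of points of `∂B ≃ ℝ²`. -/
def closedSubfluidDiff (Γ : Set Plane) : Set Space := {x | x 2 ≤ 0} \ (onBoundary '' Γ)

/-! ### Jordan curves of class `C²` -/

/-- `γ` is a 1-periodic regular `C²` parametrization of a Jordan curve, the set `range γ`. -/
structure IsC2Jordan (γ : ℝ → Plane) : Prop where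
  contDiff : ContDiff ℝ 2 γ
  periodic : Function.Periodic γ 1
  injOn : InjOn γ (Ico 0 1)
  regular : ∀ t, deriv γ t ≠ 0

/-- The domain `Ω₋` enclosed by `Γ`: the union of the bounded components of the complement. -/
def interiorDomain (Γ : Set Plane) : Set Plane :=
  {x | x ∈ Γᶜ ∧ Bornology.IsBounded (connectedComponentIn Γᶜ x)}

/-- The exterior domain `Ω₊`: the union of the unbounded components of the complement. -/
def exteriorDomain (Γ : Set Plane) : Set Plane :=
  {x | x ∈ Γᶜ ∧ ¬ Bornology.IsBounded (connectedComponentIn Γᶜ x)}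

/-- On the curve `Γ = range γ`, the field `ν` is the unit normal that points out of `Ω₋`. The values
of `ν` off the curve are irrelevant. -/
structure IsOutwardNormal (γ : ℝ → Plane) (ν : Plane → Plane) : Prop where
  norm_eq : ∀ x ∈ range γ, ‖ν x‖ = 1
  orthogonal : ∀ t, inner ℝ (ν (γ t)) (deriv γ t) = 0
  inward : ∀ x ∈ range γ, ∀ᶠ ε in 𝓝[>] (0 : ℝ), x - ε • ν x ∈ interiorDomain (range γ)
  outward : ∀ x ∈ range γ, ∀ᶠ ε in 𝓝[>] (0 : ℝ), x + ε • ν x ∈ exteriorDomain (range γ)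

/-- The line integral `∫_Γ f ds` with respect to arc length. -/
noncomputable def lineIntegral (γ : ℝ → Plane) (f : Plane → Plane) : Plane :=
  ∫ t in (0 : ℝ)..1, ‖deriv γ t‖ • f (γ t)

/-- `⟦f⟧(x) = l`, where `⟦f⟧(x) = lim_{ε ↘ 0} (f (x - ε ν(x)) - f (x + ε ν(x)))`. The limit is
asserted to exist. -/
def HasJump (ν : Plane → Plane) (f : Plane → ℝ) (x : Plane) (l : ℝ) : Prop :=
  Tendsto (fun ε : ℝ => f (x - ε • ν x) - f (x + ε • ν x)) (𝓝[>] 0) (𝓝 l)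

/-! ### Function spaces and differential operators -/

/-- `f ∈ C¹(closure Ω)` for an open set `Ω`: `f` is `C¹` in `Ω`, and `f` and its derivative extend
continuously to `closure Ω`. The values of `f` outside `Ω` are irrelevant. -/
def C1UpToBoundary {F : Type*} [NormedAddCommGroup F] [NormedSpace ℝ F]
    (Ω : Set Plane) (f : Plane → F) : Prop :=
  ContDiffOn ℝ 1 f Ω ∧
    (∃ f₀ : Plane → F, ContinuousOn f₀ (closure Ω) ∧ EqOn f f₀ Ω) ∧
    (∃ f₁ : Plane → Plane →L[ℝ] F, ContinuousOn f₁ (closure Ω) ∧ EqOn (fderiv ℝ f) f₁ Ω)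

/-- The divergence `∑ᵢ ∂ᵢ wᵢ`. -/
noncomputable def divergence {n : ℕ}
    (w : EuclideanSpace ℝ (Fin n) → EuclideanSpace ℝ (Fin n)) (x : EuclideanSpace ℝ (Fin n)) : ℝ :=
  ∑ i, fderiv ℝ w x (EuclideanSpace.single i 1) i

/-- The trace on `∂B \ Γ` of `∂v/∂x₃`, at the point `y`. For `v ∈ C¹(closure B \ Γ)` it is the
derivative of `v` from below, and the limit of the values of `∂v/∂x₃` in `B`. -/
noncomputable def normalDerivTrace (Γ : Set Plane) (v : Space → Space) (y : Plane) : Space :=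
  fderivWithin ℝ v (closedSubfluidDiff Γ) (onBoundary y) (EuclideanSpace.single 2 1)

/-- The tangential part `(w₁, w₂)` of a vector `w` of `ℝ³`. -/
noncomputable def tangentialPart (w : Space) : Plane := !₂[w 0, w 1]

/-! ### Classical solutions -/

/-- `(v, q, u, p)` is a classical solution of the coupled Stokes-surface problem with interface
`Γ = range γ`, outward unit normal `ν` and pressure jump `g`. The fields `v, q` are functions on
`closure B \ Γ` and `u, p` are functions on `∂B \ Γ ≃ ℝ² \ Γ`; the values elsewhere are
irrelevant. -/
structure IsClassicalSolution (γ : ℝ → Plane) (ν : Plane → Plane) (g : Plane → ℝ)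
    (v : Space → Space) (q : Space → ℝ) (u : Plane → Plane) (p : Plane → ℝ) : Prop where
  -- regularity
  v_C2 : ContDiffOn ℝ 2 v subfluid
  v_C1 : ContDiffOn ℝ 1 v (closedSubfluidDiff (range γ))
  q_C1 : ContDiffOn ℝ 1 q subfluid
  q_C0 : ContinuousOn q (closedSubfluidDiff (range γ))
  u_int : C1UpToBoundary (interiorDomain (range γ)) u
  u_ext : C1UpToBoundary (exteriorDomain (range γ)) u
  p_int : C1UpToBoundary (interiorDomain (range γ)) p
  p_ext : C1UpToBoundary (exteriorDomain (range γ)) p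
  -- decay at infinity
  v_decay : v =O[Bornology.cobounded Space ⊓ 𝓟 subfluid] fun x => ‖x‖ ^ (-2 : ℤ)
  grad_v_decay : (fderiv ℝ v) =O[Bornology.cobounded Space ⊓ 𝓟 subfluid] fun x => ‖x‖ ^ (-3 : ℤ)
  q_decay : q =O[Bornology.cobounded Space ⊓ 𝓟 subfluid] fun x => ‖x‖ ^ (-3 : ℤ)
  grad_q_decay : (gradient q) =O[Bornology.cobounded Space ⊓ 𝓟 subfluid] fun x => ‖x‖ ^ (-4 : ℤ)
  u_decay : u =O[Bornology.cobounded Plane] fun y => ‖y‖ ^ (-2 : ℤ)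
  p_decay : p =O[Bornology.cobounded Plane] fun y => ‖y‖ ^ (-2 : ℤ)
  -- finite energy
  v_energy : IntegrableOn
    (fun x => ∑ i : Fin 3, ‖fderiv ℝ v x (EuclideanSpace.single i 1)‖ ^ 2) subfluid
  q_energy : IntegrableOn (fun x => ‖gradient q x‖ ^ 2) subfluid
  -- the Stokes equations in `B`
  stokes : ∀ x ∈ subfluid, -(Laplacian.laplacian v x) + gradient q x = 0
  div_v : ∀ x ∈ subfluid, divergence v x = 0
  -- the boundary conditions on `∂B \ Γ`
  v_normal : ∀ y ∈ (range γ)ᶜ, v (onBoundary y) 2 = 0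
  v_tangential : ∀ y ∈ (range γ)ᶜ, tangentialPart (v (onBoundary y)) = u y
  -- the surface equations on `∂B \ Γ`
  grad_p : ∀ y ∈ (range γ)ᶜ, gradient p y = -tangentialPart (normalDerivTrace (range γ) v y)
  div_u : ∀ y ∈ (range γ)ᶜ, divergence u y = 0
  -- the jump conditions on `Γ`
  jump_u : ∀ x ∈ range γ, HasJump ν (fun y => inner ℝ (u y) (ν x)) x 0
  jump_p : ∀ x ∈ range γ, HasJump ν p x (g x)

end Langmuir

namespace Langmuir

/-! ### The subfluid and its boundary -/

/-! By linearity the difference of two solutions is a solution with `g = 0`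
(`IsClassicalSolution.sub`), so it suffices that such a solution vanishes. Testing the Stokes
equation with `v` gives `∫_B |∇v|² = ∫_{∂B} v · ∂₃v - ∫_B ∇q · v`. The pressure term is zero because
`v` is divergence-free and has no normal component on `∂B`. On `∂B` the surface equations turn `v ·
∂₃v` into `-u · ∇p = -div (p u)`, whose integral reduces to the flux of the jump of `p u` through
`Γ`. This jump has no normal component, since neither `p` nor `u · ν` jumps when `g = 0`. Hence `∇v
= 0` (`integral_energy`), and decay gives `v = 0`. The Stokes equation then gives `∇q = 0`, so `q =
0`; `u` is a trace of `v`; and `p` is locally constant, zero outside `Γ` by decay and zero inside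
because it does not jump (`pressure_eq_zero`).

The difficulty is to integrate by parts although nothing bounds `v`, `q` or their derivatives
pointwise near `Γ`. A curve in space has codimension two: it admits cut-offs with gradient of order
`n` on tubes of volume of order `n⁻²`, so their gradients are bounded in `L²`. By Cauchy-Schwarz
such a cut-off costs nothing in the limit against an `L²` field, which yields a divergence theorem
blind to `Γ` (`integral_subfluid_divergence_of_memLp`). The fields needed, `vᵢ ∇vᵢ` and `q v`, are
products of two `L²` functions and so only integrable. In `integral_green` and `integral_pressure`
the scalar factor is therefore truncated first, and the truncation is removed by dominated
convergence. That `v` and `q` are square integrable follows from decay far away and finite energy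
nearby (`memLp_two_of_decay`).

On the surface, `p` and `u` are `C¹` up to `Γ` from both sides, and the divergence theorem across
`Γ` is local: `integral_weightedDivergence` glues, by a partition of unity, computations in the
coordinates `(t, s) ↦ γ(t) + s n` with a fixed vector `n`. The box lemma `exists_strip_box` places
one side of `Γ` in the interior and the other in the exterior domain directly from the definition of
`ν`, so the Jordan curve theorem is not needed. -/

lemma mem_subfluid {x : Space} : x ∈ subfluid ↔ x 2 < 0 := Iff.rfl

lemma isOpen_subfluid : IsOpen subfluid :=
  isOpen_lt (by fun_prop) continuous_const

lemma measurableSet_subfluid : MeasurableSet subfluid := isOpen_subfluid.measurableSet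

lemma convex_lowerHalfSpace : Convex ℝ {x : Space | x 2 ≤ 0} := by
  intro x hx y hy a b ha hb _
  simp only [mem_ofPred_eq, PiLp.add_apply, PiLp.smul_apply, smul_eq_mul] at *
  nlinarith [mul_nonneg ha (neg_nonneg.2 hx), mul_nonneg hb (neg_nonneg.2 hy)]

lemma convex_subfluid : Convex ℝ subfluid := by
  intro x hx y hy a b ha hb hab
  simp only [mem_subfluid, PiLp.add_apply, PiLp.smul_apply, smul_eq_mul] at *
  rcases eq_or_lt_of_le ha with rfl | ha
  · obtain rfl : b = 1 := by linarith
    linarith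
  · nlinarith [mul_pos ha (neg_pos.2 hx), mul_nonneg hb (neg_pos.2 hy).le]

lemma continuous_onBoundary : Continuous onBoundary := by
  unfold onBoundary
  fun_prop

@[simp] lemma onBoundary_apply_zero (y : Plane) : onBoundary y 0 = y 0 := rfl
@[simp] lemma onBoundary_apply_one (y : Plane) : onBoundary y 1 = y 1 := rfl
@[simp] lemma onBoundary_apply_two (y : Plane) : onBoundary y 2 = 0 := rfl

lemma norm_onBoundary (y : Plane) : ‖onBoundary y‖ = ‖y‖ := by
  simp [EuclideanSpace.norm_eq, Fin.sum_univ_three, Fin.sum_univ_two]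

/-- `onBoundary` as a continuous linear map. -/
noncomputable def onBoundaryL : Plane →L[ℝ] Space :=
  LinearMap.toContinuousLinearMap
    { toFun := onBoundary
      map_add' := fun x y => by ext i; fin_cases i <;> simp [onBoundary]
      map_smul' := fun c x => by ext i; fin_cases i <;> simp [onBoundary] }

@[simp] lemma onBoundaryL_apply (y : Plane) : onBoundaryL y = onBoundary y := rfl

lemma onBoundary_injective : Function.Injective onBoundary := by
  intro x y h
  have h0 := congrArg (fun z : Space => z 0) h
  have h1 := congrArg (fun z : Space => z 1) h
  ext i; fin_cases i
  · simpa using h0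
  · simpa using h1

lemma subfluid_subset (Γ : Set Plane) : subfluid ⊆ closedSubfluidDiff Γ := by
  intro x hx
  refine ⟨(mem_subfluid.1 hx).le, ?_⟩
  rintro ⟨y, -, rfl⟩
  simp [subfluid] at hx

lemma onBoundary_mem {Γ : Set Plane} {y : Plane} (hy : y ∈ Γᶜ) :
    onBoundary y ∈ closedSubfluidDiff Γ := by
  refine ⟨by simp, ?_⟩
  rintro ⟨z, hz, h⟩
  exact hy (onBoundary_injective h ▸ hz)

lemma interior_lowerHalfSpace_nonempty : (interior {x : Space | x 2 ≤ 0}).Nonempty := by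
  refine ⟨EuclideanSpace.single 2 (-1), ?_⟩
  have : subfluid ⊆ interior {x : Space | x 2 ≤ 0} :=
    interior_maximal (fun x hx => (mem_subfluid.1 hx).le) isOpen_subfluid
  exact this (by simp [subfluid])

/-- A convex set with nonempty interior has unique derivatives, and removing a closed set preserves
this. It makes `fderivWithin` on `closure B \ Γ` linear in the function and continuous up to `∂B \
Γ`, as the trace of `∂₃v` requires. -/
lemma uniqueDiffOn_closedSubfluidDiff {Γ : Set Plane} (hΓ : IsCompact Γ) :
    UniqueDiffOn ℝ (closedSubfluidDiff Γ) :=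
  (uniqueDiffOn_convex convex_lowerHalfSpace interior_lowerHalfSpace_nonempty).inter
    (hΓ.image continuous_onBoundary).isClosed.isOpen_compl

/-- Each point is a limit of points straight below it. This carries identities proved in `B` to the
boundary by continuity. -/
lemma closedSubfluidDiff_subset_closure (Γ : Set Plane) :
    closedSubfluidDiff Γ ⊆ closure subfluid := by
  intro x hx
  have hc : Continuous fun ε : ℝ => x - ε • EuclideanSpace.single 2 (1 : ℝ) := by fun_prop
  have ht : Tendsto (fun ε : ℝ => x - ε • EuclideanSpace.single 2 (1 : ℝ)) (𝓝[>] 0) (𝓝 x) := by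
    have := hc.tendsto 0
    simp only [zero_smul, sub_zero] at this
    exact this.mono_left nhdsWithin_le_nhds
  refine mem_closure_of_tendsto ht ?_
  filter_upwards [self_mem_nhdsWithin] with ε hε
  have : x 2 ≤ 0 := hx.1
  simp only [subfluid, mem_ofPred_eq, PiLp.sub_apply, PiLp.smul_apply, PiLp.single_apply,
    if_true, smul_eq_mul, mul_one]
  have : (0 : ℝ) < ε := hε
  linarith

lemma fderivWithin_eq_fderiv_of_mem_subfluid {F : Type*} [NormedAddCommGroup F] [NormedSpace ℝ F]
    (Γ : Set Plane) (f : Space → F) {x : Space} (hx : x ∈ subfluid) :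
    fderivWithin ℝ f (closedSubfluidDiff Γ) x = fderiv ℝ f x :=
  fderivWithin_of_mem_nhds (mem_of_superset (isOpen_subfluid.mem_nhds hx) (subfluid_subset Γ))

/-! ### The curve and the two domains -/

lemma IsC2Jordan.range_eq {γ : ℝ → Plane} (h : IsC2Jordan γ) : range γ = γ '' Icc 0 1 := by
  have h1 := h.periodic.image_Icc (zero_lt_one) 0
  simpa using h1.symm

lemma IsC2Jordan.isCompact_range {γ : ℝ → Plane} (h : IsC2Jordan γ) : IsCompact (range γ) := by
  rw [h.range_eq]
  exact isCompact_Icc.image h.contDiff.continuous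

lemma IsC2Jordan.isOpen_compl {γ : ℝ → Plane} (h : IsC2Jordan γ) : IsOpen (range γ)ᶜ :=
  h.isCompact_range.isClosed.isOpen_compl

lemma mem_interiorDomain_of_component {Γ : Set Plane} {x y : Plane} (hx : x ∈ interiorDomain Γ)
    (hy : y ∈ connectedComponentIn Γᶜ x) : y ∈ interiorDomain Γ :=
  ⟨connectedComponentIn_subset _ _ hy, by rw [← connectedComponentIn_eq hy]; exact hx.2⟩

lemma mem_exteriorDomain_of_component {Γ : Set Plane} {x y : Plane} (hx : x ∈ exteriorDomain Γ)
    (hy : y ∈ connectedComponentIn Γᶜ x) : y ∈ exteriorDomain Γ :=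
  ⟨connectedComponentIn_subset _ _ hy, by rw [← connectedComponentIn_eq hy]; exact hx.2⟩

lemma isOpen_interiorDomain {Γ : Set Plane} (h : IsOpen Γᶜ) : IsOpen (interiorDomain Γ) := by
  rw [isOpen_iff_mem_nhds]
  intro x hx
  exact mem_of_superset (h.connectedComponentIn.mem_nhds (mem_connectedComponentIn hx.1))
    fun y hy => mem_interiorDomain_of_component hx hy

lemma isOpen_exteriorDomain {Γ : Set Plane} (h : IsOpen Γᶜ) : IsOpen (exteriorDomain Γ) := by
  rw [isOpen_iff_mem_nhds]
  intro x hx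
  exact mem_of_superset (h.connectedComponentIn.mem_nhds (mem_connectedComponentIn hx.1))
    fun y hy => mem_exteriorDomain_of_component hx hy

/-- Only this dichotomy is used globally; neither domain has to be connected. -/
lemma mem_interior_or_exterior {Γ : Set Plane} {x : Plane} (hx : x ∈ Γᶜ) :
    x ∈ interiorDomain Γ ∨ x ∈ exteriorDomain Γ := by
  by_cases h : Bornology.IsBounded (connectedComponentIn Γᶜ x)
  · exact Or.inl ⟨hx, h⟩
  · exact Or.inr ⟨hx, h⟩

/-! ### Calculus up to the curve, and linearity of the problem -/

lemma C1UpToBoundary.differentiableAt {F : Type*} [NormedAddCommGroup F] [NormedSpace ℝ F]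
    {Ω : Set Plane} {f : Plane → F} (h : C1UpToBoundary Ω f) (hΩ : IsOpen Ω) {x : Plane}
    (hx : x ∈ Ω) : DifferentiableAt ℝ f x :=
  (h.1.contDiffAt (hΩ.mem_nhds hx)).differentiableAt one_ne_zero

lemma C1UpToBoundary.sub {F : Type*} [NormedAddCommGroup F] [NormedSpace ℝ F]
    {Ω : Set Plane} {f g : Plane → F} (hΩ : IsOpen Ω) (hf : C1UpToBoundary Ω f)
    (hg : C1UpToBoundary Ω g) : C1UpToBoundary Ω (fun x => f x - g x) := by
  have hf' := hf
  have hg' := hg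
  obtain ⟨hf1, ⟨f0, hf0, ef0⟩, ⟨f1, hf1', ef1⟩⟩ := hf
  obtain ⟨hg1, ⟨g0, hg0, eg0⟩, ⟨g1, hg1', eg1⟩⟩ := hg
  refine ⟨hf1.sub hg1, ⟨fun x => f0 x - g0 x, hf0.sub hg0, fun x hx => ?_⟩,
    ⟨fun x => f1 x - g1 x, hf1'.sub hg1', fun x hx => ?_⟩⟩
  · simp only [ef0 hx, eg0 hx]
  · simp only
    rw [fderiv_fun_sub (hf'.differentiableAt hΩ hx) (hg'.differentiableAt hΩ hx), ef1 hx, eg1 hx]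

lemma C1UpToBoundary.smul {F : Type*} [NormedAddCommGroup F] [NormedSpace ℝ F]
    {Ω : Set Plane} {f : Plane → ℝ} {g : Plane → F} (hΩ : IsOpen Ω) (hf : C1UpToBoundary Ω f)
    (hg : C1UpToBoundary Ω g) : C1UpToBoundary Ω (fun x => f x • g x) := by
  have hf' := hf
  have hg' := hg
  obtain ⟨hf1, ⟨f0, hf0, ef0⟩, ⟨f1, hf1', ef1⟩⟩ := hf
  obtain ⟨hg1, ⟨g0, hg0, eg0⟩, ⟨g1, hg1', eg1⟩⟩ := hg
  refine ⟨hf1.smul hg1, ⟨fun x => f0 x • g0 x, hf0.smul hg0, fun x hx => ?_⟩,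
    ⟨fun x => f0 x • g1 x + (f1 x).smulRight (g0 x), ?_, fun x hx => ?_⟩⟩
  · simp only [ef0 hx, eg0 hx]
  · refine (hf0.smul hg1').add ?_
    have : ContinuousOn (fun x => ContinuousLinearMap.smulRightL ℝ Plane F (f1 x) (g0 x))
      (closure Ω) := by fun_prop
    exact this
  · simp only
    rw [fderiv_fun_smul (hf'.differentiableAt hΩ hx) (hg'.differentiableAt hΩ hx), ef1 hx, eg1 hx,
      ef0 hx, eg0 hx]

lemma gradient_sub_of_differentiableAt {E : Type*} [NormedAddCommGroup E] [InnerProductSpace ℝ E]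
    [CompleteSpace E] {f g : E → ℝ} {x : E} (hf : DifferentiableAt ℝ f x)
    (hg : DifferentiableAt ℝ g x) :
    gradient (fun y => f y - g y) x = gradient f x - gradient g x := by
  simp only [gradient]
  rw [fderiv_fun_sub hf hg, map_sub]

lemma divergence_sub_of_differentiableAt {n : ℕ}
    {v w : EuclideanSpace ℝ (Fin n) → EuclideanSpace ℝ (Fin n)} {x : EuclideanSpace ℝ (Fin n)}
    (hv : DifferentiableAt ℝ v x) (hw : DifferentiableAt ℝ w x) :
    divergence (fun y => v y - w y) x = divergence v x - divergence w x := by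
  simp only [divergence]
  rw [fderiv_fun_sub hv hw, ← Finset.sum_sub_distrib]
  rfl

lemma HasJump.sub {ν : Plane → Plane} {f₁ f₂ : Plane → ℝ} {x : Plane} {l₁ l₂ : ℝ}
    (h₁ : HasJump ν f₁ x l₁) (h₂ : HasJump ν f₂ x l₂) :
    HasJump ν (fun y => f₁ y - f₂ y) x (l₁ - l₂) := by
  refine (Tendsto.sub h₁ h₂).congr fun ε => ?_
  ring

lemma tangentialPart_sub (a b : Space) :
    tangentialPart (a - b) = tangentialPart a - tangentialPart b := by
  ext i; fin_cases i <;> simp [tangentialPart]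

/-- Every condition is linear except finite energy, which passes to differences by `|a - b|² ≤ 2|a|²
+ 2|b|²`. The two jumps `g` cancel. -/
theorem IsClassicalSolution.sub {γ : ℝ → Plane} {ν : Plane → Plane} {g : Plane → ℝ}
    {v₁ v₂ : Space → Space} {q₁ q₂ : Space → ℝ} {u₁ u₂ : Plane → Plane} {p₁ p₂ : Plane → ℝ}
    (hγ : IsC2Jordan γ) (h₁ : IsClassicalSolution γ ν g v₁ q₁ u₁ p₁)
    (h₂ : IsClassicalSolution γ ν g v₂ q₂ u₂ p₂) :
    IsClassicalSolution γ ν (fun _ => 0) (fun x => v₁ x - v₂ x) (fun x => q₁ x - q₂ x)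
      (fun y => u₁ y - u₂ y) (fun y => p₁ y - p₂ y) := by
  have hB := fun x (hx : x ∈ subfluid) => isOpen_subfluid.mem_nhds hx
  have dv₁ : ∀ x ∈ subfluid, DifferentiableAt ℝ v₁ x := fun x hx =>
    (h₁.v_C2.contDiffAt (hB x hx)).differentiableAt two_ne_zero
  have dv₂ : ∀ x ∈ subfluid, DifferentiableAt ℝ v₂ x := fun x hx =>
    (h₂.v_C2.contDiffAt (hB x hx)).differentiableAt two_ne_zero
  have dq₁ : ∀ x ∈ subfluid, DifferentiableAt ℝ q₁ x := fun x hx =>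
    (h₁.q_C1.contDiffAt (hB x hx)).differentiableAt one_ne_zero
  have dq₂ : ∀ x ∈ subfluid, DifferentiableAt ℝ q₂ x := fun x hx =>
    (h₂.q_C1.contDiffAt (hB x hx)).differentiableAt one_ne_zero
  have hi := isOpen_interiorDomain hγ.isOpen_compl
  have he := isOpen_exteriorDomain hγ.isOpen_compl
  have hd : ∀ {F : Type} [NormedAddCommGroup F] [NormedSpace ℝ F] {f : Plane → F},
      C1UpToBoundary (interiorDomain (range γ)) f → C1UpToBoundary (exteriorDomain (range γ)) f →
      ∀ y ∈ (range γ)ᶜ, DifferentiableAt ℝ f y := by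
    intro F _ _ f h h' y hy
    rcases mem_interior_or_exterior hy with hy | hy
    · exact h.differentiableAt hi hy
    · exact h'.differentiableAt he hy
  have hvf : ∀ x ∈ subfluid, fderiv ℝ (fun x => v₁ x - v₂ x) x = fderiv ℝ v₁ x - fderiv ℝ v₂ x :=
    fun x hx => fderiv_fun_sub (dv₁ x hx) (dv₂ x hx)
  have hqf : ∀ x ∈ subfluid, gradient (fun x => q₁ x - q₂ x) x = gradient q₁ x - gradient q₂ x :=
    fun x hx => gradient_sub_of_differentiableAt (dq₁ x hx) (dq₂ x hx)
  have hev : ∀ᶠ x in Bornology.cobounded Space ⊓ 𝓟 subfluid, x ∈ subfluid :=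
    mem_inf_of_right (mem_principal_self _)
  have hmeas : ∀ {f : Space → Space}, ContDiffOn ℝ 2 f subfluid → ∀ i : Fin 3,
      ContinuousOn (fun x => fderiv ℝ f x (EuclideanSpace.single i 1)) subfluid := by
    intro f hf i
    exact (hf.continuousOn_fderiv_of_isOpen isOpen_subfluid (by norm_num)).clm_apply
      continuousOn_const
  have hmeasq : ∀ {f : Space → ℝ}, ContDiffOn ℝ 1 f subfluid →
      ContinuousOn (fun x => gradient f x) subfluid := by
    intro f hf
    exact (InnerProductSpace.toDual ℝ Space).symm.continuous.comp_continuousOn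
      (hf.continuousOn_fderiv_of_isOpen isOpen_subfluid le_rfl)
  exact
  { v_C2 := h₁.v_C2.sub h₂.v_C2
    v_C1 := h₁.v_C1.sub h₂.v_C1
    q_C1 := h₁.q_C1.sub h₂.q_C1
    q_C0 := h₁.q_C0.sub h₂.q_C0
    u_int := h₁.u_int.sub hi h₂.u_int
    u_ext := h₁.u_ext.sub he h₂.u_ext
    p_int := h₁.p_int.sub hi h₂.p_int
    p_ext := h₁.p_ext.sub he h₂.p_ext
    v_decay := h₁.v_decay.sub h₂.v_decay
    grad_v_decay := (h₁.grad_v_decay.sub h₂.grad_v_decay).congr'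
      (hev.mono fun x hx => (hvf x hx).symm) EventuallyEq.rfl
    q_decay := h₁.q_decay.sub h₂.q_decay
    grad_q_decay := (h₁.grad_q_decay.sub h₂.grad_q_decay).congr'
      (hev.mono fun x hx => (hqf x hx).symm) EventuallyEq.rfl
    u_decay := h₁.u_decay.sub h₂.u_decay
    p_decay := h₁.p_decay.sub h₂.p_decay
    v_energy := by
      refine Integrable.mono' ((h₁.v_energy.add h₂.v_energy).const_mul 2) ?_ ?_
      · have hc : ContinuousOn (fun x => ∑ i : Fin 3, ‖fderiv ℝ (fun x => v₁ x - v₂ x) x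
            (EuclideanSpace.single i 1)‖ ^ 2) subfluid :=
          continuousOn_finsetSum _ fun i _ => (hmeas (h₁.v_C2.sub h₂.v_C2) i).norm.pow 2
        exact hc.aestronglyMeasurable measurableSet_subfluid
      · filter_upwards [ae_restrict_mem measurableSet_subfluid] with x hx
        rw [hvf x hx, Real.norm_of_nonneg (by positivity)]
        simp only [Pi.add_apply, ← Finset.sum_add_distrib, Finset.mul_sum]
        refine Finset.sum_le_sum fun i _ => ?_
        have := norm_sub_le (fderiv ℝ v₁ x (EuclideanSpace.single i 1))
          (fderiv ℝ v₂ x (EuclideanSpace.single i 1))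
        rw [sub_apply]
        refine (pow_le_pow_left₀ (norm_nonneg _) this 2).trans ?_
        nlinarith [sq_nonneg (‖fderiv ℝ v₁ x (EuclideanSpace.single i 1)‖ -
          ‖fderiv ℝ v₂ x (EuclideanSpace.single i 1)‖)]
    q_energy := by
      refine Integrable.mono' ((h₁.q_energy.add h₂.q_energy).const_mul 2) ?_ ?_
      · exact ((hmeasq (h₁.q_C1.sub h₂.q_C1)).norm.pow 2).aestronglyMeasurable
          measurableSet_subfluid
      · filter_upwards [ae_restrict_mem measurableSet_subfluid] with x hx
        rw [hqf x hx, Real.norm_of_nonneg (by positivity)]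
        simp only [Pi.add_apply]
        have := norm_sub_le (gradient q₁ x) (gradient q₂ x)
        refine (pow_le_pow_left₀ (norm_nonneg _) this 2).trans ?_
        nlinarith [sq_nonneg (‖gradient q₁ x‖ - ‖gradient q₂ x‖)]
    stokes := fun x hx => by
      have hl : Laplacian.laplacian (fun x => v₁ x - v₂ x) x =
          Laplacian.laplacian v₁ x - Laplacian.laplacian v₂ x :=
        (h₁.v_C2.contDiffAt (hB x hx)).laplacian_sub (h₂.v_C2.contDiffAt (hB x hx))
      rw [hqf x hx, hl]
      have e₁ := h₁.stokes x hx
      have e₂ := h₂.stokes x hx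
      -- The zero on the right is rewritten as the difference of the two Stokes residuals.
      rw [← sub_eq_zero.2 (e₁.trans e₂.symm)]
      abel
    div_v := fun x hx => by
      rw [divergence_sub_of_differentiableAt (dv₁ x hx) (dv₂ x hx), h₁.div_v x hx, h₂.div_v x hx,
        sub_zero]
    v_normal := fun y hy => by simp [h₁.v_normal y hy, h₂.v_normal y hy]
    v_tangential := fun y hy => by
      rw [tangentialPart_sub, h₁.v_tangential y hy, h₂.v_tangential y hy]
    grad_p := fun y hy => by
      have hy' := onBoundary_mem hy
      rw [gradient_sub_of_differentiableAt (hd h₁.p_int h₁.p_ext y hy)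
        (hd h₂.p_int h₂.p_ext y hy), h₁.grad_p y hy, h₂.grad_p y hy]
      simp only [normalDerivTrace]
      rw [fderivWithin_fun_sub (uniqueDiffOn_closedSubfluidDiff hγ.isCompact_range _ hy')
          ((h₁.v_C1 _ hy').differentiableWithinAt one_ne_zero)
          ((h₂.v_C1 _ hy').differentiableWithinAt one_ne_zero),
        sub_apply, tangentialPart_sub]
      abel
    div_u := fun y hy => by
      rw [divergence_sub_of_differentiableAt (hd h₁.u_int h₁.u_ext y hy)
        (hd h₂.u_int h₂.u_ext y hy), h₁.div_u y hy, h₂.div_u y hy, sub_zero]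
    jump_u := fun x hx => by
      have := (h₁.jump_u x hx).sub (h₂.jump_u x hx)
      simpa only [inner_sub_left, sub_zero] using this
    jump_p := fun x hx => by
      have := (h₁.jump_p x hx).sub (h₂.jump_p x hx)
      simpa only [sub_self] using this }

/-! ### The divergence theorem in the subfluid -/

lemma integral_comp_toLp {n : ℕ} {E : Type*} [NormedAddCommGroup E] [NormedSpace ℝ E]
    (f : EuclideanSpace ℝ (Fin n) → E) :
    ∫ x : Fin n → ℝ, f (WithLp.toLp 2 x) = ∫ x, f x :=
  (PiLp.volume_preserving_toLp (Fin n)).integral_comp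
    (MeasurableEquiv.toLp 2 (Fin n → ℝ)).measurableEmbedding f

lemma fderiv_eq_zero_of_eq_zero {E F : Type*} [NormedAddCommGroup E] [NormedSpace ℝ E]
    [NormedAddCommGroup F] [NormedSpace ℝ F] {f : E → F} {R : ℝ}
    (h : ∀ x, R ≤ ‖x‖ → f x = 0) {x : E} (hx : R < ‖x‖) : fderiv ℝ f x = 0 := by
  have : f =ᶠ[𝓝 x] fun _ => 0 := by
    filter_upwards [(isOpen_lt continuous_const continuous_norm).mem_nhds hx] with y hy
    exact h y (le_of_lt hy)
  rw [this.fderiv_eq]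
  simp

lemma abs_le_norm_toLp {n : ℕ} (x : Fin n → ℝ) (i : Fin n) : |x i| ≤ ‖WithLp.toLp 2 x‖ := by
  simpa using PiLp.norm_apply_le (WithLp.toLp 2 x) i

/-- The divergence theorem on the box `[-T, T]² × [-T, 0]`. With `T > R` the field vanishes on every
face except the top one, which lies in `∂B`. -/
theorem integral_subfluid_divergence {F : Space → Space}
    (hc : ContinuousOn F {x | x 2 ≤ 0}) {R : ℝ} (hR : ∀ x, R ≤ ‖x‖ → F x = 0)
    (hd : ∀ x ∈ subfluid, DifferentiableAt ℝ F x) (hi : IntegrableOn (divergence F) subfluid) :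
    ∫ x in subfluid, divergence F x = ∫ y : Plane, F (onBoundary y) 2 := by
  -- The maximum with `0` keeps the box nondegenerate when `R` is negative.
  set T : ℝ := max R 0 + 1 with hT
  have hT0 : 0 < T := by positivity
  have hRT : R < T := lt_of_le_of_lt (le_max_left _ _) (lt_add_one _)
  set a : Fin 3 → ℝ := ![-T, -T, -T] with ha
  set b : Fin 3 → ℝ := ![T, T, 0] with hb
  have hab : a ≤ b := by
    intro i; fin_cases i <;> simp [ha, hb] <;> linarith
  set A : Set (Fin 3 → ℝ) := {x | x 2 < 0} with hA
  have hAm : MeasurableSet A := measurableSet_lt (by fun_prop) measurable_const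
  let E := EuclideanSpace.equiv (Fin 3) ℝ
  set f : (Fin 3 → ℝ) → Fin 3 → ℝ := fun x => E (F (E.symm x)) with hf
  set f' : (Fin 3 → ℝ) → (Fin 3 → ℝ) →L[ℝ] (Fin 3 → ℝ) := fun x =>
    E.toContinuousLinearMap.comp ((fderiv ℝ F (E.symm x)).comp E.symm.toContinuousLinearMap)
    with hf'
  have hdiv : ∀ x, ∑ i, f' x (Pi.single i 1) i = divergence F (WithLp.toLp 2 x) := fun x => rfl
  have hfar : ∀ x : Fin 3 → ℝ, ∀ i, T ≤ |x i| → divergence F (WithLp.toLp 2 x) = 0 := by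
    intro x i hx
    have : R < ‖WithLp.toLp 2 x‖ := hRT.trans_le (hx.trans (abs_le_norm_toLp x i))
    simp [divergence, fderiv_eq_zero_of_eq_zero hR this]
  have hfar' : ∀ x : Fin 3 → ℝ, ∀ i, T ≤ |x i| → f x = 0 := by
    intro x i hx
    have : F (E.symm x) = 0 := hR _ (hRT.le.trans (hx.trans (abs_le_norm_toLp x i)))
    simp [hf, this]
  -- The derivative of `F` is controlled only where `x₃ < 0`; the closed box exceeds that region by
  -- part of a null plane.
  have hae : (Icc a b : Set (Fin 3 → ℝ)) =ᵐ[volume] (Icc a b ∩ A : Set (Fin 3 → ℝ)) := by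
    have hnull : volume {x : Fin 3 → ℝ | x 2 = 0} = 0 := Measure.pi_hyperplane _ 2 0
    have : ∀ᵐ x : Fin 3 → ℝ, x 2 ≠ 0 := by
      rw [ae_iff]; simpa using hnull
    filter_upwards [this] with x hx
    refine propext ⟨fun h => ⟨h, ?_⟩, fun h => h.1⟩
    exact lt_of_le_of_ne (by simpa [hb] using h.2 2) hx
  have hout : ∀ x ∈ A \ Icc a b, divergence F (WithLp.toLp 2 x) = 0 := by
    rintro x ⟨hx, hx'⟩
    by_contra hne
    have hlt : ∀ i, |x i| < T := fun i => by
      by_contra h; exact hne (hfar x i (not_lt.1 h))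
    refine hx' ⟨fun i => ?_, fun i => ?_⟩
    · have := (abs_lt.1 (hlt i)).1
      fin_cases i <;> simp [ha] at this ⊢ <;> linarith
    · have := (abs_lt.1 (hlt i)).2
      have h2 : x 2 < 0 := hx
      fin_cases i <;> simp [hb] at this ⊢ <;> linarith
  have hpre : (WithLp.toLp 2 : (Fin 3 → ℝ) → Space) ⁻¹' subfluid = A := rfl
  have hintA : IntegrableOn (fun x => divergence F (WithLp.toLp 2 x)) A := by
    rw [← hpre]
    exact ((PiLp.volume_preserving_toLp (Fin 3)).integrableOn_comp_preimage
      (MeasurableEquiv.toLp 2 (Fin 3 → ℝ)).measurableEmbedding).2 hi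
  have hint : IntegrableOn (fun x => ∑ i, f' x (Pi.single i 1) i) (Icc a b) := by
    simp only [hdiv]
    exact (hintA.mono_set inter_subset_right).congr_set_ae hae
  have hcont : ContinuousOn f (Icc a b) := by
    refine E.continuous.comp_continuousOn (hc.comp E.symm.continuous.continuousOn ?_)
    intro x hx
    have : x 2 ≤ 0 := hx.2 2
    exact this
  have key := integral_divergence_of_hasFDerivAt_off_countable a b hab f f' ∅ countable_empty hcont
    (fun x hx => by
      have hx2 : E.symm x ∈ subfluid := by
        have : x 2 < 0 := (hx.1 2 (mem_univ _)).2
        exact this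
      have h1 : HasFDerivAt (F ∘ E.symm) _ x :=
        (hd _ hx2).hasFDerivAt.comp x E.symm.hasFDerivAt
      exact E.hasFDerivAt.comp x h1) hint
  simp only [hdiv] at key
  rw [setIntegral_congr_set hae, ← setIntegral_eq_of_subset_of_forall_sdiff_eq_zero hAm
    inter_subset_right (fun x hx => hout x ⟨hx.1, fun h => hx.2 ⟨h, hx.1⟩⟩)] at key
  have hL : ∫ x in A, divergence F (WithLp.toLp 2 x) = ∫ x in subfluid, divergence F x := by
    rw [← hpre]
    exact (PiLp.volume_preserving_toLp (Fin 3)).setIntegral_preimage_emb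
      (MeasurableEquiv.toLp 2 (Fin 3 → ℝ)).measurableEmbedding (divergence F) subfluid
  rw [← hL, key]
  -- A point of a lateral or bottom face has a coordinate of modulus `T`, hence norm above `R`.
  have hface : ∀ (i : Fin 3) (c : ℝ) (x : Fin 2 → ℝ), T ≤ |c| → f (i.insertNth c x) i = 0 := by
    intro i c x hc
    rw [hfar' (i.insertNth c x) i (by simpa using hc)]
    rfl
  have hTT : T ≤ |T| := le_abs_self T
  have hTT' : T ≤ |-T| := by rw [abs_neg]; exact hTT
  rw [Fin.sum_univ_three]
  have e0 : ∀ x : Fin 2 → ℝ, f ((0 : Fin 3).insertNth (b 0) x) 0 = 0 := fun x => hface 0 T x hTT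
  have e0' : ∀ x : Fin 2 → ℝ, f ((0 : Fin 3).insertNth (a 0) x) 0 = 0 := fun x => hface 0 _ x hTT'
  have e1 : ∀ x : Fin 2 → ℝ, f ((1 : Fin 3).insertNth (b 1) x) 1 = 0 := fun x => hface 1 T x hTT
  have e1' : ∀ x : Fin 2 → ℝ, f ((1 : Fin 3).insertNth (a 1) x) 1 = 0 := fun x => hface 1 _ x hTT'
  have e2' : ∀ x : Fin 2 → ℝ, f ((2 : Fin 3).insertNth (a 2) x) 2 = 0 := fun x => hface 2 _ x hTT'
  simp only [e0, e0', e1, e1', e2', integral_zero, sub_zero, zero_add]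
  have e2 : ∀ x : Fin 2 → ℝ, f ((2 : Fin 3).insertNth (b 2) x) 2 =
      F (onBoundary (WithLp.toLp 2 x)) 2 := by
    intro x
    have : E.symm ((2 : Fin 3).insertNth (b 2) x) = onBoundary (WithLp.toLp 2 x) := by
      ext i
      fin_cases i
      · rfl
      · rfl
      · simp [hb, E]
    simp only [hf, this]
    rfl
  simp only [e2]
  rw [← integral_comp_toLp (fun y : Plane => F (onBoundary y) 2),
    setIntegral_eq_integral_of_forall_compl_eq_zero]
  intro x hx
  by_contra hne
  have hlt : ∀ i : Fin 2, |x i| < T := fun i => by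
    by_contra h
    refine hne ?_
    have : F (onBoundary (WithLp.toLp 2 x)) = 0 := by
      refine hR _ (hRT.le.trans ((not_lt.1 h).trans ?_))
      rw [norm_onBoundary]
      exact abs_le_norm_toLp x i
    simp [this]
  refine hx ⟨fun i => ?_, fun i => ?_⟩
  · have := (abs_lt.1 (hlt i)).1
    fin_cases i <;> simp [ha, Fin.succAbove] at this ⊢ <;> linarith
  · have := (abs_lt.1 (hlt i)).2
    fin_cases i <;> simp [hb, Fin.succAbove] at this ⊢ <;> linarith

/-! ### Cut-off functions -/

/-- Mollification of a Lipschitz function with values in `[0, 1]`. -/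
lemma exists_contDiff_lipschitz {E : Type*} [NormedAddCommGroup E] [InnerProductSpace ℝ E]
    [FiniteDimensional ℝ E] [MeasurableSpace E] [BorelSpace E] {f : E → ℝ} {L : NNReal}
    (hf : LipschitzWith L f) (h01 : ∀ x, f x ∈ Icc (0 : ℝ) 1) {r : ℝ} (hr : 0 < r) :
    ∃ g : E → ℝ, ContDiff ℝ 1 g ∧ LipschitzWith L g ∧ (∀ x, g x ∈ Icc (0 : ℝ) 1) ∧
      ∀ x, (∀ y ∈ Metric.ball x r, f y = f x) → g x = f x := by
  -- Averaging against a kernel of mass one preserves both the Lipschitz constant and the range.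
  -- Since the kernel lives in the ball of radius `r`, values are unchanged where `f` is constant on
  -- such a ball.
  let φ : ContDiffBump (0 : E) := ⟨r / 2, r, by positivity, by linarith⟩
  let μ : Measure E := volume
  have hint : ∀ x, Integrable (fun t => φ.normed μ t * f (x - t)) μ := by
    intro x
    have := hf.continuous
    exact (φ.continuous_normed.mul (by fun_prop)).integrable_of_hasCompactSupport
      φ.hasCompactSupport_normed.mul_right
  have hφ : ∫ t, φ.normed μ t ∂μ = 1 := φ.integral_normed
  have hφi : Integrable (φ.normed μ) μ := φ.integrable_normed
  have hφ0 : ∀ t, 0 ≤ φ.normed μ t := fun t => φ.nonneg_normed t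
  set g : E → ℝ := convolution (φ.normed μ) f (ContinuousLinearMap.lsmul ℝ ℝ) μ with hg
  have hgx : ∀ x, g x = ∫ t, φ.normed μ t * f (x - t) ∂μ := fun x => rfl
  refine ⟨g, ?_, ?_, ?_, ?_⟩
  · have := φ.hasCompactSupport_normed (μ := μ) |>.contDiff_convolution_left (n := 1)
      (ContinuousLinearMap.lsmul ℝ ℝ) (φ.contDiff_normed (n := 1))
      (hf.continuous.locallyIntegrable (μ := μ))
    exact_mod_cast this
  · refine LipschitzWith.of_dist_le_mul fun x y => ?_
    rw [Real.dist_eq, hgx, hgx, ← integral_sub (hint x) (hint y)]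
    calc |∫ t, (φ.normed μ t * f (x - t) - φ.normed μ t * f (y - t)) ∂μ|
        ≤ ∫ t, |φ.normed μ t * f (x - t) - φ.normed μ t * f (y - t)| ∂μ :=
          abs_integral_le_integral_abs
      _ ≤ ∫ t, φ.normed μ t * (L * dist x y) ∂μ := by
          refine integral_mono ((hint x).sub (hint y)).abs (hφi.mul_const _) fun t => ?_
          simp only
          rw [← mul_sub, abs_mul, abs_of_nonneg (hφ0 t)]
          refine mul_le_mul_of_nonneg_left ?_ (hφ0 t)
          have := hf.dist_le_mul (x - t) (y - t)
          rwa [Real.dist_eq, dist_sub_right] at this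
      _ = L * dist x y := by rw [integral_mul_const, hφ, one_mul]
  · intro x
    rw [hgx]
    refine ⟨integral_nonneg fun t => mul_nonneg (hφ0 t) (h01 _).1, ?_⟩
    rw [← hφ]
    exact integral_mono (hint x) hφi fun t => mul_le_of_le_one_right (hφ0 t) (h01 _).2
  · intro x hx
    exact φ.normed_convolution_eq_right hx

/-- The functions `η n` vanish near `K`, and tend to `1` off `K`. Their gradients are bounded by
`n + 1` and supported in sets of measure `O(n⁻²)`. -/
structure IsTubeCutoff (K : Set Space) (η : ℕ → Space → ℝ) (T : ℕ → Set Space) (C : ℝ) : Prop where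
  contDiff : ∀ n, ContDiff ℝ 1 (η n)
  mem_Icc : ∀ n x, η n x ∈ Icc (0 : ℝ) 1
  eventually_zero : ∀ n, ∀ x ∈ K, η n =ᶠ[𝓝 x] fun _ => 0
  eventually_one : ∀ x ∉ K, ∀ᶠ n in atTop, η n x = 1
  norm_fderiv_le : ∀ n x, ‖fderiv ℝ (η n) x‖ ≤ n + 1
  measurableSet : ∀ n, MeasurableSet (T n)
  fderiv_eq_zero : ∀ n, ∀ x ∉ T n, fderiv ℝ (η n) x = 0
  eventually_notMem : ∀ x ∉ K, ∀ᶠ n in atTop, x ∉ T n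
  volume_le : ∀ n, volume (T n) ≤ ENNReal.ofReal (C / (n + 1) ^ 2)

/-- The `n + 2` balls of radius `(3 + Λ)/(n + 1)` centred at the points `c (k/(n + 1))` cover the
tube. Their total volume is of order `n · n⁻³`, which is where codimension two enters. -/
lemma exists_volume_tube_le {c : ℝ → Space} {Λ : NNReal} (hc : LipschitzOnWith Λ c (Icc 0 1)) :
    ∃ C : ℝ, 0 ≤ C ∧ ∀ n : ℕ,
      volume {x : Space | Metric.infDist x (c '' Icc 0 1) ≤ 3 / (n + 1)} ≤
        ENNReal.ofReal (C / (n + 1) ^ 2) := by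
  set ω := (volume (Metric.ball (0 : Space) 1)).toReal with hω
  have hωt : volume (Metric.ball (0 : Space) 1) = ENNReal.ofReal ω :=
    (ENNReal.ofReal_toReal measure_ball_lt_top.ne).symm
  refine ⟨2 * (3 + Λ) ^ 3 * ω, by positivity, fun n => ?_⟩
  have hK : IsCompact (c '' Icc 0 1) := isCompact_Icc.image_of_continuousOn hc.continuousOn
  have hKne : (c '' Icc 0 1).Nonempty := ⟨c 0, 0, by simp, rfl⟩
  have hn : (0 : ℝ) < n + 1 := by positivity
  have hsub : {x : Space | Metric.infDist x (c '' Icc 0 1) ≤ 3 / (n + 1)} ⊆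
      ⋃ k ∈ Finset.range (n + 2), Metric.closedBall (c (k / (n + 1))) ((3 + Λ) / (n + 1)) := by
    intro x hx
    obtain ⟨_, ⟨t, ht, rfl⟩, hdist⟩ := hK.exists_infDist_eq_dist hKne x
    have hx' : dist x (c t) ≤ 3 / (n + 1) := by rw [← hdist]; exact hx
    have h0 : 0 ≤ t * (n + 1) := mul_nonneg ht.1 hn.le
    -- The nearest subdivision point to the left of `t`; moving there costs at most `Λ/(n + 1)`
    -- along the curve.
    set k := ⌊t * (n + 1)⌋₊ with hk
    have hk1 : (k : ℝ) ≤ t * (n + 1) := Nat.floor_le h0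
    have hk2 : t * (n + 1) < k + 1 := Nat.lt_floor_add_one _
    have hk3 : (k : ℝ) ≤ n + 1 := hk1.trans (by nlinarith [ht.2])
    refine mem_iUnion₂.2 ⟨k, ?_, ?_⟩
    · rw [Finset.mem_range]
      have : k ≤ n + 1 := by exact_mod_cast hk3
      omega
    · have hkm : (k : ℝ) / (n + 1) ∈ Icc (0 : ℝ) 1 :=
        ⟨by positivity, (div_le_one hn).2 hk3⟩
      have h1 := hc.dist_le_mul t ht _ hkm
      have h2 : dist t (k / (n + 1)) ≤ 1 / (n + 1) := by
        rw [Real.dist_eq, abs_le]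
        have e : t - k / (n + 1) = (t * (n + 1) - k) / (n + 1) := by field_simp
        rw [e]
        constructor
        · have : 0 ≤ (t * (n + 1) - k) / (n + 1) := div_nonneg (by linarith) hn.le
          have : (0 : ℝ) ≤ 1 / (n + 1) := by positivity
          linarith
        · gcongr
          linarith
      rw [Metric.mem_closedBall]
      calc dist x (c (k / (n + 1))) ≤ dist x (c t) + dist (c t) (c (k / (n + 1))) :=
            dist_triangle _ _ _
        _ ≤ 3 / (n + 1) + Λ * (1 / (n + 1)) := by
            refine add_le_add hx' (h1.trans ?_)
            gcongr
        _ = (3 + Λ) / (n + 1) := by ring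
  calc volume {x : Space | Metric.infDist x (c '' Icc 0 1) ≤ 3 / (n + 1)}
      ≤ ∑ k ∈ Finset.range (n + 2),
          volume (Metric.closedBall (c (k / (n + 1))) ((3 + Λ) / (n + 1))) :=
        (measure_mono hsub).trans (measure_biUnion_finset_le _ _)
    _ = (n + 2 : ℕ) * (ENNReal.ofReal (((3 + Λ) / (n + 1)) ^ 3) * ENNReal.ofReal ω) := by
        have : ∀ k : ℕ, volume (Metric.closedBall (c (k / (n + 1))) ((3 + Λ) / (n + 1))) =
            ENNReal.ofReal (((3 + Λ) / (n + 1)) ^ 3) * ENNReal.ofReal ω := by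
          intro k
          rw [Measure.addHaar_closedBall _ _ (by positivity), hωt]
          simp
        simp only [this, Finset.sum_const, Finset.card_range, nsmul_eq_mul]
    _ = ENNReal.ofReal ((n + 2 : ℕ) * (((3 + Λ) / (n + 1)) ^ 3 * ω)) := by
        rw [ENNReal.ofReal_mul (by positivity), ENNReal.ofReal_mul (by positivity),
          ENNReal.ofReal_natCast]
    _ ≤ ENNReal.ofReal (2 * (3 + Λ) ^ 3 * ω / (n + 1) ^ 2) := by
        refine ENNReal.ofReal_le_ofReal ?_
        have e : ((n + 2 : ℕ) : ℝ) * (((3 + Λ) / (n + 1)) ^ 3 * ω) =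
            ((n + 2) / (n + 1)) * ((3 + Λ) ^ 3 * ω / (n + 1) ^ 2) := by
          push_cast; field_simp
        have h2 : ((n : ℝ) + 2) / (n + 1) ≤ 2 := by
          rw [div_le_iff₀ hn]; linarith [(Nat.cast_nonneg n : (0 : ℝ) ≤ n)]
        rw [e]
        calc _ ≤ 2 * ((3 + Λ) ^ 3 * ω / (n + 1) ^ 2) := by gcongr
          _ = _ := by ring

/-- The cut-off is a mollification of `(n + 1) d - 1` clamped to `[0, 1]`, where `d` is the distance
to the curve. It is `0` for `(n + 1) d ≤ 1/2` and `1` for `(n + 1) d ≥ 5/2`, so its gradient lives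
in the tube `(n + 1) d ≤ 3`. -/
theorem exists_isTubeCutoff {c : ℝ → Space} {Λ : NNReal} (hc : LipschitzOnWith Λ c (Icc 0 1)) :
    ∃ η T C, IsTubeCutoff (c '' Icc 0 1) η T C := by
  obtain ⟨C, -, hC⟩ := exists_volume_tube_le hc
  set K := c '' Icc 0 1 with hKdef
  have hK : IsCompact K := isCompact_Icc.image_of_continuousOn hc.continuousOn
  have hKne : K.Nonempty := ⟨c 0, 0, by simp, rfl⟩
  have hpos : ∀ x ∉ K, 0 < Metric.infDist x K := fun x hx =>
    (hK.isClosed.notMem_iff_infDist_pos hKne).1 hx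
  have hN : ∀ n : ℕ, (0 : ℝ) < n + 1 := fun n => by positivity
  have hlip : ∀ n : ℕ, LipschitzWith (n + 1 : NNReal)
      (fun x : Space => max 0 (min 1 ((n + 1 : ℝ) * Metric.infDist x K - 1))) := by
    intro n
    refine LipschitzWith.const_max (LipschitzWith.const_min ?_ _) _
    refine LipschitzWith.of_dist_le_mul fun x y => ?_
    have := (Metric.lipschitz_infDist_pt K).dist_le_mul x y
    simp only [Real.dist_eq, NNReal.coe_one, one_mul] at this ⊢
    rw [show (n + 1 : ℝ) * Metric.infDist x K - 1 - ((n + 1) * Metric.infDist y K - 1) =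
      (n + 1) * (Metric.infDist x K - Metric.infDist y K) by ring, abs_mul, abs_of_pos (hN n)]
    push_cast
    exact mul_le_mul_of_nonneg_left this (hN n).le
  -- At this radius the mollification changes `(n + 1) d` by at most `1/2`.
  have hr : ∀ n : ℕ, (0 : ℝ) < 1 / (2 * (n + 1)) := fun n => by positivity
  choose η h1 h2 h3 h4 using fun n => exists_contDiff_lipschitz (hlip n)
    (fun x => ⟨le_max_left _ _, max_le zero_le_one (min_le_left _ _)⟩) (hr n)
  have hball : ∀ (n : ℕ) (x y : Space), y ∈ Metric.ball x (1 / (2 * (n + 1))) →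
      |(n + 1) * Metric.infDist x K - (n + 1) * Metric.infDist y K| ≤ 1 / 2 := by
    intro n x y hy
    have := (Metric.lipschitz_infDist_pt K).dist_le_mul x y
    simp only [Real.dist_eq, NNReal.coe_one, one_mul] at this
    rw [← mul_sub, abs_mul, abs_of_pos (hN n)]
    have hy' : dist x y ≤ 1 / (2 * (n + 1)) := by rw [dist_comm]; exact (Metric.mem_ball.1 hy).le
    calc (n + 1) * |Metric.infDist x K - Metric.infDist y K| ≤ (n + 1) * (1 / (2 * (n + 1))) :=
          mul_le_mul_of_nonneg_left (this.trans hy') (hN n).le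
      _ = 1 / 2 := by field_simp
  have hone : ∀ (n : ℕ) (x : Space), 5 / 2 ≤ (n + 1) * Metric.infDist x K → η n x = 1 := by
    intro n x hx
    have e : ∀ y, 2 ≤ (n + 1) * Metric.infDist y K →
        max 0 (min 1 ((n + 1 : ℝ) * Metric.infDist y K - 1)) = 1 := by
      intro y hy
      rw [min_eq_left (by linarith)]
      exact max_eq_right zero_le_one
    rw [h4 n x, e x (by linarith)]
    intro y hy
    have := abs_le.1 (hball n x y hy)
    rw [e x (by linarith), e y (by linarith)]
  have hzero : ∀ (n : ℕ) (x : Space), (n + 1) * Metric.infDist x K ≤ 1 / 2 → η n x = 0 := by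
    intro n x hx
    have e : ∀ y, (n + 1) * Metric.infDist y K ≤ 1 →
        max 0 (min 1 ((n + 1 : ℝ) * Metric.infDist y K - 1)) = 0 := by
      intro y hy
      exact max_eq_left ((min_le_right _ _).trans (by linarith))
    rw [h4 n x, e x (by linarith)]
    intro y hy
    have := abs_le.1 (hball n x y hy)
    rw [e x (by linarith), e y (by linarith)]
  have hcont : ∀ n : ℕ, Continuous fun x : Space => (n + 1 : ℝ) * Metric.infDist x K := fun n =>
    continuous_const.mul (Metric.continuous_infDist_pt K)
  have hlarge : ∀ x ∉ K, ∀ᶠ n : ℕ in atTop, 3 < ((n : ℝ) + 1) * Metric.infDist x K := by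
    intro x hx
    have : Tendsto (fun n : ℕ => ((n : ℝ) + 1) * Metric.infDist x K) atTop atTop :=
      (tendsto_atTop_add_const_right _ _ tendsto_natCast_atTop_atTop).atTop_mul_const (hpos x hx)
    exact this.eventually_gt_atTop 3
  have hmem : ∀ (n : ℕ) (x : Space), x ∉ {x : Space | Metric.infDist x K ≤ 3 / (n + 1)} ↔
      3 < ((n : ℝ) + 1) * Metric.infDist x K := by
    intro n x
    rw [mem_ofPred_eq, not_le, div_lt_iff₀ (hN n), mul_comm]
  refine ⟨η, fun n => {x | Metric.infDist x K ≤ 3 / (n + 1)}, C, h1, h3, ?_, ?_, ?_, ?_, ?_, ?_, hC⟩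
  · intro n x hx
    have h0 : (n + 1 : ℝ) * Metric.infDist x K < 1 / 2 := by
      rw [Metric.infDist_zero_of_mem hx]; norm_num
    filter_upwards [(isOpen_lt (hcont n) continuous_const).mem_nhds h0] with y hy
    exact hzero n y (le_of_lt hy)
  · intro x hx
    filter_upwards [hlarge x hx] with n hn
    exact hone n x (by linarith)
  · intro n x
    have := norm_fderiv_le_of_lipschitz ℝ (h2 n) (x₀ := x)
    simpa using this
  · intro n
    exact measurableSet_le (Metric.continuous_infDist_pt K).measurable measurable_const
  · intro n x hx
    rw [hmem] at hx
    have : η n =ᶠ[𝓝 x] fun _ => 1 := by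
      filter_upwards [(isOpen_lt continuous_const (hcont n)).mem_nhds hx] with y hy
      exact hone n y (by have : (3 : ℝ) < (n + 1) * Metric.infDist y K := hy; linarith)
    rw [this.fderiv_eq]
    simp
  · intro x hx
    filter_upwards [hlarge x hx] with n hn
    exact (hmem n x).2 hn

/-- The `L²` norm of the cut-off gradient is bounded but need not be small. The smallness comes from
`H`, whose `L²` mass on the tubes tends to zero because every point of `A` eventually leaves them.
-/
lemma IsTubeCutoff.tendsto_integral {K : Set Space} {η : ℕ → Space → ℝ} {T : ℕ → Set Space} {C : ℝ}
    (h : IsTubeCutoff K η T C) {A : Set Space} (hA : MeasurableSet A) (hAK : Disjoint A K)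
    {H : Space → Space} (hH : MemLp H 2 (volume.restrict A)) :
    Tendsto (fun n => ∫ x in A, fderiv ℝ (η n) x (H x)) atTop (𝓝 0) := by
  have hH2 : Integrable (fun x => ‖H x‖ ^ 2) (volume.restrict A) :=
    (memLp_two_iff_integrable_sq_norm hH.1).1 hH
  have hlim : Tendsto (fun n => ∫ x in A, (T n).indicator (fun x => ‖H x‖ ^ 2) x) atTop (𝓝 0) := by
    have := tendsto_integral_of_dominated_convergence (μ := volume.restrict A)
      (F := fun n => (T n).indicator (fun x => ‖H x‖ ^ 2)) (f := fun _ => (0 : ℝ))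
      (fun x => ‖H x‖ ^ 2) (fun n => (hH2.indicator (h.measurableSet n)).1) hH2
      (fun n => Eventually.of_forall fun x =>
        (norm_indicator_le_norm_self _ _).trans_eq (Real.norm_of_nonneg (sq_nonneg _)))
      (by
        filter_upwards [ae_restrict_mem hA] with x hx
        refine tendsto_const_nhds.congr' ?_
        filter_upwards [h.eventually_notMem x (disjoint_left.1 hAK hx)] with n hn
        rw [indicator_of_notMem hn])
    simpa using this
  rw [Metric.tendsto_atTop']
  intro ε hε
  -- The weight in Young's inequality `(n + 1)|H| ≤ l (n + 1)² + l⁻¹ |H|²`. The first term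
  -- integrates over the tube to at most `|C| l ≤ ε/2`, uniformly in `n`.
  set l : ℝ := ε / (2 * (|C| + 1)) with hl
  have hl0 : 0 < l := by positivity
  have hev : ∀ᶠ n in atTop, ∫ x in A, (T n).indicator (fun x => ‖H x‖ ^ 2) x < l * (ε / 2) :=
    hlim.eventually_lt_const (by positivity)
  obtain ⟨N, hN⟩ := eventually_atTop.1 hev
  refine ⟨N, fun n hn => ?_⟩
  have hn1 : (0 : ℝ) < n + 1 := by positivity
  have hTfin : volume (T n) < ⊤ := (h.volume_le n).trans_lt ENNReal.ofReal_lt_top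
  have hTle : (volume.restrict A).real (T n) ≤ |C| / (n + 1) ^ 2 := by
    refine ENNReal.toReal_le_of_le_ofReal (by positivity) ?_
    refine (Measure.restrict_apply_le _ _).trans ((h.volume_le n).trans ?_)
    refine ENNReal.ofReal_le_ofReal ?_
    gcongr
    exact le_abs_self C
  have hTi : Integrable ((T n).indicator fun _ => l * ((n : ℝ) + 1) ^ 2) (volume.restrict A) := by
    rw [integrable_indicator_iff (h.measurableSet n)]
    refine integrableOn_const ?_
    exact ((Measure.restrict_apply_le _ _).trans_lt hTfin).ne
  have hHi : Integrable (fun x => l⁻¹ * (T n).indicator (fun x => ‖H x‖ ^ 2) x)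
      (volume.restrict A) := (hH2.indicator (h.measurableSet n)).const_mul _
  rw [dist_zero_right]
  calc ‖∫ x in A, fderiv ℝ (η n) x (H x)‖
      ≤ ∫ x in A, ((T n).indicator (fun _ => l * ((n : ℝ) + 1) ^ 2) x +
          l⁻¹ * (T n).indicator (fun x => ‖H x‖ ^ 2) x) := by
        refine norm_integral_le_of_norm_le (hTi.add hHi) (Eventually.of_forall fun x => ?_)
        by_cases hx : x ∈ T n
        · simp only [indicator_of_mem hx]
          refine ((fderiv ℝ (η n) x).le_opNorm _).trans ?_
          refine (mul_le_mul_of_nonneg_right (h.norm_fderiv_le n x) (norm_nonneg _)).trans ?_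
          have e : l * ((n : ℝ) + 1) ^ 2 + l⁻¹ * ‖H x‖ ^ 2 - (n + 1) * ‖H x‖ =
              l⁻¹ * ((l * (n + 1) - ‖H x‖ / 2) ^ 2 + 3 / 4 * ‖H x‖ ^ 2) := by
            field_simp; ring
          have : 0 ≤ l⁻¹ * ((l * (n + 1) - ‖H x‖ / 2) ^ 2 + 3 / 4 * ‖H x‖ ^ 2) := by positivity
          linarith
        · simp [hx, h.fderiv_eq_zero n x hx]
    _ = (volume.restrict A).real (T n) * (l * ((n : ℝ) + 1) ^ 2) +
          l⁻¹ * ∫ x in A, (T n).indicator (fun x => ‖H x‖ ^ 2) x := by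
        rw [integral_add hTi hHi, integral_const_mul,
          integral_indicator_const _ (h.measurableSet n)]
        rfl
    _ < |C| / (n + 1) ^ 2 * (l * ((n : ℝ) + 1) ^ 2) + l⁻¹ * (l * (ε / 2)) := by
        refine add_lt_add_of_le_of_lt ?_ ?_
        · gcongr
        · exact mul_lt_mul_of_pos_left (hN n hn.le) (inv_pos.2 hl0)
    _ = |C| * l + ε / 2 := by field_simp
    _ ≤ ε := by
        have : |C| * l ≤ ε / 2 := by
          rw [hl, ← mul_div_assoc, div_le_div_iff₀ (by positivity) two_pos]
          nlinarith [abs_nonneg C]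
        linarith

/-! ### The divergence theorem for fields with singularities on `Γ` -/

/-- Sard's argument: the curve is the image of the plane under `z ↦ γ(z₀)`, whose derivative kills
the second basis vector and so has determinant zero everywhere. -/
lemma volume_range_eq_zero {γ : ℝ → Plane} (h : Differentiable ℝ γ) : volume (range γ) = 0 := by
  have hr : range γ = (fun z : Plane => γ (z 0)) '' univ := by
    ext y
    simp only [mem_range, image_univ]
    exact ⟨fun ⟨t, ht⟩ => ⟨EuclideanSpace.single 0 t, by simpa using ht⟩, fun ⟨z, hz⟩ => ⟨_, hz⟩⟩
  let P : Plane →L[ℝ] ℝ := EuclideanSpace.proj 0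
  rw [hr]
  refine addHaar_image_eq_zero_of_det_fderivWithin_eq_zero volume
    (f' := fun z => (fderiv ℝ γ (z 0)).comp P) (fun z _ => ?_) (fun z _ => ?_)
  · exact ((h (z 0)).hasFDerivAt.comp z P.hasFDerivAt).hasFDerivWithinAt
  · by_contra hne
    set A := (fderiv ℝ γ (z 0)).comp P
    have hinj := (LinearMap.equivOfDetNeZero (A : Plane →ₗ[ℝ] Plane) hne).injective
    have h0 : LinearMap.equivOfDetNeZero (A : Plane →ₗ[ℝ] Plane) hne (EuclideanSpace.single 1 1) =
        LinearMap.equivOfDetNeZero (A : Plane →ₗ[ℝ] Plane) hne 0 := by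
      change fderiv ℝ γ (z 0) (P (EuclideanSpace.single 1 1)) = fderiv ℝ γ (z 0) (P 0)
      simp [P]
    have := congrArg (fun x : Plane => x 1) (hinj h0)
    simp at this

lemma IsC2Jordan.restrict_compl {γ : ℝ → Plane} (hγ : IsC2Jordan γ) :
    (volume : Measure Plane).restrict (range γ)ᶜ = volume := by
  refine (Measure.restrict_congr_set (ae_eq_univ.2 ?_)).trans Measure.restrict_univ
  rw [compl_compl]
  exact volume_range_eq_zero (hγ.contDiff.differentiable two_ne_zero)

lemma divergence_smul {n : ℕ} {a : EuclideanSpace ℝ (Fin n) → ℝ}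
    {Y : EuclideanSpace ℝ (Fin n) → EuclideanSpace ℝ (Fin n)} {x : EuclideanSpace ℝ (Fin n)}
    (ha : DifferentiableAt ℝ a x) (hY : DifferentiableAt ℝ Y x) :
    divergence (fun x => a x • Y x) x = a x * divergence Y x + fderiv ℝ a x (Y x) := by
  have hsum : Y x = ∑ i, Y x i • EuclideanSpace.single i (1 : ℝ) := by
    ext j
    simp [Pi.single_apply]
  simp only [divergence]
  conv_rhs => rw [hsum]
  rw [fderiv_fun_smul ha hY, map_sum, Finset.mul_sum, ← Finset.sum_add_distrib]
  refine Finset.sum_congr rfl fun i _ => ?_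
  simp [mul_comm]

lemma integrable_mul_norm_of_memLp {A : Set Space} {κ : Space → ℝ}
    (hκ : Continuous κ) (hκc : HasCompactSupport κ) {Y : Space → Space}
    (hY : MemLp Y 2 (volume.restrict A)) :
    Integrable (fun x => κ x * ‖Y x‖) (volume.restrict A) :=
  ((hκ.memLp_of_hasCompactSupport (p := 2) hκc).restrict A).integrable_mul hY.norm

lemma integrable_fderiv_apply_of_memLp {A : Set Space} {θ : Space → ℝ}
    (hθ : ContDiff ℝ 1 θ) (hθc : HasCompactSupport θ) {Y : Space → Space}
    (hY : MemLp Y 2 (volume.restrict A)) :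
    Integrable (fun x => fderiv ℝ θ x (Y x)) (volume.restrict A) := by
  have hc : Continuous (fderiv ℝ θ) := hθ.continuous_fderiv one_ne_zero
  refine (integrable_mul_norm_of_memLp hc.norm (hθc.fderiv ℝ).norm hY).mono' ?_
    (Eventually.of_forall fun x => (fderiv ℝ θ x).le_opNorm _)
  have h : Continuous fun z : (Space →L[ℝ] ℝ) × Space => z.1 z.2 :=
    continuous_fst.clm_apply continuous_snd
  exact h.comp_aestronglyMeasurable (hc.aestronglyMeasurable.prodMk hY.1)

/-- The curve is invisible to `L²` fields. The field `η θ Y`, with `η` a tube cut-off, falls under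
`integral_subfluid_divergence`; as the tube shrinks, the term with `∇η` vanishes by
`IsTubeCutoff.tendsto_integral` and the others converge by domination. -/
theorem integral_subfluid_divergence_of_memLp {γ : ℝ → Plane} (hγ : IsC2Jordan γ)
    {Y : Space → Space} (hc : ContinuousOn Y (closedSubfluidDiff (range γ)))
    (hd : ∀ x ∈ subfluid, DifferentiableAt ℝ Y x) (hL2 : MemLp Y 2 (volume.restrict subfluid))
    (hdiv : IntegrableOn (divergence Y) subfluid) {θ : Space → ℝ} (hθ : ContDiff ℝ 1 θ)
    (hθc : HasCompactSupport θ) (hb : Integrable fun y => θ (onBoundary y) * Y (onBoundary y) 2) :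
    ∫ x in subfluid, (θ x * divergence Y x + fderiv ℝ θ x (Y x)) =
      ∫ y, θ (onBoundary y) * Y (onBoundary y) 2 := by
  have hlip : ∃ Λ, LipschitzOnWith Λ (fun t => onBoundary (γ t)) (Icc 0 1) := by
    have : ContDiff ℝ 1 fun t => onBoundary (γ t) :=
      onBoundaryL.contDiff.comp (hγ.contDiff.of_le one_le_two)
    exact this.contDiffOn.exists_lipschitzOnWith one_ne_zero (convex_Icc 0 1) isCompact_Icc
  obtain ⟨Λ, hΛ⟩ := hlip
  obtain ⟨η, T, C, hη⟩ := exists_isTubeCutoff hΛ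
  have hK : (fun t => onBoundary (γ t)) '' Icc 0 1 = onBoundary '' range γ := by
    rw [hγ.range_eq, image_image]
  rw [hK] at hη
  set K := onBoundary '' range γ with hKdef
  have hBK : Disjoint subfluid K := by
    rw [Set.disjoint_left]
    intro x hx
    exact (subfluid_subset (range γ) hx).2
  have hηd : ∀ n x, DifferentiableAt ℝ (η n) x := fun n x =>
    (hη.contDiff n).differentiable one_ne_zero x
  have hθd : ∀ x, DifferentiableAt ℝ θ x := fun x => hθ.differentiable one_ne_zero x
  obtain ⟨Cθ, hCθ⟩ := hθc.exists_bound_of_continuous hθ.continuous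
  have hθY : MemLp (fun x => θ x • Y x) 2 (volume.restrict subfluid) :=
    hL2.of_le_mul (c := Cθ) (hθ.continuous.aestronglyMeasurable.smul hL2.1)
      (Eventually.of_forall fun x => by
        rw [norm_smul]; exact mul_le_mul_of_nonneg_right (hCθ x) (norm_nonneg _))
  have hi1 : Integrable (fun x => θ x * divergence Y x) (volume.restrict subfluid) :=
    hdiv.bdd_mul hθ.continuous.aestronglyMeasurable (Eventually.of_forall hCθ)
  have hi2 : Integrable (fun x => fderiv ℝ θ x (Y x)) (volume.restrict subfluid) :=
    integrable_fderiv_apply_of_memLp hθ hθc hL2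
  have hi12 : Integrable (fun x => θ x * divergence Y x + fderiv ℝ θ x (Y x))
      (volume.restrict subfluid) := hi1.add hi2
  have hηb : ∀ n x, ‖η n x‖ ≤ 1 := fun n x => by
    rw [Real.norm_of_nonneg (hη.mem_Icc n x).1]; exact (hη.mem_Icc n x).2
  have hi12η : ∀ n, Integrable (fun x => η n x * (θ x * divergence Y x + fderiv ℝ θ x (Y x)))
      (volume.restrict subfluid) := fun n =>
    hi12.bdd_mul (hη.contDiff n).continuous.aestronglyMeasurable (Eventually.of_forall (hηb n))
  have hi3 : ∀ n, Integrable (fun x => fderiv ℝ (η n) x (θ x • Y x))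
      (volume.restrict subfluid) := by
    intro n
    have h1 := (integrable_mul_norm_of_memLp hθ.continuous.norm hθc.norm hL2).const_mul
      ((n : ℝ) + 1)
    refine h1.mono' ?_ (Eventually.of_forall fun x => ?_)
    · have h : Continuous fun z : (Space →L[ℝ] ℝ) × Space => z.1 z.2 :=
        continuous_fst.clm_apply continuous_snd
      exact h.comp_aestronglyMeasurable
        (((hη.contDiff n).continuous_fderiv one_ne_zero).aestronglyMeasurable.prodMk hθY.1)
    · refine ((fderiv ℝ (η n) x).le_opNorm _).trans ?_
      rw [norm_smul]
      exact mul_le_mul_of_nonneg_right (hη.norm_fderiv_le n x) (by positivity)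
  have hdivn : ∀ n, ∀ x ∈ subfluid, divergence (fun x => (η n x * θ x) • Y x) x =
      η n x * (θ x * divergence Y x + fderiv ℝ θ x (Y x)) + fderiv ℝ (η n) x (θ x • Y x) := by
    intro n x hx
    have hm : DifferentiableAt ℝ (fun x => η n x * θ x) x := (hηd n x).mul (hθd x)
    rw [divergence_smul hm (hd x hx), fderiv_fun_mul (hηd n x) (hθd x)]
    simp only [add_apply, smul_apply, map_smul, smul_eq_mul]
    ring
  have hid : ∀ n, (∫ x in subfluid, (η n x * (θ x * divergence Y x + fderiv ℝ θ x (Y x)))) +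
      ∫ x in subfluid, fderiv ℝ (η n) x (θ x • Y x) =
      ∫ y, η n (onBoundary y) * (θ (onBoundary y) * Y (onBoundary y) 2) := by
    intro n
    rw [← integral_add (hi12η n) (hi3 n),
      ← setIntegral_congr_fun measurableSet_subfluid (hdivn n)]
    obtain ⟨R, hR⟩ := hθc.isCompact.isBounded.exists_norm_le
    rw [integral_subfluid_divergence (F := fun x => (η n x * θ x) • Y x) (R := R + 1)]
    · simp only [PiLp.smul_apply, smul_eq_mul, mul_assoc]
    · intro x hx
      -- Nothing is known of `Y` on the curve, but there the cut-off field is zero in a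
      -- neighbourhood.
      by_cases hxK : x ∈ K
      · have : (fun x => (η n x * θ x) • Y x) =ᶠ[𝓝 x] fun _ => 0 := by
          filter_upwards [hη.eventually_zero n x hxK] with y hy
          rw [hy]; simp
        exact (continuousAt_const.congr this.symm).continuousWithinAt
      · have hcx : ContinuousWithinAt Y {x | x 2 ≤ 0} x := by
          refine (hc x ⟨hx, hxK⟩).mono_of_mem_nhdsWithin ?_
          have hKc : IsClosed K := (hγ.isCompact_range.image continuous_onBoundary).isClosed
          exact inter_mem_nhdsWithin _ (hKc.isOpen_compl.mem_nhds hxK)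
        exact ((hη.contDiff n).continuous.mul hθ.continuous).continuousWithinAt.smul hcx
    · intro x hx
      have : θ x = 0 := by
        by_contra h
        have := hR x (subset_tsupport _ h)
        linarith
      simp [this]
    · intro x hx
      exact ((hηd n x).mul (hθd x)).smul (hd x hx)
    · refine (((hi12η n).add (hi3 n)).congr ?_)
      filter_upwards [ae_restrict_mem measurableSet_subfluid] with x hx
      exact (hdivn n x hx).symm
  have hl1 : Tendsto (fun n => ∫ x in subfluid,
      (η n x * (θ x * divergence Y x + fderiv ℝ θ x (Y x)))) atTop
      (𝓝 (∫ x in subfluid, (θ x * divergence Y x + fderiv ℝ θ x (Y x)))) := by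
    refine tendsto_integral_of_dominated_convergence _ (fun n => (hi12η n).1) hi12.norm
      (fun n => Eventually.of_forall fun x => ?_) ?_
    · rw [norm_mul]
      exact mul_le_of_le_one_left (norm_nonneg _) (hηb n x)
    · filter_upwards [ae_restrict_mem measurableSet_subfluid] with x hx
      refine tendsto_const_nhds.congr' ?_
      filter_upwards [hη.eventually_one x (Set.disjoint_left.1 hBK hx)] with n hn
      rw [hn, one_mul]
  have hl2 := hη.tendsto_integral measurableSet_subfluid hBK hθY
  have hl3 : Tendsto (fun n => ∫ y, η n (onBoundary y) * (θ (onBoundary y) * Y (onBoundary y) 2))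
      atTop (𝓝 (∫ y, θ (onBoundary y) * Y (onBoundary y) 2)) := by
    refine tendsto_integral_of_dominated_convergence _ (fun n => ?_) hb.norm
      (fun n => Eventually.of_forall fun x => ?_) ?_
    · exact ((hη.contDiff n).continuous.comp continuous_onBoundary).aestronglyMeasurable.mul hb.1
    · rw [norm_mul]
      exact mul_le_of_le_one_left (norm_nonneg _) (hηb n _)
    · have hnull : ∀ᵐ y : Plane, y ∉ range γ :=
        measure_eq_zero_iff_ae_notMem.1
          (volume_range_eq_zero (hγ.contDiff.differentiable two_ne_zero))
      filter_upwards [hnull] with y hy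
      refine tendsto_const_nhds.congr' ?_
      filter_upwards [hη.eventually_one _ (onBoundary_mem hy).2] with n hn
      rw [hn, one_mul]
  have hl12 := hl1.add hl2
  rw [add_zero] at hl12
  exact tendsto_nhds_unique (hl12.congr hid) hl3

/-! ### Square integrability of decaying functions with finite energy -/

/-- Cauchy-Schwarz, read off from `∫ (h b - I)² ≥ 0` with `I = ∫ b`. -/
lemma sq_integral_le {b : ℝ → ℝ} {h : ℝ} (hh : 0 < h) (hb : ContinuousOn b (Icc 0 h)) :
    (∫ t in (0 : ℝ)..h, b t) ^ 2 ≤ h * ∫ t in (0 : ℝ)..h, b t ^ 2 := by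
  have hb' : ContinuousOn b (uIcc 0 h) := by rwa [uIcc_of_le hh.le]
  set I := ∫ t in (0 : ℝ)..h, b t with hI
  have h0 : 0 ≤ ∫ t in (0 : ℝ)..h, (h * b t - I) ^ 2 :=
    intervalIntegral.integral_nonneg hh.le fun t _ => sq_nonneg _
  have hi1 : IntervalIntegrable (fun t => h ^ 2 * b t ^ 2) volume 0 h :=
    ((hb'.pow 2).intervalIntegrable).const_mul _
  have hi2 : IntervalIntegrable (fun t => 2 * h * I * b t) volume 0 h :=
    (hb'.intervalIntegrable).const_mul _
  have e : ∫ t in (0 : ℝ)..h, (h * b t - I) ^ 2 =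
      h ^ 2 * (∫ t in (0 : ℝ)..h, b t ^ 2) - 2 * h * I * I + h * I ^ 2 := by
    have : ∀ t, (h * b t - I) ^ 2 = h ^ 2 * b t ^ 2 - 2 * h * I * b t + I ^ 2 := fun t => by ring
    simp only [this]
    rw [intervalIntegral.integral_add (hi1.sub hi2) intervalIntegrable_const,
      intervalIntegral.integral_sub hi1 hi2, intervalIntegral.integral_const_mul,
      intervalIntegral.integral_const_mul, intervalIntegral.integral_const,
      ← hI]
    simp
  rw [e] at h0
  have h1 : 0 ≤ h * (h * (∫ t in (0 : ℝ)..h, b t ^ 2) - I ^ 2) := by nlinarith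
  have := nonneg_of_mul_nonneg_right h1 hh
  linarith

lemma sub_smul_mem_subfluid {x : Space} (hx : x ∈ subfluid) {t : ℝ} (ht : 0 ≤ t) :
    x - t • EuclideanSpace.single 2 (1 : ℝ) ∈ subfluid := by
  rw [mem_subfluid] at *
  simp only [PiLp.sub_apply, PiLp.smul_apply, PiLp.single_apply, if_true, smul_eq_mul, mul_one]
  linarith

/-- The fundamental theorem of calculus along a vertical segment going down, followed by
Cauchy-Schwarz. It bounds `f` near the surface by its value at depth and by the energy in between.
-/
lemma norm_sq_le_vertical {E : Type*} [NormedAddCommGroup E] [NormedSpace ℝ E] [CompleteSpace E]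
    {f : Space → E} (hf : ContDiffOn ℝ 1 f subfluid) {x : Space} (hx : x ∈ subfluid) {h : ℝ}
    (hh : 0 < h) :
    ‖f x‖ ^ 2 ≤ 2 * ‖f (x - h • EuclideanSpace.single 2 (1 : ℝ))‖ ^ 2 + 2 * h *
      ∫ t in (0 : ℝ)..h, ‖fderiv ℝ f (x - t • EuclideanSpace.single 2 (1 : ℝ))
        (EuclideanSpace.single 2 1)‖ ^ 2 := by
  set e : Space := EuclideanSpace.single 2 (1 : ℝ) with he
  have hmaps : MapsTo (fun t : ℝ => x - t • e) (Icc 0 h) subfluid := fun t ht =>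
    sub_smul_mem_subfluid hx ht.1
  have hcont : ContinuousOn (fun t : ℝ => fderiv ℝ f (x - t • e) e) (Icc 0 h) :=
    ((hf.continuousOn_fderiv_of_isOpen isOpen_subfluid le_rfl).clm_apply continuousOn_const).comp
      (by fun_prop) hmaps
  have hcont' : ContinuousOn (fun t : ℝ => -fderiv ℝ f (x - t • e) e) (uIcc 0 h) := by
    rw [uIcc_of_le hh.le]; exact hcont.neg
  have hd : ∀ t ∈ uIcc 0 h, HasDerivAt (fun t : ℝ => f (x - t • e))
      (-fderiv ℝ f (x - t • e) e) t := by
    intro t ht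
    rw [uIcc_of_le hh.le] at ht
    have h1 : HasDerivAt (fun t : ℝ => x - t • e) (-e) t := by
      simpa using ((hasDerivAt_id t).smul_const e).const_sub x
    have h2 : HasFDerivAt f (fderiv ℝ f (x - t • e)) (x - t • e) :=
      ((hf.contDiffAt (isOpen_subfluid.mem_nhds (hmaps ht))).differentiableAt
        one_ne_zero).hasFDerivAt
    have := h2.comp_hasDerivAt t h1
    rwa [map_neg] at this
  have hftc := intervalIntegral.integral_eq_sub_of_hasDerivAt hd hcont'.intervalIntegrable
  have hle : ‖f (x - h • e) - f x‖ ≤ ∫ t in (0 : ℝ)..h, ‖fderiv ℝ f (x - t • e) e‖ := by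
    have h1 := intervalIntegral.norm_integral_le_integral_norm (μ := volume)
      (f := fun t : ℝ => -fderiv ℝ f (x - t • e) e) hh.le
    rw [hftc] at h1
    simpa using h1
  have hsq := sq_integral_le hh hcont.norm
  have htri : ‖f x‖ ≤ ‖f (x - h • e)‖ + ‖f (x - h • e) - f x‖ := by
    have := norm_sub_le (f (x - h • e)) (f (x - h • e) - f x)
    simpa using this
  have h3 : ‖f x‖ ^ 2 ≤ 2 * ‖f (x - h • e)‖ ^ 2 + 2 * ‖f (x - h • e) - f x‖ ^ 2 := by
    refine (pow_le_pow_left₀ (norm_nonneg _) htri 2).trans ?_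
    nlinarith [sq_nonneg (‖f (x - h • e)‖ - ‖f (x - h • e) - f x‖)]
  have h4 := pow_le_pow_left₀ (norm_nonneg _) hle 2
  linarith

/-- Far away, `|f|² = O(|x|⁻⁴)` is integrable in dimension three. In a ball of radius `R`, where `f`
may be unbounded near `Γ`, a descent of length `2R` reaches the region of decay; the energy picked
up on the way is summed over all starting points by Tonelli. -/
theorem memLp_two_of_decay {E : Type*} [NormedAddCommGroup E] [NormedSpace ℝ E]
    [FiniteDimensional ℝ E] {f : Space → E} (hf : ContDiffOn ℝ 1 f subfluid)
    (hd : IntegrableOn (fun x => ‖fderiv ℝ f x (EuclideanSpace.single 2 1)‖ ^ 2) subfluid)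
    (hO : f =O[Bornology.cobounded Space ⊓ 𝓟 subfluid] fun x => ‖x‖ ^ (-2 : ℤ)) :
    MemLp f 2 (volume.restrict subfluid) := by
  have : CompleteSpace E := FiniteDimensional.complete ℝ E
  have hfm : AEStronglyMeasurable f (volume.restrict subfluid) :=
    hf.continuousOn.aestronglyMeasurable measurableSet_subfluid
  rw [memLp_two_iff_integrable_sq_norm hfm]
  obtain ⟨C, hC0, hC⟩ := hO.exists_pos
  rw [isBigOWith_iff, eventually_inf_principal] at hC
  obtain ⟨R₀, -, hR₀⟩ := (hasBasis_cobounded_norm.eventually_iff).1 hC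
  set R : ℝ := max R₀ 1 with hR
  have hR1 : 1 ≤ R := le_max_right _ _
  have hR0 : 0 < R := by linarith
  have hbd : ∀ x ∈ subfluid, R ≤ ‖x‖ → ‖f x‖ ≤ C * (‖x‖ ^ 2)⁻¹ := by
    intro x hx hxR
    have := hR₀ (show R₀ ≤ ‖x‖ from (le_max_left _ _).trans hxR) hx
    rw [norm_zpow, norm_norm] at this
    exact_mod_cast this
  set e : Space := EuclideanSpace.single 2 (1 : ℝ) with he
  have hen : ‖e‖ = 1 := by simp [he]
  have hfar : IntegrableOn (fun x => ‖f x‖ ^ 2) (subfluid ∩ (Metric.ball 0 R)ᶜ) := by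
    have h1 : Integrable fun x : Space => C ^ 2 * 16 * (1 + ‖x‖) ^ (-(4 : ℝ)) :=
      (integrable_one_add_norm (by simp; norm_num)).const_mul _
    refine h1.integrableOn.mono' ((hfm.mono_measure
      (Measure.restrict_mono inter_subset_left le_rfl)).norm.pow 2) ?_
    filter_upwards [ae_restrict_mem (measurableSet_subfluid.inter measurableSet_ball.compl)]
      with x hx
    have hxR : R ≤ ‖x‖ := by simpa using hx.2
    have h1x : 1 ≤ ‖x‖ := hR1.trans hxR
    rw [Real.norm_of_nonneg (by positivity)]
    have e4 : (1 + ‖x‖) ^ (-(4 : ℝ)) = ((1 + ‖x‖) ^ 4)⁻¹ := by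
      rw [Real.rpow_neg (by positivity)]; norm_cast
    rw [e4]
    have h5 : (1 + ‖x‖) ^ 4 ≤ (2 * ‖x‖) ^ 4 := pow_le_pow_left₀ (by positivity) (by linarith) 4
    calc ‖f x‖ ^ 2 ≤ (C * (‖x‖ ^ 2)⁻¹) ^ 2 := pow_le_pow_left₀ (norm_nonneg _) (hbd x hx.1 hxR) 2
      _ = C ^ 2 * 16 * ((2 * ‖x‖) ^ 4)⁻¹ := by field_simp; norm_num
      _ ≤ C ^ 2 * 16 * ((1 + ‖x‖) ^ 4)⁻¹ := by gcongr
  have hnear : IntegrableOn (fun x => ‖f x‖ ^ 2) (subfluid ∩ Metric.ball 0 R) := by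
    -- Extension by zero to the whole space makes the translation invariance of Lebesgue measure
    -- available.
    set g : Space → ENNReal := fun x => subfluid.indicator
      (fun x => ENNReal.ofReal (‖fderiv ℝ f x e‖ ^ 2)) x with hg
    have hcd : ContinuousOn (fun x => fderiv ℝ f x e) subfluid :=
      (hf.continuousOn_fderiv_of_isOpen isOpen_subfluid le_rfl).clm_apply continuousOn_const
    have hgm : Measurable g := by
      have h1 : ContinuousOn (fun x => ENNReal.ofReal (‖fderiv ℝ f x e‖ ^ 2)) subfluid :=
        ENNReal.continuous_ofReal.comp_continuousOn (hcd.norm.pow 2)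
      classical
      have := h1.measurable_piecewise (g := 0) continuousOn_const measurableSet_subfluid
      rwa [Set.piecewise_eq_indicator] at this
    have hgi : ∫⁻ x, g x < ⊤ := by
      rw [lintegral_indicator measurableSet_subfluid]
      have := hd.lintegral_lt_top
      exact this
    have hle : ∀ x ∈ subfluid ∩ Metric.ball 0 R, ENNReal.ofReal (‖f x‖ ^ 2) ≤
        ENNReal.ofReal (2 * C ^ 2) + ENNReal.ofReal (2 * (2 * R)) *
          ∫⁻ t in Ioc 0 (2 * R), g (x - t • e) := by
      intro x hx
      have h1 := norm_sq_le_vertical hf hx.1 (h := 2 * R) (by positivity)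
      have hxR : ‖x‖ < R := by simpa using hx.2
      -- The length `2R` is chosen so that every point of the ball of radius `R` leaves it.
      have h2 : R ≤ ‖x - (2 * R) • e‖ := by
        have := norm_sub_norm_le ((2 * R) • e) x
        rw [norm_smul, hen, norm_sub_rev, Real.norm_of_nonneg (by positivity)] at this
        linarith
      have h3 : ‖f (x - (2 * R) • e)‖ ≤ C := by
        refine (hbd _ (sub_smul_mem_subfluid hx.1 (by positivity)) h2).trans ?_
        refine mul_le_of_le_one_right hC0.le (inv_le_one_of_one_le₀ ?_)
        exact one_le_pow₀ (hR1.trans h2)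
      have h4 : ‖f x‖ ^ 2 ≤ 2 * C ^ 2 + 2 * (2 * R) *
          ∫ t in (0 : ℝ)..(2 * R), ‖fderiv ℝ f (x - t • e) e‖ ^ 2 := by
        refine h1.trans (add_le_add_left ?_ _)
        exact mul_le_mul_of_nonneg_left (pow_le_pow_left₀ (norm_nonneg _) h3 2) two_pos.le
      have hmaps : MapsTo (fun t : ℝ => x - t • e) (Icc 0 (2 * R)) subfluid := fun t ht =>
        sub_smul_mem_subfluid hx.1 ht.1
      have hcc : ContinuousOn (fun t : ℝ => ‖fderiv ℝ f (x - t • e) e‖ ^ 2) (Icc 0 (2 * R)) :=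
        ((hcd.comp (by fun_prop) hmaps).norm.pow 2)
      have hii : IntegrableOn (fun t : ℝ => ‖fderiv ℝ f (x - t • e) e‖ ^ 2) (Ioc 0 (2 * R)) :=
        (hcc.integrableOn_Icc).mono_set Ioc_subset_Icc_self
      have h5 : ENNReal.ofReal (∫ t in (0 : ℝ)..(2 * R), ‖fderiv ℝ f (x - t • e) e‖ ^ 2) =
          ∫⁻ t in Ioc 0 (2 * R), g (x - t • e) := by
        rw [intervalIntegral.integral_of_le (by positivity),
          ofReal_integral_eq_lintegral_ofReal hii (Eventually.of_forall fun t => by positivity)]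
        refine setLIntegral_congr_fun measurableSet_Ioc fun t ht => ?_
        simp only [hg]
        rw [indicator_of_mem (hmaps (Ioc_subset_Icc_self ht))]
      refine (ENNReal.ofReal_le_ofReal h4).trans ?_
      rw [ENNReal.ofReal_add (by positivity) (by
        have : 0 ≤ ∫ t in (0 : ℝ)..(2 * R), ‖fderiv ℝ f (x - t • e) e‖ ^ 2 :=
          intervalIntegral.integral_nonneg (by positivity) fun t _ => by positivity
        positivity), ENNReal.ofReal_mul (p := 2 * (2 * R)) (by positivity), h5]
    have hm : MeasurableSet (subfluid ∩ Metric.ball (0 : Space) R) :=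
      measurableSet_subfluid.inter measurableSet_ball
    have hprod : Measurable fun z : Space × ℝ => g (z.1 - z.2 • e) := hgm.comp (by fun_prop)
    refine ⟨(hfm.mono_measure (Measure.restrict_mono inter_subset_left le_rfl)).norm.pow 2, ?_⟩
    rw [hasFiniteIntegral_iff_ofReal (Eventually.of_forall fun x => by positivity)]
    calc ∫⁻ x in subfluid ∩ Metric.ball 0 R, ENNReal.ofReal (‖f x‖ ^ 2)
        ≤ ∫⁻ x in subfluid ∩ Metric.ball 0 R, (ENNReal.ofReal (2 * C ^ 2) +
          ENNReal.ofReal (2 * (2 * R)) * ∫⁻ t in Ioc 0 (2 * R), g (x - t • e)) :=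
          setLIntegral_mono' hm hle
      _ = ENNReal.ofReal (2 * C ^ 2) * volume (subfluid ∩ Metric.ball (0 : Space) R) +
          ENNReal.ofReal (2 * (2 * R)) * ∫⁻ x in subfluid ∩ Metric.ball 0 R,
            ∫⁻ t in Ioc 0 (2 * R), g (x - t • e) := by
          rw [lintegral_add_left measurable_const, setLIntegral_const, lintegral_const_mul]
          exact hprod.lintegral_prod_right'
      _ ≤ ENNReal.ofReal (2 * C ^ 2) * volume (Metric.ball (0 : Space) R) +
          ENNReal.ofReal (2 * (2 * R)) * ∫⁻ x, ∫⁻ t in Ioc 0 (2 * R), g (x - t • e) := by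
          gcongr
          · exact inter_subset_right
          · exact Measure.restrict_le_self
      _ = ENNReal.ofReal (2 * C ^ 2) * volume (Metric.ball (0 : Space) R) +
          ENNReal.ofReal (2 * (2 * R)) * (ENNReal.ofReal (2 * R) * ∫⁻ x, g x) := by
          -- After the swap the integral over `x` does not depend on the shift `t`, which
          -- contributes only the factor `2R`.
          rw [lintegral_lintegral_swap hprod.aemeasurable]
          simp only [lintegral_sub_right_eq_self g, lintegral_const, Measure.restrict_apply_univ,
            Real.volume_Ioc, sub_zero]
          rw [mul_comm (∫⁻ x, g x)]
      _ < ⊤ := by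
          refine ENNReal.add_lt_top.2 ⟨ENNReal.mul_lt_top ENNReal.ofReal_lt_top
            measure_ball_lt_top, ENNReal.mul_lt_top ENNReal.ofReal_lt_top
            (ENNReal.mul_lt_top ENNReal.ofReal_lt_top hgi)⟩
  have := hnear.union hfar
  rwa [inter_union_compl] at this

/-! ### Coordinates near the curve -/

/-- The determinant of two vectors of the plane. -/
def cross (a b : Plane) : ℝ := a 0 * b 1 - a 1 * b 0

/-- The map `(t, s) ↦ γ(t) + s n`. -/
noncomputable def strip (γ : ℝ → Plane) (n : Plane) (z : ℝ × ℝ) : Plane := γ z.1 + z.2 • n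

/-- The divergence of `ψ w`, expanded by the product rule. -/
noncomputable def weightedDivergence (w : Plane → Plane) (ψ : Plane → ℝ) (y : Plane) : ℝ :=
  ψ y * divergence w y + fderiv ℝ ψ y (w y)

lemma continuous_strip {γ : ℝ → Plane} (hγ : Continuous γ) (n : Plane) :
    Continuous (strip γ n) := by
  unfold strip
  fun_prop

lemma plane_eq (a : Plane) :
    a = a 0 • EuclideanSpace.single 0 (1 : ℝ) + a 1 • EuclideanSpace.single 1 (1 : ℝ) := by
  ext i; fin_cases i <;> simp

/-- The derivative of the determinant is multiplication by the trace. It is what makes the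
divergence transform well in the coordinates `strip γ n`. -/
lemma cross_apply_add (D : Plane →L[ℝ] Plane) (a b : Plane) :
    cross (D a) b + cross a (D b) =
      cross a b * ∑ i, D (EuclideanSpace.single i 1) i := by
  have ha : D a = a 0 • D (EuclideanSpace.single 0 (1 : ℝ)) +
      a 1 • D (EuclideanSpace.single 1 (1 : ℝ)) := by
    conv_lhs => rw [plane_eq a]
    simp only [map_add, map_smul]
  have hb : D b = b 0 • D (EuclideanSpace.single 0 (1 : ℝ)) +
      b 1 • D (EuclideanSpace.single 1 (1 : ℝ)) := by
    conv_lhs => rw [plane_eq b]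
    simp only [map_add, map_smul]
  rw [ha, hb, Fin.sum_univ_two]
  simp only [cross, PiLp.add_apply, PiLp.smul_apply, smul_eq_mul]
  ring

lemma hasFDerivAt_strip {γ : ℝ → Plane} {n : Plane} {z : ℝ × ℝ} (h : DifferentiableAt ℝ γ z.1) :
    HasFDerivAt (strip γ n) ((ContinuousLinearMap.fst ℝ ℝ ℝ).smulRight (deriv γ z.1) +
      (ContinuousLinearMap.snd ℝ ℝ ℝ).smulRight n) z := by
  have h1 : HasFDerivAt (fun z : ℝ × ℝ => γ z.1) _ z :=
    h.hasDerivAt.hasFDerivAt.comp z hasFDerivAt_fst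
  have h2 : HasFDerivAt (fun z : ℝ × ℝ => z.2 • n) _ z :=
    ((ContinuousLinearMap.snd ℝ ℝ ℝ).hasFDerivAt (x := z)).smul_const n
  refine (h1.add h2).congr_fderiv ?_
  ext <;> simp

lemma ae_eq_Icc_prod (a b : ℝ × ℝ) :
    (Ioo a.1 b.1 ×ˢ Ioo a.2 b.2 : Set (ℝ × ℝ)) =ᵐ[volume] Icc a b := by
  rw [← Prod.mk.eta (p := a), ← Prod.mk.eta (p := b), ← Icc_prod_Icc]
  exact Measure.set_prod_ae_eq Ioo_ae_eq_Icc Ioo_ae_eq_Icc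

/-- The divergence theorem on one side of the curve, in the coordinates `strip γ n`. -/
lemma integral_rectangle_side {γ : ℝ → Plane} (hγ : ContDiff ℝ 2 γ) (n : Plane) {Ω : Set Plane}
    (hΩ : IsOpen Ω) {w w₀ : Plane → Plane} {w₁ : Plane → Plane →L[ℝ] Plane}
    (hw : ContDiffOn ℝ 1 w Ω) (hw₀ : ContinuousOn w₀ (closure Ω)) (e₀ : EqOn w w₀ Ω)
    (hw₁ : ContinuousOn w₁ (closure Ω)) (e₁ : EqOn (fderiv ℝ w) w₁ Ω) {ψ : Plane → ℝ}
    (hψ : ContDiff ℝ 1 ψ) {a b : ℝ × ℝ} (h1 : a.1 < b.1) (h2 : a.2 < b.2)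
    (hmaps : MapsTo (strip γ n) (Ioo a.1 b.1 ×ˢ Ioo a.2 b.2) Ω)
    (hl : ∀ s ∈ Icc a.2 b.2, ψ (strip γ n (a.1, s)) = 0)
    (hr : ∀ s ∈ Icc a.2 b.2, ψ (strip γ n (b.1, s)) = 0) :
    IntegrableOn (fun z => cross (deriv γ z.1) n * weightedDivergence w ψ (strip γ n z))
        (Icc a b) ∧
      ∫ z in Icc a b, cross (deriv γ z.1) n * weightedDivergence w ψ (strip γ n z) =
        (∫ t in a.1..b.1, ψ (strip γ n (t, b.2)) *
          cross (deriv γ t) (w₀ (strip γ n (t, b.2)))) -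
        ∫ t in a.1..b.1, ψ (strip γ n (t, a.2)) *
          cross (deriv γ t) (w₀ (strip γ n (t, a.2))) := by
  have hγd : Differentiable ℝ γ := hγ.differentiable two_ne_zero
  have hγ' : ContDiff ℝ 1 (deriv γ) := hγ.deriv'
  have hsc := continuous_strip hγ.continuous n
  -- One edge of the rectangle may lie on the curve, outside `Ω`; the continuous extensions `w₀` and
  -- `w₁` are still available there.
  have hcl : MapsTo (strip γ n) (Icc a b) (closure Ω) := by
    have : closure (Ioo a.1 b.1 ×ˢ Ioo a.2 b.2) = Icc a b := by
      rw [closure_prod_eq, closure_Ioo h1.ne, closure_Ioo h2.ne, Icc_prod_Icc]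
    rw [← this]
    exact hmaps.closure hsc
  have hw₀c : ContinuousOn (fun z => w₀ (strip γ n z)) (Icc a b) :=
    hw₀.comp hsc.continuousOn hcl
  have hw₁c : ContinuousOn (fun z => w₁ (strip γ n z)) (Icc a b) :=
    hw₁.comp hsc.continuousOn hcl
  have hψc : Continuous fun z => ψ (strip γ n z) := hψ.continuous.comp hsc
  have hψ'c : Continuous fun z => fderiv ℝ ψ (strip γ n z) :=
    (hψ.continuous_fderiv one_ne_zero).comp hsc
  have hcoord : ∀ {f : ℝ × ℝ → Plane} {s : Set (ℝ × ℝ)} (i : Fin 2), ContinuousOn f s →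
      ContinuousOn (fun z => f z i) s := fun i hf =>
    (EuclideanSpace.proj (𝕜 := ℝ) i).continuous.comp_continuousOn hf
  have hγ'c : ∀ i : Fin 2, Continuous fun z : ℝ × ℝ => deriv γ z.1 i := fun i =>
    (EuclideanSpace.proj (𝕜 := ℝ) i).continuous.comp (hγ'.continuous.comp continuous_fst)
  -- The functions `f` and `g` are the components of the Piola transform of `ψ w`: `∂ₜ f + ∂ₛ g` is
  -- the Jacobian `cross γ' n` times the divergence of `ψ w`. Differentiability of `g` involves
  -- `γ''`, hence the class `C²`.
  set f : ℝ × ℝ → ℝ := fun z => ψ (strip γ n z) * cross (w₀ (strip γ n z)) n with hf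
  set g : ℝ × ℝ → ℝ := fun z => ψ (strip γ n z) * cross (deriv γ z.1) (w₀ (strip γ n z)) with hg
  have hfc : ContinuousOn f (Icc a b) :=
    hψc.continuousOn.mul (((hcoord 0 hw₀c).mul continuousOn_const).sub
      ((hcoord 1 hw₀c).mul continuousOn_const))
  have hgc : ContinuousOn g (Icc a b) :=
    hψc.continuousOn.mul (((hγ'c 0).continuousOn.mul (hcoord 1 hw₀c)).sub
      ((hγ'c 1).continuousOn.mul (hcoord 0 hw₀c)))
  have hder : ∀ z ∈ Ioo a.1 b.1 ×ˢ Ioo a.2 b.2, DifferentiableAt ℝ f z ∧ DifferentiableAt ℝ g z ∧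
      fderiv ℝ f z (1, 0) + fderiv ℝ g z (0, 1) =
        cross (deriv γ z.1) n * weightedDivergence w ψ (strip γ n z) := by
    intro z hz
    have hy := hmaps hz
    have hwd : DifferentiableAt ℝ w (strip γ n z) :=
      (hw.contDiffAt (hΩ.mem_nhds hy)).differentiableAt one_ne_zero
    have hψd : DifferentiableAt ℝ ψ (strip γ n z) := hψ.differentiable one_ne_zero _
    set W : Plane → Plane := fun y => ψ y • w y with hW
    have hWd : DifferentiableAt ℝ W (strip γ n z) := hψd.smul hwd
    set D := fderiv ℝ W (strip γ n z) with hD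
    have hst := hasFDerivAt_strip (n := n) (hγd z.1)
    have hWs : HasFDerivAt (fun z => W (strip γ n z)) _ z := hWd.hasFDerivAt.comp z hst
    have hWi : ∀ i : Fin 2, HasFDerivAt (fun z => W (strip γ n z) i) _ z := fun i =>
      (EuclideanSpace.proj i : Plane →L[ℝ] ℝ).hasFDerivAt.comp z hWs
    have hγi : ∀ i : Fin 2, HasFDerivAt (fun z : ℝ × ℝ => deriv γ z.1 i) _ z := fun i =>
      (EuclideanSpace.proj i : Plane →L[ℝ] ℝ).hasFDerivAt.comp z
        (((hγ'.differentiable one_ne_zero) z.1).hasDerivAt.hasFDerivAt.comp z hasFDerivAt_fst)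
    have hnhds : ∀ᶠ z' in 𝓝 z, w (strip γ n z') = w₀ (strip γ n z') := by
      filter_upwards [hsc.continuousAt.preimage_mem_nhds (hΩ.mem_nhds hy)] with z' hz'
      exact e₀ hz'
    have hf1 := ((hWi 0).mul_const (n 1)).sub ((hWi 1).mul_const (n 0))
    have hg1 := ((hγi 0).mul (hWi 1)).sub ((hγi 1).mul (hWi 0))
    have hf2 : HasFDerivAt f _ z := hf1.congr_of_eventuallyEq (by
      filter_upwards [hnhds] with z' hz'
      simp only [hf, hW, cross, ← hz', PiLp.smul_apply, smul_eq_mul, Pi.sub_apply]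
      ring)
    have hg2 : HasFDerivAt g _ z := hg1.congr_of_eventuallyEq (by
      filter_upwards [hnhds] with z' hz'
      simp only [hg, hW, cross, ← hz', PiLp.smul_apply, smul_eq_mul, Pi.sub_apply, Pi.mul_apply]
      ring)
    refine ⟨hf2.differentiableAt, hg2.differentiableAt, ?_⟩
    have hdiv : weightedDivergence w ψ (strip γ n z) = ∑ i, D (EuclideanSpace.single i 1) i :=
      (divergence_smul hψd hwd).symm
    rw [hdiv, ← cross_apply_add, hf2.fderiv, hg2.fderiv]
    simp [cross]
    ring
  have hae : ∀ᵐ z ∂(volume.restrict (Icc a b)), z ∈ Ioo a.1 b.1 ×ˢ Ioo a.2 b.2 := by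
    rw [← Measure.restrict_congr_set (ae_eq_Icc_prod a b)]
    exact ae_restrict_mem (measurableSet_Ioo.prod measurableSet_Ioo)
  have hint : IntegrableOn
      (fun z => cross (deriv γ z.1) n * weightedDivergence w ψ (strip γ n z)) (Icc a b) := by
    have hc : ContinuousOn (fun z => cross (deriv γ z.1) n *
        (ψ (strip γ n z) * (∑ i, w₁ (strip γ n z) (EuclideanSpace.single i 1) i) +
          fderiv ℝ ψ (strip γ n z) (w₀ (strip γ n z)))) (Icc a b) := by
      refine ContinuousOn.mul ?_ ((hψc.continuousOn.mul (continuousOn_finsetSum _ fun i _ =>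
        hcoord i (hw₁c.clm_apply continuousOn_const))).add (hψ'c.continuousOn.clm_apply hw₀c))
      exact (((hγ'c 0).mul continuous_const).sub ((hγ'c 1).mul continuous_const)).continuousOn
    refine (hc.integrableOn_compact isCompact_Icc).congr ?_
    filter_upwards [hae] with z hz
    have hy := hmaps hz
    simp only [weightedDivergence, divergence, e₀ hy, e₁ hy]
  refine ⟨hint, ?_⟩
  have hint' : IntegrableOn (fun z => fderiv ℝ f z (1, 0) + fderiv ℝ g z (0, 1)) (Icc a b) := by
    refine hint.congr ?_
    filter_upwards [hae] with z hz
    exact (hder z hz).2.2.symm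
  have key := integral_divergence_prod_Icc_of_hasFDerivAt_off_countable_of_le f g (fderiv ℝ f)
    (fderiv ℝ g) a b ⟨h1.le, h2.le⟩ ∅ countable_empty hfc hgc
    (fun z hz => (hder z hz.1).1.hasFDerivAt) (fun z hz => (hder z hz.1).2.1.hasFDerivAt) hint'
  have hcongr : ∫ z in Icc a b, cross (deriv γ z.1) n * weightedDivergence w ψ (strip γ n z) =
      ∫ z in Icc a b, fderiv ℝ f z (1, 0) + fderiv ℝ g z (0, 1) := by
    refine integral_congr_ae ?_
    filter_upwards [hae] with z hz
    exact (hder z hz).2.2.symm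
  -- There is no flux through the two sides, where `ψ` vanishes.
  have hfl : ∫ s in a.2..b.2, f (a.1, s) = 0 := by
    rw [intervalIntegral.integral_congr (g := fun _ => 0), intervalIntegral.integral_zero]
    intro s hs
    rw [uIcc_of_le h2.le] at hs
    simp [hf, hl s hs]
  have hfr : ∫ s in a.2..b.2, f (b.1, s) = 0 := by
    rw [intervalIntegral.integral_congr (g := fun _ => 0), intervalIntegral.integral_zero]
    intro s hs
    rw [uIcc_of_le h2.le] at hs
    simp [hf, hr s hs]
  rw [hcongr, key, hfl, hfr, add_zero, sub_zero]

/-- Change of variables in the coordinates `strip γ n`. -/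
lemma integral_strip_image {γ : ℝ → Plane} (hγ : Differentiable ℝ γ) (n : Plane) {Q : Set (ℝ × ℝ)}
    (hQ : MeasurableSet Q) (hinj : InjOn (strip γ n) Q) (G : Plane → ℝ) :
    ∫ y in strip γ n '' Q, G y = ∫ z in Q, |cross (deriv γ z.1) n| * G (strip γ n z) := by
  let e : ℝ × ℝ → Plane := fun z => !₂[z.1, z.2]
  let i : Plane → ℝ × ℝ := fun y => (y 0, y 1)
  let iL : Plane →L[ℝ] ℝ × ℝ := (EuclideanSpace.proj 0).prod (EuclideanSpace.proj 1)
  have hei : ∀ y, e (i y) = y := fun y => by ext k; fin_cases k <;> simp [e, i]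
  have hie : ∀ z, i (e z) = z := fun z => by simp [e, i]
  have hem : MeasurePreserving e := by
    have h1 := (volume_preserving_finTwoArrow ℝ).symm
    exact (PiLp.volume_preserving_toLp (Fin 2)).comp h1
  have hec : Continuous e := by fun_prop
  have hic : Continuous i := by fun_prop
  have heemb : MeasurableEmbedding e :=
    (MeasurableEquiv.mk ⟨e, i, hie, hei⟩ hec.measurable hic.measurable).measurableEmbedding
  have hpre : e ⁻¹' (strip γ n '' Q) = (fun z => i (strip γ n z)) '' Q := by
    ext z
    constructor
    · rintro ⟨z', hz', h⟩
      exact ⟨z', hz', by simp only [h, hie]⟩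
    · rintro ⟨z', hz', rfl⟩
      exact ⟨z', hz', (hei _).symm⟩
  rw [← hem.setIntegral_preimage_emb heemb G, hpre]
  rw [integral_image_eq_integral_abs_det_fderiv_smul volume hQ
    (f' := fun z => iL.comp ((ContinuousLinearMap.fst ℝ ℝ ℝ).smulRight (deriv γ z.1) +
      (ContinuousLinearMap.snd ℝ ℝ ℝ).smulRight n))]
  · simp only [hei, smul_eq_mul]
    refine integral_congr_ae (Eventually.of_forall fun z => ?_)
    simp only
    congr 2
    rw [ContinuousLinearMap.det, ← LinearMap.det_toMatrix (Module.Basis.finTwoProd ℝ),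
      Matrix.det_fin_two]
    simp [LinearMap.toMatrix_apply, iL, cross]
    ring
  · intro z _
    exact (iL.hasFDerivAt.comp z (hasFDerivAt_strip (hγ z.1))).hasFDerivWithinAt
  · intro z hz z' hz' h
    refine hinj hz hz' ?_
    rw [← hei (strip γ n z), ← hei (strip γ n z')]
    exact congrArg e h

lemma inner_plane (a b : Plane) : inner ℝ a b = a 0 * b 0 + a 1 * b 1 := by
  simp [PiLp.inner_apply, Fin.sum_univ_two, mul_comm]

lemma cross_ne_zero_of_orthogonal {a n : Plane} (hn : ‖n‖ = 1) (ha : a ≠ 0)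
    (h : inner ℝ n a = 0) : cross a n ≠ 0 := by
  intro h0
  rw [inner_plane] at h
  have h1 : n 0 ^ 2 + n 1 ^ 2 = 1 := by
    have := EuclideanSpace.norm_sq_eq n
    rw [hn, Fin.sum_univ_two] at this
    simpa using this.symm
  unfold cross at h0
  apply ha
  ext i; fin_cases i
  · change a 0 = 0
    linear_combination n 0 * h + n 1 * h0 - a 0 * h1
  · change a 1 = 0
    linear_combination n 1 * h - n 0 * h0 - a 1 * h1

lemma IsC2Jordan.exists_int_of_eq {γ : ℝ → Plane} (h : IsC2Jordan γ) {s t : ℝ}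
    (hst : γ s = γ t) : ∃ k : ℤ, s - t = k := by
  have hf : ∀ t, γ (Int.fract t) = γ t := fun t => by
    have := h.periodic.sub_int_mul_eq ⌊t⌋ (x := t)
    rwa [mul_one] at this
  have : Int.fract s = Int.fract t :=
    h.injOn ⟨Int.fract_nonneg s, Int.fract_lt_one s⟩ ⟨Int.fract_nonneg t, Int.fract_lt_one t⟩
      (by rw [hf, hf, hst])
  exact Int.fract_eq_fract.1 this

/-- Near a point of the curve, only the nearby arc is present. -/
lemma IsC2Jordan.eventually_mem_arc {γ : ℝ → Plane} (h : IsC2Jordan γ) (t₀ : ℝ) {r : ℝ}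
    (hr : 0 < r) : ∀ᶠ y in 𝓝 (γ t₀), y ∈ range γ → ∃ τ ∈ Icc (t₀ - r) (t₀ + r), γ τ = y := by
  -- The rest of one period is a compact arc that misses `γ t₀`, hence stays away from it.
  have hK : IsCompact (γ '' Icc (t₀ + r) (t₀ + 1 - r)) :=
    isCompact_Icc.image h.contDiff.continuous
  have hx : γ t₀ ∉ γ '' Icc (t₀ + r) (t₀ + 1 - r) := by
    rintro ⟨t, ht, heq⟩
    obtain ⟨k, hk⟩ := h.exists_int_of_eq heq
    have h1 : (0 : ℝ) < k := by rw [← hk]; linarith [ht.1]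
    have h2 : (k : ℝ) < 1 := by rw [← hk]; linarith [ht.2]
    have h1' : (0 : ℤ) < k := by exact_mod_cast h1
    have h2' : k < (1 : ℤ) := by exact_mod_cast h2
    omega
  filter_upwards [hK.isClosed.isOpen_compl.mem_nhds hx] with y hy hyr
  obtain ⟨s, rfl⟩ := hyr
  obtain ⟨τ, hτ, e⟩ := h.periodic.exists_mem_Ico zero_lt_one s (t₀ - r)
  refine ⟨τ, ⟨hτ.1, ?_⟩, e.symm⟩
  by_contra hlt
  exact hy ⟨τ, ⟨(not_le.1 hlt).le, by linarith [hτ.2]⟩, e.symm⟩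

/-- The normal is frozen at `n = ν(γ t₀)`, so the coordinates are as smooth as `γ`, and the inverse
function theorem applies because `γ'(t₀)` and `n` are independent. In a small box the curve is
exactly `s = 0`. Each open half of the box is convex, so its image lies in one component of the
complement; the normal ray at `γ t₀`, which enters both halves, decides which domain that is. -/
lemma exists_strip_box {γ : ℝ → Plane} (hγ : IsC2Jordan γ) {ν : Plane → Plane}
    (hν : IsOutwardNormal γ ν) (t₀ : ℝ) :
    ∃ r > 0, InjOn (strip γ (ν (γ t₀))) (Icc (t₀ - r) (t₀ + r) ×ˢ Icc (-r) r) ∧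
      IsOpen (strip γ (ν (γ t₀)) '' (Ioo (t₀ - r) (t₀ + r) ×ˢ Ioo (-r) r)) ∧
      ((∀ t ∈ Icc (t₀ - r) (t₀ + r), 0 < cross (deriv γ t) (ν (γ t₀))) ∨
        ∀ t ∈ Icc (t₀ - r) (t₀ + r), cross (deriv γ t) (ν (γ t₀)) < 0) ∧
      (∀ z ∈ Icc (t₀ - r) (t₀ + r) ×ˢ Icc (-r) r, 0 < z.2 →
        strip γ (ν (γ t₀)) z ∈ exteriorDomain (range γ)) ∧
      ∀ z ∈ Icc (t₀ - r) (t₀ + r) ×ˢ Icc (-r) r, z.2 < 0 →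
        strip γ (ν (γ t₀)) z ∈ interiorDomain (range γ) := by
  set n := ν (γ t₀) with hn
  have hbox : ∀ r : ℝ, Metric.closedBall ((t₀, 0) : ℝ × ℝ) r =
      Icc (t₀ - r) (t₀ + r) ×ˢ Icc (-r) r := by
    intro r
    rw [← closedBall_prod_same, Real.closedBall_eq_Icc, Real.closedBall_eq_Icc, zero_sub, zero_add]
  have hc0 : cross (deriv γ t₀) n ≠ 0 := cross_ne_zero_of_orthogonal
    (hν.norm_eq _ ⟨t₀, rfl⟩) (hγ.regular t₀) (hν.orthogonal t₀)
  have hsc := continuous_strip hγ.contDiff.continuous n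
  have hγ'c : Continuous (deriv γ) := hγ.contDiff.continuous_deriv one_le_two
  have hs0 : strip γ n (t₀, 0) = γ t₀ := by simp [strip]
  set A : ℝ × ℝ →L[ℝ] Plane := (ContinuousLinearMap.fst ℝ ℝ ℝ).smulRight (deriv γ t₀) +
      (ContinuousLinearMap.snd ℝ ℝ ℝ).smulRight n with hA
  have hAinj : Function.Injective A := by
    rw [injective_iff_map_eq_zero]
    rintro ⟨x, y⟩ hxy
    have h0 : x * deriv γ t₀ 0 + y * n 0 = 0 := by
      simpa [hA] using congrArg (fun v : Plane => v 0) hxy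
    have h1 : x * deriv γ t₀ 1 + y * n 1 = 0 := by
      simpa [hA] using congrArg (fun v : Plane => v 1) hxy
    have hx : x * cross (deriv γ t₀) n = 0 := by
      unfold cross; linear_combination n 1 * h0 - n 0 * h1
    have hy : y * cross (deriv γ t₀) n = 0 := by
      unfold cross; linear_combination deriv γ t₀ 0 * h1 - deriv γ t₀ 1 * h0
    ext
    · simpa [hc0] using hx
    · simpa [hc0] using hy
  let A' : (ℝ × ℝ) ≃L[ℝ] Plane :=
    (LinearEquiv.ofInjectiveOfFinrankEq (A : ℝ × ℝ →ₗ[ℝ] Plane) hAinj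
      (by simp)).toContinuousLinearEquiv
  have hA' : (A' : ℝ × ℝ →L[ℝ] Plane) = A := rfl
  have hstrict : HasStrictFDerivAt (strip γ n) (A' : ℝ × ℝ →L[ℝ] Plane) (t₀, 0) := by
    have hcd : ContDiff ℝ 2 (strip γ n) :=
      (hγ.contDiff.comp contDiff_fst).add (contDiff_snd.smul contDiff_const)
    refine hcd.contDiffAt.hasStrictFDerivAt' ?_ two_ne_zero
    rw [hA']
    exact hasFDerivAt_strip (n := n) (z := (t₀, 0)) (hγ.contDiff.differentiable two_ne_zero t₀)
  obtain ⟨φ, hφ, hφm⟩ : ∃ φ : OpenPartialHomeomorph (ℝ × ℝ) Plane,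
      (φ : ℝ × ℝ → Plane) = strip γ n ∧ ((t₀, 0) : ℝ × ℝ) ∈ φ.source :=
    ⟨hstrict.toOpenPartialHomeomorph (strip γ n), hstrict.toOpenPartialHomeomorph_coe,
      hstrict.mem_toOpenPartialHomeomorph_source⟩
  have hsrc : φ.source ∈ 𝓝 ((t₀, 0) : ℝ × ℝ) := φ.open_source.mem_nhds hφm
  obtain ⟨r₁, hr₁, hball₁⟩ := Metric.nhds_basis_closedBall.mem_iff.1 hsrc
  have hinj₁ : InjOn (strip γ n) (Metric.closedBall (t₀, 0) r₁) :=
    hφ ▸ φ.injOn.mono hball₁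
  have harc : ∀ᶠ z in 𝓝 ((t₀, 0) : ℝ × ℝ), strip γ n z ∈ range γ →
      ∃ τ ∈ Icc (t₀ - r₁) (t₀ + r₁), γ τ = strip γ n z := by
    have := hγ.eventually_mem_arc t₀ hr₁
    rw [← hs0] at this
    exact hsc.continuousAt.eventually this
  have hcc : Continuous fun z : ℝ × ℝ => cross (deriv γ z.1) n := by
    have hi : ∀ i : Fin 2, Continuous fun z : ℝ × ℝ => deriv γ z.1 i := fun i =>
      (EuclideanSpace.proj (𝕜 := ℝ) i).continuous.comp (hγ'c.comp continuous_fst)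
    exact ((hi 0).mul continuous_const).sub ((hi 1).mul continuous_const)
  have hsign : ∃ N ∈ 𝓝 ((t₀, 0) : ℝ × ℝ), (∀ z ∈ N, 0 < cross (deriv γ z.1) n) ∨
      ∀ z ∈ N, cross (deriv γ z.1) n < 0 := by
    rcases lt_or_gt_of_ne hc0 with h | h
    · exact ⟨_, (isOpen_lt hcc continuous_const).mem_nhds h, Or.inr fun z hz => hz⟩
    · exact ⟨_, (isOpen_lt continuous_const hcc).mem_nhds h, Or.inl fun z hz => hz⟩
  obtain ⟨N, hN, hsign⟩ := hsign
  -- Two radii are needed: a point of the curve in the image of the `r`-box has a parameter in the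
  -- larger `r₁`-interval, where injectivity identifies it.
  obtain ⟨r, hr, hball⟩ := Metric.nhds_basis_closedBall.mem_iff.1
    (inter_mem (Metric.closedBall_mem_nhds _ hr₁) (inter_mem harc hN))
  have hle : Metric.closedBall ((t₀, 0) : ℝ × ℝ) r ⊆ Metric.closedBall (t₀, 0) r₁ :=
    fun z hz => (hball hz).1
  have hoff : ∀ z ∈ Metric.closedBall ((t₀, 0) : ℝ × ℝ) r, strip γ n z ∈ range γ → z.2 = 0 := by
    intro z hz hzr
    obtain ⟨τ, hτ, e⟩ := (hball hz).2.1 hzr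
    have hτm : ((τ, 0) : ℝ × ℝ) ∈ Metric.closedBall ((t₀, 0) : ℝ × ℝ) r₁ := by
      rw [hbox]; exact ⟨hτ, by simp [hr₁.le]⟩
    have := hinj₁ (hle hz) hτm (by rw [← e]; simp [strip])
    rw [this]
  have hmem : ∀ ε : ℝ, |ε| ≤ r → ((t₀, ε) : ℝ × ℝ) ∈ Metric.closedBall ((t₀, 0) : ℝ × ℝ) r := by
    intro ε hε
    rw [hbox]
    exact ⟨⟨by linarith, by linarith⟩, abs_le.1 hε⟩
  refine ⟨r, hr, ?_, ?_, ?_, ?_, ?_⟩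
  · rw [← hbox]; exact hinj₁.mono hle
  · rw [← hφ]
    refine φ.isOpen_image_of_subset_source (isOpen_Ioo.prod isOpen_Ioo) ?_
    refine (Set.prod_mono Ioo_subset_Icc_self Ioo_subset_Icc_self).trans ?_
    rw [← hbox]
    exact hle.trans hball₁
  · have h0 : ∀ t ∈ Icc (t₀ - r) (t₀ + r), ((t, 0) : ℝ × ℝ) ∈ N := fun t ht =>
      (hball (by rw [hbox]; exact ⟨ht, by simp [hr.le]⟩)).2.2
    exact hsign.imp (fun h t ht => h _ (h0 t ht)) fun h t ht => h _ (h0 t ht)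
  · intro z hz hz2
    rw [← hbox] at hz
    obtain ⟨ε, hε, hε0, hεr⟩ :=
      ((hν.outward (γ t₀) ⟨t₀, rfl⟩).and (Ioc_mem_nhdsGT hr)).exists
    have hconv : Convex ℝ (Metric.closedBall ((t₀, 0) : ℝ × ℝ) r ∩ {z | 0 < z.2}) :=
      (convex_closedBall _ _).inter
        ((convex_Ioi (0 : ℝ)).linear_preimage (LinearMap.snd ℝ ℝ ℝ))
    refine mem_exteriorDomain_of_component hε ?_
    refine (hconv.isPreconnected.image _ hsc.continuousOn).subset_connectedComponentIn
      ⟨(t₀, ε), ⟨hmem ε ?_, hε0⟩, rfl⟩ ?_ ⟨z, ⟨hz, hz2⟩, rfl⟩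
    · rw [abs_of_pos hε0]; exact hεr
    · rintro _ ⟨z', hz', rfl⟩ hmem'
      have : 0 < z'.2 := hz'.2
      exact this.ne' (hoff z' hz'.1 hmem')
  · intro z hz hz2
    rw [← hbox] at hz
    obtain ⟨ε, hε, hε0, hεr⟩ :=
      ((hν.inward (γ t₀) ⟨t₀, rfl⟩).and (Ioc_mem_nhdsGT hr)).exists
    have hconv : Convex ℝ (Metric.closedBall ((t₀, 0) : ℝ × ℝ) r ∩ {z | z.2 < 0}) :=
      (convex_closedBall _ _).inter
        ((convex_Iio (0 : ℝ)).linear_preimage (LinearMap.snd ℝ ℝ ℝ))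
    refine mem_interiorDomain_of_component hε ?_
    refine (hconv.isPreconnected.image _ hsc.continuousOn).subset_connectedComponentIn
      ⟨(t₀, -ε), ⟨hmem (-ε) ?_, neg_lt_zero.2 hε0⟩, by simp [strip, sub_eq_add_neg, hn]⟩ ?_
      ⟨z, ⟨hz, hz2⟩, rfl⟩
    · rw [abs_neg, abs_of_pos hε0]; exact hεr
    · rintro _ ⟨z', hz', rfl⟩ hmem'
      have : z'.2 < 0 := hz'.2
      exact this.ne (hoff z' hz'.1 hmem')

/-! ### The divergence theorem across the curve -/

/-- Jumps are defined by limits along normals. Identifying those limits with values of the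
continuous extensions makes jump conditions usable in boundary integrals. -/
lemma IsOutwardNormal.tendsto_outward {γ : ℝ → Plane} {ν : Plane → Plane}
    (hν : IsOutwardNormal γ ν) {F : Type*} [TopologicalSpace F] {f f₀ : Plane → F}
    (hc : ContinuousOn f₀ (closure (exteriorDomain (range γ))))
    (he : EqOn f f₀ (exteriorDomain (range γ))) {x : Plane} (hx : x ∈ range γ) :
    x ∈ closure (exteriorDomain (range γ)) ∧
      Tendsto (fun ε : ℝ => f (x + ε • ν x)) (𝓝[>] 0) (𝓝 (f₀ x)) := by
  have hcont : Continuous fun ε : ℝ => x + ε • ν x := by fun_prop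
  have ht : Tendsto (fun ε : ℝ => x + ε • ν x) (𝓝[>] 0) (𝓝 x) := by
    have := hcont.tendsto 0
    simp only [zero_smul, add_zero] at this
    exact this.mono_left nhdsWithin_le_nhds
  have hmem := hν.outward x hx
  have hxc : x ∈ closure (exteriorDomain (range γ)) := mem_closure_of_tendsto ht hmem
  refine ⟨hxc, ?_⟩
  have h1 : Tendsto (fun ε : ℝ => x + ε • ν x) (𝓝[>] 0)
      (𝓝[closure (exteriorDomain (range γ))] x) :=
    tendsto_nhdsWithin_iff.2 ⟨ht, hmem.mono fun ε h => subset_closure h⟩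
  exact ((hc x hxc).tendsto.comp h1).congr' (hmem.mono fun ε h => (he h).symm)

lemma IsOutwardNormal.tendsto_inward {γ : ℝ → Plane} {ν : Plane → Plane}
    (hν : IsOutwardNormal γ ν) {F : Type*} [TopologicalSpace F] {f f₀ : Plane → F}
    (hc : ContinuousOn f₀ (closure (interiorDomain (range γ))))
    (he : EqOn f f₀ (interiorDomain (range γ))) {x : Plane} (hx : x ∈ range γ) :
    x ∈ closure (interiorDomain (range γ)) ∧
      Tendsto (fun ε : ℝ => f (x - ε • ν x)) (𝓝[>] 0) (𝓝 (f₀ x)) := by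
  have hcont : Continuous fun ε : ℝ => x - ε • ν x := by fun_prop
  have ht : Tendsto (fun ε : ℝ => x - ε • ν x) (𝓝[>] 0) (𝓝 x) := by
    have := hcont.tendsto 0
    simp only [zero_smul, sub_zero] at this
    exact this.mono_left nhdsWithin_le_nhds
  have hmem := hν.inward x hx
  have hxc : x ∈ closure (interiorDomain (range γ)) := mem_closure_of_tendsto ht hmem
  refine ⟨hxc, ?_⟩
  have h1 : Tendsto (fun ε : ℝ => x - ε • ν x) (𝓝[>] 0)
      (𝓝[closure (interiorDomain (range γ))] x) :=
    tendsto_nhdsWithin_iff.2 ⟨ht, hmem.mono fun ε h => subset_closure h⟩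
  exact ((hc x hxc).tendsto.comp h1).congr' (hmem.mono fun ε h => (he h).symm)

/-- For a tangent vector `a`, `cross a b` sees only the normal component of `b`: the flux through
the curve depends only on `w · ν`. -/
lemma cross_eq_of_inner_eq {a n b c : Plane} (hn : ‖n‖ = 1) (h : inner ℝ n a = 0)
    (hbc : inner ℝ b n = inner ℝ c n) : cross a b = cross a c := by
  rw [inner_plane] at h hbc
  rw [inner_plane] at hbc
  have h1 : n 0 ^ 2 + n 1 ^ 2 = 1 := by
    have := EuclideanSpace.norm_sq_eq n
    rw [hn, Fin.sum_univ_two] at this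
    simpa using this.symm
  unfold cross
  linear_combination (n 0 * b 1 - n 0 * c 1 - n 1 * b 0 + n 1 * c 0) * h +
    (-n 0 * a 1 + n 1 * a 0) * hbc - (a 0 * (b 1 - c 1) - a 1 * (b 0 - c 0)) * h1

lemma weightedDivergence_eq_zero {w : Plane → Plane} {ψ : Plane → ℝ} {y : Plane}
    (hy : y ∉ tsupport ψ) : weightedDivergence w ψ y = 0 := by
  have h1 : ψ y = 0 := image_eq_zero_of_notMem_tsupport hy
  have h2 : fderiv ℝ ψ y = 0 := by
    by_contra h
    exact hy (support_fderiv_subset ℝ h)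
  simp [weightedDivergence, h1, h2]

/-- The local divergence theorem near a point of the curve. -/
lemma exists_nhds_integral_weightedDivergence_curve {γ : ℝ → Plane} (hγ : IsC2Jordan γ)
    {ν : Plane → Plane} (hν : IsOutwardNormal γ ν) {w : Plane → Plane}
    (hwi : C1UpToBoundary (interiorDomain (range γ)) w)
    (hwe : C1UpToBoundary (exteriorDomain (range γ)) w)
    (hj : ∀ x ∈ range γ, HasJump ν (fun y => inner ℝ (w y) (ν x)) x 0) (t₀ : ℝ) :
    ∃ U, IsOpen U ∧ γ t₀ ∈ U ∧ ∀ ψ : Plane → ℝ, ContDiff ℝ 1 ψ → tsupport ψ ⊆ U →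
      ∫ y, weightedDivergence w ψ y = 0 := by
  obtain ⟨r, hr, hinj, hopen, hsign, hext, hint⟩ := exists_strip_box hγ hν t₀
  obtain ⟨hi1, ⟨wi, hi2, ei⟩, ⟨wi', hi3, ei'⟩⟩ := hwi
  obtain ⟨he1, ⟨we, he2, ee⟩, ⟨we', he3, ee'⟩⟩ := hwe
  set n := ν (γ t₀) with hn
  set box : Set (ℝ × ℝ) := Icc (t₀ - r) (t₀ + r) ×ˢ Icc (-r) r with hbox
  refine ⟨_, hopen, ⟨(t₀, 0), ⟨⟨by simp [hr], by simp [hr]⟩, by simp [hr]⟩, by simp [strip]⟩,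
    fun ψ hψ hsupp => ?_⟩
  -- By injectivity no boundary point of the box is mapped into the image of the open box, which
  -- contains the support of `ψ`.
  have hbd : ∀ z ∈ box, z ∉ Ioo (t₀ - r) (t₀ + r) ×ˢ Ioo (-r) r → ψ (strip γ n z) = 0 := by
    intro z hz hz'
    refine image_eq_zero_of_notMem_tsupport fun hmem => hz' ?_
    obtain ⟨z', hz'', e⟩ := hsupp hmem
    have := hinj ⟨Ioo_subset_Icc_self hz''.1, Ioo_subset_Icc_self hz''.2⟩ hz e
    rwa [← this]
  have hl : ∀ s ∈ Icc (-r) r, ψ (strip γ n (t₀ - r, s)) = 0 := fun s hs =>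
    hbd _ ⟨⟨le_rfl, by linarith⟩, hs⟩ fun h => lt_irrefl _ h.1.1
  have hr' : ∀ s ∈ Icc (-r) r, ψ (strip γ n (t₀ + r, s)) = 0 := fun s hs =>
    hbd _ ⟨⟨by linarith, le_rfl⟩, hs⟩ fun h => lt_irrefl _ h.1.2
  have hup := integral_rectangle_side hγ.contDiff n (isOpen_exteriorDomain hγ.isOpen_compl)
    he1 he2 ee he3 ee' hψ (a := (t₀ - r, 0)) (b := (t₀ + r, r)) (by dsimp; linarith) hr
    (fun z hz => hext z ⟨Ioo_subset_Icc_self hz.1, ⟨by linarith [hz.2.1], hz.2.2.le⟩⟩ hz.2.1)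
    (fun s hs => hl s ⟨by linarith [hs.1], hs.2⟩) (fun s hs => hr' s ⟨by linarith [hs.1], hs.2⟩)
  have hlo := integral_rectangle_side hγ.contDiff n (isOpen_interiorDomain hγ.isOpen_compl)
    hi1 hi2 ei hi3 ei' hψ (a := (t₀ - r, -r)) (b := (t₀ + r, 0)) (by dsimp; linarith)
    (by dsimp; linarith)
    (fun z hz => hint z ⟨Ioo_subset_Icc_self hz.1, ⟨hz.2.1.le, by linarith [hz.2.2]⟩⟩ hz.2.2)
    (fun s hs => hl s ⟨hs.1, by linarith [hs.2]⟩) (fun s hs => hr' s ⟨hs.1, by linarith [hs.2]⟩)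
  simp only at hup hlo
  set H : ℝ × ℝ → ℝ := fun z => cross (deriv γ z.1) n * weightedDivergence w ψ (strip γ n z)
    with hH
  have htop : ∫ t in (t₀ - r)..(t₀ + r), ψ (strip γ n (t, r)) *
      cross (deriv γ t) (we (strip γ n (t, r))) = 0 := by
    rw [intervalIntegral.integral_congr (g := fun _ => 0), intervalIntegral.integral_zero]
    intro t ht
    rw [uIcc_of_le (by linarith)] at ht
    simp only
    rw [hbd (t, r) ⟨ht, by simp [hr.le]⟩ fun h => lt_irrefl _ h.2.2, zero_mul]
  have hbot : ∫ t in (t₀ - r)..(t₀ + r), ψ (strip γ n (t, -r)) *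
      cross (deriv γ t) (wi (strip γ n (t, -r))) = 0 := by
    rw [intervalIntegral.integral_congr (g := fun _ => 0), intervalIntegral.integral_zero]
    intro t ht
    rw [uIcc_of_le (by linarith)] at ht
    simp only
    rw [hbd (t, -r) ⟨ht, by simp [hr.le]⟩ fun h => lt_irrefl _ h.2.1, zero_mul]
  -- The fluxes from the two sides cancel along `Γ`. Freezing `n` does no harm: the flux through `γ
  -- t` is determined by the component along `ν(γ t)`, which does not jump.
  have hmid : ∫ t in (t₀ - r)..(t₀ + r), ψ (strip γ n (t, 0)) *
      cross (deriv γ t) (wi (strip γ n (t, 0))) = ∫ t in (t₀ - r)..(t₀ + r),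
        ψ (strip γ n (t, 0)) * cross (deriv γ t) (we (strip γ n (t, 0))) := by
    refine intervalIntegral.integral_congr fun t _ => ?_
    have hs : strip γ n (t, 0) = γ t := by simp [strip]
    have hx : γ t ∈ range γ := ⟨t, rfl⟩
    simp only [hs]
    congr 1
    refine cross_eq_of_inner_eq (hν.norm_eq _ hx) (hν.orthogonal t) ?_
    have h1 := (hν.tendsto_inward hi2 ei hx).2
    have h2 := (hν.tendsto_outward he2 ee hx).2
    have h3 := (h1.inner (𝕜 := ℝ) (tendsto_const_nhds (x := ν (γ t)))).sub
      (h2.inner (𝕜 := ℝ) (tendsto_const_nhds (x := ν (γ t))))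
    exact sub_eq_zero.1 (tendsto_nhds_unique h3 (hj _ hx))
  have hunion : box = Icc (t₀ - r, -r) (t₀ + r, 0) ∪ Icc (t₀ - r, 0) (t₀ + r, r) := by
    rw [← Icc_prod_Icc, ← Icc_prod_Icc, ← Set.prod_union,
      Icc_union_Icc_eq_Icc (by linarith) hr.le]
  have hdisj : AEDisjoint volume (Icc (t₀ - r, -r) (t₀ + r, (0 : ℝ)))
      (Icc (t₀ - r, (0 : ℝ)) (t₀ + r, r)) := by
    have h0 : volume ((univ : Set ℝ) ×ˢ ({0} : Set ℝ)) = 0 := by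
      rw [Measure.volume_eq_prod, Measure.prod_prod]; simp
    have hsub : Icc (t₀ - r, -r) (t₀ + r, (0 : ℝ)) ∩ Icc (t₀ - r, (0 : ℝ)) (t₀ + r, r) ⊆
        (univ : Set ℝ) ×ˢ ({0} : Set ℝ) := fun z hz =>
      ⟨mem_univ _, le_antisymm hz.1.2.2 hz.2.1.2⟩
    exact measure_mono_null hsub h0
  have hzero : ∫ z in box, H z = 0 := by
    rw [hunion, setIntegral_union₀ hdisj measurableSet_Icc.nullMeasurableSet hlo.1 hup.1,
      hlo.2, hup.2, htop, hbot, hmid]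
    ring
  have hout : ∀ y, y ∉ strip γ n '' box → weightedDivergence w ψ y = 0 := by
    intro y hy
    refine weightedDivergence_eq_zero fun hmem => hy ?_
    obtain ⟨z, hz, e⟩ := hsupp hmem
    exact ⟨z, ⟨Ioo_subset_Icc_self hz.1, Ioo_subset_Icc_self hz.2⟩, e⟩
  have hboxm : MeasurableSet box := measurableSet_Icc.prod measurableSet_Icc
  rw [← setIntegral_eq_integral_of_forall_compl_eq_zero (s := strip γ n '' box) hout,
    integral_strip_image (hγ.contDiff.differentiable two_ne_zero) n hboxm hinj]
  -- The Jacobian has constant sign on the box, so its absolute value changes the integral at most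
  -- by a sign.
  rcases hsign with h | h
  · rw [← hzero]
    refine setIntegral_congr_fun hboxm fun z hz => ?_
    simp only [hH, abs_of_pos (h z.1 hz.1)]
  · rw [← neg_zero, ← hzero, ← integral_neg]
    refine setIntegral_congr_fun hboxm fun z hz => ?_
    simp only [hH, abs_of_neg (h z.1 hz.1)]
    ring

/-- The local divergence theorem away from the curve. -/
lemma integral_weightedDivergence_of_subset {U : Set Plane} (hU : IsOpen U) {w : Plane → Plane}
    (hw : ContDiffOn ℝ 1 w U) {ψ : Plane → ℝ} (hψ : ContDiff ℝ 1 ψ) (hψc : HasCompactSupport ψ)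
    (hsupp : tsupport ψ ⊆ U) : ∫ y, weightedDivergence w ψ y = 0 := by
  set W : Plane → Plane := fun y => ψ y • w y with hW
  have hWd : ContDiff ℝ 1 W := by
    rw [contDiff_iff_contDiffAt]
    intro y
    by_cases hy : y ∈ tsupport ψ
    · exact hψ.contDiffAt.smul (hw.contDiffAt (hU.mem_nhds (hsupp hy)))
    · have : W =ᶠ[𝓝 y] fun _ => 0 := by
        filter_upwards [(isClosed_tsupport ψ).isOpen_compl.mem_nhds hy] with z hz
        simp [hW, image_eq_zero_of_notMem_tsupport hz]
      exact contDiffAt_const.congr_of_eventuallyEq this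
  have hWc : HasCompactSupport W := hψc.smul_right
  have hWi : ∀ i : Fin 2, ContDiff ℝ 1 fun y => W y i := fun i =>
    (EuclideanSpace.proj i : Plane →L[ℝ] ℝ).contDiff.comp hWd
  have hWic : ∀ i : Fin 2, HasCompactSupport fun y => W y i := fun i =>
    hWc.comp_left (g := fun v : Plane => v i) rfl
  have hint : ∀ i : Fin 2, Integrable fun y => fderiv ℝ (fun y => W y i) y
      (EuclideanSpace.single i 1) := fun i =>
    (((hWi i).continuous_fderiv one_ne_zero).clm_apply
      continuous_const).integrable_of_hasCompactSupport ((hWic i).fderiv_apply ℝ _)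
  have hzero : ∀ i : Fin 2, ∫ y, fderiv ℝ (fun y => W y i) y (EuclideanSpace.single i 1) = 0 := by
    intro i
    -- Integration by parts against the constant `1`: the integral of a derivative of a compactly
    -- supported function is zero.
    have := integral_mul_fderiv_eq_neg_fderiv_mul_of_integrable (μ := (volume : Measure Plane))
      (𝕜 := ℝ) (f := fun _ => (1 : ℝ)) (g := fun y => W y i) (v := EuclideanSpace.single i 1)
      (by simp) (by simpa using hint i)
      (by simpa using (hWi i).continuous.integrable_of_hasCompactSupport (hWic i))
      (fun y _ => differentiableAt_const _) (fun y _ => (hWi i).differentiable one_ne_zero y)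
    simpa using this
  have hdiv : ∀ y, weightedDivergence w ψ y =
      ∑ i : Fin 2, fderiv ℝ (fun y => W y i) y (EuclideanSpace.single i 1) := by
    intro y
    have hcomp : ∀ i : Fin 2, fderiv ℝ (fun y => W y i) y (EuclideanSpace.single i 1) =
        fderiv ℝ W y (EuclideanSpace.single i 1) i := by
      intro i
      have := ((EuclideanSpace.proj i : Plane →L[ℝ] ℝ).hasFDerivAt.comp y
        (hWd.differentiable one_ne_zero y).hasFDerivAt).fderiv
      exact congrArg (fun L : Plane →L[ℝ] ℝ => L (EuclideanSpace.single i 1)) this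
    simp only [hcomp]
    by_cases hy : y ∈ tsupport ψ
    · exact (divergence_smul (hψ.differentiable one_ne_zero y)
        ((hw.contDiffAt (hU.mem_nhds (hsupp hy))).differentiableAt one_ne_zero)).symm
    · rw [weightedDivergence_eq_zero hy]
      have : fderiv ℝ W y = 0 := by
        by_contra h
        exact hy (closure_mono (Function.support_smul_subset_left ψ w)
          (support_fderiv_subset ℝ h))
      simp [this]
  simp only [hdiv]
  rw [integral_finsetSum _ fun i _ => hint i]
  simp [hzero]

/-- On the compact set `tsupport ψ ∩ closure Ω` the integrand extends continuously. -/
lemma integrableOn_weightedDivergence {Ω : Set Plane} (hΩ : IsOpen Ω) {w : Plane → Plane}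
    (hw : C1UpToBoundary Ω w) {ψ : Plane → ℝ} (hψ : ContDiff ℝ 1 ψ) (hψc : HasCompactSupport ψ) :
    IntegrableOn (weightedDivergence w ψ) Ω := by
  obtain ⟨-, ⟨w₀, hw₀, e₀⟩, ⟨w₁, hw₁, e₁⟩⟩ := hw
  have hcoord : ∀ {f : Plane → Plane} {s : Set Plane} (i : Fin 2), ContinuousOn f s →
      ContinuousOn (fun z => f z i) s := fun i hf =>
    (EuclideanSpace.proj (𝕜 := ℝ) i).continuous.comp_continuousOn hf
  have hc : ContinuousOn (fun y => ψ y * (∑ i, w₁ y (EuclideanSpace.single i 1) i) +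
      fderiv ℝ ψ y (w₀ y)) (closure Ω) :=
    (hψ.continuous.continuousOn.mul (continuousOn_finsetSum _ fun i _ =>
      hcoord i (hw₁.clm_apply continuousOn_const))).add
      ((hψ.continuous_fderiv one_ne_zero).continuousOn.clm_apply hw₀)
  have hK : IsCompact (tsupport ψ ∩ closure Ω) := IsCompact.inter_right hψc isClosed_closure
  have h1 : IntegrableOn (weightedDivergence w ψ) (tsupport ψ ∩ Ω) := by
    refine (((hc.mono inter_subset_right).integrableOn_compact hK).mono_set
      (inter_subset_inter_right _ subset_closure)).congr ?_
    filter_upwards [ae_restrict_mem ((isClosed_tsupport ψ).measurableSet.inter hΩ.measurableSet)]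
      with y hy
    simp only [weightedDivergence, divergence, e₀ hy.2, e₁ hy.2]
  exact h1.of_forall_sdiff_eq_zero hΩ.measurableSet fun y hy =>
    weightedDivergence_eq_zero fun h => hy.2 ⟨h, hy.1⟩

lemma integrable_of_integrableOn_domains {F : Type*} [NormedAddCommGroup F] {γ : ℝ → Plane}
    (hγ : IsC2Jordan γ) {f : Plane → F} (hi : IntegrableOn f (interiorDomain (range γ)))
    (he : IntegrableOn f (exteriorDomain (range γ))) : Integrable f := by
  have h : IntegrableOn f (range γ)ᶜ :=
    (hi.union he).mono_set fun y hy => mem_interior_or_exterior hy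
  rwa [IntegrableOn, hγ.restrict_compl] at h

lemma integrable_weightedDivergence {γ : ℝ → Plane} (hγ : IsC2Jordan γ) {w : Plane → Plane}
    (hwi : C1UpToBoundary (interiorDomain (range γ)) w)
    (hwe : C1UpToBoundary (exteriorDomain (range γ)) w) {ψ : Plane → ℝ} (hψ : ContDiff ℝ 1 ψ)
    (hψc : HasCompactSupport ψ) : Integrable (weightedDivergence w ψ) :=
  integrable_of_integrableOn_domains hγ
    (integrableOn_weightedDivergence (isOpen_interiorDomain hγ.isOpen_compl) hwi hψ hψc)
    (integrableOn_weightedDivergence (isOpen_exteriorDomain hγ.isOpen_compl) hwe hψ hψc)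

lemma weightedDivergence_sum {ι : Type*} (s : Finset ι) {w : Plane → Plane} {ψ : ι → Plane → ℝ}
    (hψ : ∀ i ∈ s, ContDiff ℝ 1 (ψ i)) (y : Plane) :
    weightedDivergence w (fun y => ∑ i ∈ s, ψ i y) y = ∑ i ∈ s, weightedDivergence w (ψ i) y := by
  simp only [weightedDivergence]
  rw [fderiv_fun_sum fun i hi => (hψ i hi).differentiable one_ne_zero y, Finset.sum_add_distrib,
    Finset.sum_mul, sum_apply]

/-- The divergence theorem in the plane does not notice `Γ` when the normal component of `w` has no
jump. Only the local statement near each point needs proof, because the integrand is additive in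
`φ`. -/
theorem integral_weightedDivergence {γ : ℝ → Plane} (hγ : IsC2Jordan γ)
    {ν : Plane → Plane} (hν : IsOutwardNormal γ ν) {w : Plane → Plane}
    (hwi : C1UpToBoundary (interiorDomain (range γ)) w)
    (hwe : C1UpToBoundary (exteriorDomain (range γ)) w)
    (hj : ∀ x ∈ range γ, HasJump ν (fun y => inner ℝ (w y) (ν x)) x 0)
    {φ : Plane → ℝ} (hφ : ContDiff ℝ 1 φ) (hφc : HasCompactSupport φ) :
    ∫ y, weightedDivergence w φ y = 0 := by
  have hloc : ∀ x : Plane, ∃ U, IsOpen U ∧ x ∈ U ∧ ∀ ψ : Plane → ℝ, ContDiff ℝ 1 ψ →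
      HasCompactSupport ψ → tsupport ψ ⊆ U → ∫ y, weightedDivergence w ψ y = 0 := by
    intro x
    by_cases hx : x ∈ range γ
    · obtain ⟨t₀, rfl⟩ := hx
      obtain ⟨U, h1, h2, h3⟩ :=
        exists_nhds_integral_weightedDivergence_curve hγ hν hwi hwe hj t₀
      exact ⟨U, h1, h2, fun ψ hψ _ hs => h3 ψ hψ hs⟩
    · rcases mem_interior_or_exterior hx with hx | hx
      · have hU := isOpen_interiorDomain hγ.isOpen_compl
        exact ⟨_, hU, hx, fun ψ hψ hc hs =>
          integral_weightedDivergence_of_subset hU hwi.1 hψ hc hs⟩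
      · have hU := isOpen_exteriorDomain hγ.isOpen_compl
        exact ⟨_, hU, hx, fun ψ hψ hc hs =>
          integral_weightedDivergence_of_subset hU hwe.1 hψ hc hs⟩
  choose U hUo hxU hU using hloc
  -- The partition is needed only on the compact support of `φ`, where local finiteness leaves
  -- finitely many indices.
  obtain ⟨f, hf⟩ := SmoothPartitionOfUnity.exists_isSubordinate (modelWithCornersSelf ℝ Plane)
    (isClosed_tsupport φ) U hUo fun x _ => mem_iUnion.2 ⟨x, hxU x⟩
  have hfin : {i | (Function.support (f i) ∩ tsupport φ).Nonempty}.Finite :=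
    f.locallyFinite.finite_nonempty_inter_compact hφc
  set s := hfin.toFinset with hs
  have hfd : ∀ i, ContDiff ℝ 1 (f i) := fun i => (f i).contMDiff.contDiff.of_le (by
    exact_mod_cast le_top)
  have hψd : ∀ i, ContDiff ℝ 1 fun y => f i y * φ y := fun i => (hfd i).mul hφ
  have hψc : ∀ i, HasCompactSupport fun y => f i y * φ y := fun i => hφc.mul_left
  have hsum : φ = fun y => ∑ i ∈ s, f i y * φ y := by
    ext y
    by_cases hy : y ∈ tsupport φ
    · have h1 := f.sum_eq_one hy
      rw [finsum_eq_sum_of_support_subset (s := s)] at h1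
      · rw [← Finset.sum_mul, h1, one_mul]
      · intro i hi
        rw [hs, Finite.coe_toFinset]
        exact ⟨y, hi, hy⟩
    · simp [image_eq_zero_of_notMem_tsupport hy]
  have hw : ∀ y, weightedDivergence w φ y =
      ∑ i ∈ s, weightedDivergence w (fun y => f i y * φ y) y := by
    intro y
    conv_lhs => rw [hsum]
    exact weightedDivergence_sum s (fun i _ => hψd i) y
  simp only [hw]
  rw [integral_finsetSum _ fun i _ => integrable_weightedDivergence hγ hwi hwe (hψd i) (hψc i)]
  refine Finset.sum_eq_zero fun i _ => hU i _ (hψd i) (hψc i) ?_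
  exact (closure_mono (Function.support_mul_subset_left _ _)).trans (hf i)

/-! ### Truncations -/

/-- A bounded smooth truncation of the identity of `ℝ`. -/
noncomputable def trunc (n : ℕ) (s : ℝ) : ℝ := (n + 1) * Real.arctan (s / (n + 1))

lemma hasDerivAt_trunc (n : ℕ) (s : ℝ) :
    HasDerivAt (trunc n) (1 / (1 + (s / (n + 1)) ^ 2)) s := by
  have hn : (n + 1 : ℝ) ≠ 0 := by positivity
  have h := (((hasDerivAt_id s).div_const ((n : ℝ) + 1)).arctan).const_mul ((n : ℝ) + 1)
  refine h.congr_deriv ?_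
  simp only [id]
  field_simp

lemma contDiff_trunc (n : ℕ) : ContDiff ℝ 1 (trunc n) := by
  unfold trunc
  exact contDiff_const.mul (Real.contDiff_arctan.comp (contDiff_id.div_const _))

lemma abs_deriv_trunc_le (n : ℕ) (s : ℝ) : |deriv (trunc n) s| ≤ 1 := by
  rw [(hasDerivAt_trunc n s).deriv, abs_of_nonneg (by positivity)]
  exact div_le_one_of_le₀ (by nlinarith [sq_nonneg (s / (n + 1))]) (by positivity)

lemma abs_trunc_le_abs (n : ℕ) (s : ℝ) : |trunc n s| ≤ |s| := by
  have h : LipschitzWith 1 (trunc n) := lipschitzWith_of_nnnorm_deriv_le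
    (fun s => (hasDerivAt_trunc n s).differentiableAt) fun s => by
      rw [← NNReal.coe_le_coe]
      exact abs_deriv_trunc_le n s
  have := h.dist_le_mul s 0
  simpa [Real.dist_eq, trunc] using this

lemma abs_trunc_le (n : ℕ) (s : ℝ) : |trunc n s| ≤ (n + 1) * (Real.pi / 2) := by
  rw [trunc, abs_mul, abs_of_nonneg (by positivity)]
  exact mul_le_mul_of_nonneg_left
    (abs_le.2 ⟨(Real.neg_pi_div_two_lt_arctan _).le, (Real.arctan_lt_pi_div_two _).le⟩)
    (by positivity)

lemma tendsto_div_add_one (s : ℝ) : Tendsto (fun n : ℕ => s / ((n : ℝ) + 1)) atTop (𝓝 0) :=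
  tendsto_const_nhds.div_atTop (tendsto_atTop_add_const_right _ _ tendsto_natCast_atTop_atTop)

lemma tendsto_deriv_trunc (s : ℝ) : Tendsto (fun n => deriv (trunc n) s) atTop (𝓝 1) := by
  have h : Tendsto (fun n : ℕ => 1 / (1 + (s / ((n : ℝ) + 1)) ^ 2)) atTop
      (𝓝 (1 / (1 + 0 ^ 2))) :=
    tendsto_const_nhds.div (tendsto_const_nhds.add ((tendsto_div_add_one s).pow 2)) (by norm_num)
  simp only [ne_eq, OfNat.ofNat_ne_zero, not_false_eq_true, zero_pow, add_zero, div_one] at h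
  exact h.congr fun n => ((hasDerivAt_trunc n s).deriv).symm

/-- For `s ≠ 0`, `trunc n s` is `s` times the difference quotient of `arctan` at zero with step
`s/(n + 1)`. -/
lemma tendsto_trunc (s : ℝ) : Tendsto (fun n => trunc n s) atTop (𝓝 s) := by
  rcases eq_or_ne s 0 with rfl | hs
  · simp [trunc]
  have h1 := (Real.hasDerivAt_arctan 0).tendsto_slope_zero
  simp only [zero_add, Real.arctan_zero, sub_zero, smul_eq_mul, ne_eq, OfNat.ofNat_ne_zero,
    not_false_eq_true, zero_pow, add_zero, div_one] at h1
  have h2 : Tendsto (fun n : ℕ => s / ((n : ℝ) + 1)) atTop (𝓝[≠] 0) :=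
    tendsto_nhdsWithin_iff.2 ⟨tendsto_div_add_one s, Eventually.of_forall fun n =>
      div_ne_zero hs (by positivity)⟩
  have h3 := (h1.comp h2).const_mul s
  rw [mul_one] at h3
  refine h3.congr fun n => ?_
  simp only [Function.comp, trunc, inv_div]
  field_simp

/-! ### Cut-off functions at infinity -/

/-- The functions `θ n` have compact support and tend to `1`, with gradients of size `O(1/n)`. -/
structure IsRadialCutoff (θ : ℕ → Space → ℝ) : Prop where
  contDiff : ∀ n, ContDiff ℝ 1 (θ n)
  hasCompactSupport : ∀ n, HasCompactSupport (θ n)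
  mem_Icc : ∀ n x, θ n x ∈ Icc (0 : ℝ) 1
  eventually_one : ∀ x, ∀ᶠ n in atTop, θ n x = 1
  norm_fderiv_le : ∀ n x, ‖fderiv ℝ (θ n) x‖ ≤ 1 / (n + 1)

/-- Mollification at scale `1` of `2 - |x|/(n + 1)` clamped to `[0, 1]`. The support lies in the
ball of radius `2(n + 1) + 1`, the extra `1` being the mollification radius. -/
theorem exists_isRadialCutoff : ∃ θ, IsRadialCutoff θ := by
  have hN : ∀ n : ℕ, (0 : ℝ) < n + 1 := fun n => by positivity
  have hlip : ∀ n : ℕ, LipschitzWith (1 / (n + 1) : NNReal)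
      (fun x : Space => max 0 (min 1 (2 - ‖x‖ / (n + 1)))) := by
    intro n
    refine LipschitzWith.const_max (LipschitzWith.const_min ?_ _) _
    refine LipschitzWith.of_dist_le_mul fun x y => ?_
    rw [Real.dist_eq, show 2 - ‖x‖ / (n + 1) - (2 - ‖y‖ / (n + 1)) = (‖y‖ - ‖x‖) / (n + 1) by ring,
      abs_div, abs_of_pos (hN n), dist_eq_norm, norm_sub_rev]
    push_cast
    rw [one_div, inv_mul_eq_div]
    exact div_le_div_of_nonneg_right (abs_norm_sub_norm_le y x) (hN n).le
  choose θ h1 h2 h3 h4 using fun n => exists_contDiff_lipschitz (hlip n)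
    (fun x => ⟨le_max_left _ _, max_le zero_le_one (min_le_left _ _)⟩) one_pos
  have hball : ∀ x y : Space, y ∈ Metric.ball x 1 → |‖y‖ - ‖x‖| ≤ 1 := fun x y hy => by
    rw [Metric.mem_ball, dist_eq_norm] at hy
    exact (abs_norm_sub_norm_le y x).trans hy.le
  refine ⟨θ, h1, fun n => ?_, h3, fun x => ?_, fun n x => ?_⟩
  · refine HasCompactSupport.intro
      (isCompact_closedBall (0 : Space) (2 * (n + 1) + 1)) fun x hx => ?_
    have hx' : 2 * ((n : ℝ) + 1) + 1 < ‖x‖ := by simpa using hx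
    have e : ∀ y : Space, 2 * ((n : ℝ) + 1) ≤ ‖y‖ →
        max 0 (min 1 (2 - ‖y‖ / ((n : ℝ) + 1))) = 0 := fun y hy =>
      max_eq_left ((min_le_right _ _).trans (by rw [sub_nonpos, le_div_iff₀ (hN n)]; exact hy))
    rw [h4 n x, e x (by linarith)]
    intro y hy
    have := abs_le.1 (hball x y hy)
    rw [e x (by linarith), e y (by linarith)]
  · have hev : ∀ᶠ n : ℕ in atTop, ‖x‖ ≤ n := tendsto_natCast_atTop_atTop.eventually_ge_atTop _
    filter_upwards [hev] with n hn
    have e : ∀ y : Space, ‖y‖ ≤ (n : ℝ) + 1 →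
        max 0 (min 1 (2 - ‖y‖ / ((n : ℝ) + 1))) = 1 := fun y hy => by
      have : ‖y‖ / ((n : ℝ) + 1) ≤ 1 := (div_le_one (hN n)).2 hy
      rw [min_eq_left (by linarith)]
      exact max_eq_right zero_le_one
    rw [h4 n x, e x (by linarith)]
    intro y hy
    have := abs_le.1 (hball x y hy)
    rw [e x (by linarith), e y (by linarith)]
  · have := norm_fderiv_le_of_lipschitz ℝ (h2 n) (x₀ := x)
    simpa using this

lemma aestronglyMeasurable_clm_apply {E : Type*} [NormedAddCommGroup E] [NormedSpace ℝ E]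
    {X : Type*} [MeasurableSpace X] {μ : Measure X} {L : X → E →L[ℝ] ℝ} {H : X → E}
    (hL : AEStronglyMeasurable L μ) (hH : AEStronglyMeasurable H μ) :
    AEStronglyMeasurable (fun x => L x (H x)) μ := by
  have h : Continuous fun z : (E →L[ℝ] ℝ) × E => z.1 z.2 := continuous_fst.clm_apply continuous_snd
  exact h.comp_aestronglyMeasurable (hL.prodMk hH)

/-- Here the gradients tend to zero uniformly, so integrability of `H` suffices, in contrast to the
tube cut-offs. -/
lemma IsRadialCutoff.tendsto_integral {θ : ℕ → Space → ℝ} (h : IsRadialCutoff θ)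
    {μ : Measure Space} {A : Space → ℝ} {H : Space → Space} (hA : Integrable A μ)
    (hH : Integrable H μ) :
    Tendsto (fun n => ∫ x, (θ n x * A x + fderiv ℝ (θ n) x (H x)) ∂μ) atTop
      (𝓝 (∫ x, A x ∂μ)) := by
  have hle : ∀ n x, |θ n x| ≤ 1 := fun n x => by
    rw [abs_of_nonneg (h.mem_Icc n x).1]; exact (h.mem_Icc n x).2
  have hle' : ∀ n x, ‖fderiv ℝ (θ n) x (H x)‖ ≤ 1 / (n + 1) * ‖H x‖ := fun n x =>
    ((fderiv ℝ (θ n) x).le_opNorm _).trans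
      (mul_le_mul_of_nonneg_right (h.norm_fderiv_le n x) (norm_nonneg _))
  refine tendsto_integral_of_dominated_convergence (fun x => ‖A x‖ + ‖H x‖) (fun n => ?_)
    (hA.norm.add hH.norm) (fun n => Eventually.of_forall fun x => ?_)
    (Eventually.of_forall fun x => ?_)
  · exact ((h.contDiff n).continuous.aestronglyMeasurable.mul hA.1).add
      (aestronglyMeasurable_clm_apply
        ((h.contDiff n).continuous_fderiv one_ne_zero).aestronglyMeasurable hH.1)
  · refine (norm_add_le _ _).trans (add_le_add ?_ ((hle' n x).trans ?_))
    · rw [norm_mul]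
      exact mul_le_of_le_one_left (norm_nonneg _) (hle n x)
    · refine mul_le_of_le_one_left (norm_nonneg _) ?_
      rw [div_le_one (by positivity)]
      linarith [(Nat.cast_nonneg n : (0 : ℝ) ≤ n)]
  · have h1 : Tendsto (fun n => θ n x * A x) atTop (𝓝 (A x)) := by
      refine tendsto_const_nhds.congr' ?_
      filter_upwards [h.eventually_one x] with n hn
      rw [hn, one_mul]
    have h2 : Tendsto (fun n => fderiv ℝ (θ n) x (H x)) atTop (𝓝 0) := by
      refine squeeze_zero_norm (hle' · x) ?_
      have := (tendsto_div_add_one 1).mul_const ‖H x‖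
      rwa [zero_mul] at this
    simpa using h1.add h2

/-! ### Green identities with finite energy -/

lemma gradient_apply (f : Space → ℝ) (x : Space) (i : Fin 3) :
    gradient f x i = fderiv ℝ f x (EuclideanSpace.single i 1) := by
  rw [← inner_gradient_left, EuclideanSpace.inner_single_right]
  simp

lemma gradientWithin_apply (f : Space → ℝ) (s : Set Space) (x : Space) (i : Fin 3) :
    gradientWithin f s x i = fderivWithin ℝ f s x (EuclideanSpace.single i 1) := by
  rw [← inner_gradientWithin_left, EuclideanSpace.inner_single_right]
  simp

lemma divergence_gradient {f : Space → ℝ} {x : Space} (hf : ContDiffAt ℝ 2 f x) :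
    DifferentiableAt ℝ (gradient f) x ∧ divergence (gradient f) x = Laplacian.laplacian f x := by
  have hd : DifferentiableAt ℝ (fderiv ℝ f) x :=
    (hf.fderiv_right (m := 1) (by norm_num)).differentiableAt one_ne_zero
  have hg : DifferentiableAt ℝ (gradient f) x :=
    (InnerProductSpace.toDual ℝ Space).symm.differentiable.differentiableAt.comp x hd
  refine ⟨hg, ?_⟩
  rw [laplacian_eq_iteratedFDeriv_orthonormalBasis f (EuclideanSpace.basisFun (Fin 3) ℝ)]
  refine Finset.sum_congr rfl fun i _ => ?_
  have h1 : fderiv ℝ (gradient f) x (EuclideanSpace.single i 1) i =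
      fderiv ℝ (fun y => gradient f y i) x (EuclideanSpace.single i 1) := by
    have := ((EuclideanSpace.proj i : Space →L[ℝ] ℝ).hasFDerivAt.comp x hg.hasFDerivAt).fderiv
    exact (congrArg (fun L : Space →L[ℝ] ℝ => L (EuclideanSpace.single i 1)) this).symm
  rw [h1]
  simp only [gradient_apply]
  rw [fderiv_clm_apply hd (differentiableAt_const _)]
  simp [iteratedFDeriv_two_apply]

/-- The natural field `f ∇f` is only integrable, whereas removing `Γ` requires `L²`. The field
`trunc n f • ∇f` is in `L²`, with divergence `trunc n'(f) |∇f|² + trunc n (f) k`; the bounds `|trunc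
n'| ≤ 1` and `|trunc n s| ≤ |s|` then dominate the passage to the limit. -/
theorem integral_green {γ : ℝ → Plane} (hγ : IsC2Jordan γ) {f k : Space → ℝ}
    (hf2 : ContDiffOn ℝ 2 f subfluid) (hf1 : ContDiffOn ℝ 1 f (closedSubfluidDiff (range γ)))
    (hf : MemLp f 2 (volume.restrict subfluid))
    (hG : MemLp (gradient f) 2 (volume.restrict subfluid))
    (hk : MemLp k 2 (volume.restrict subfluid))
    (hΔ : ∀ x ∈ subfluid, Laplacian.laplacian f x = k x) {θ : Space → ℝ} (hθ : ContDiff ℝ 1 θ)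
    (hθc : HasCompactSupport θ)
    (hb : Integrable fun y => θ (onBoundary y) * (f (onBoundary y) *
      fderivWithin ℝ f (closedSubfluidDiff (range γ)) (onBoundary y)
        (EuclideanSpace.single 2 1))) :
    ∫ x in subfluid, (θ x * (‖gradient f x‖ ^ 2 + f x * k x) + fderiv ℝ θ x (f x • gradient f x)) =
      ∫ y, θ (onBoundary y) * (f (onBoundary y) *
        fderivWithin ℝ f (closedSubfluidDiff (range γ)) (onBoundary y)
          (EuclideanSpace.single 2 1)) := by
  set S := closedSubfluidDiff (range γ) with hS
  set b : Plane → ℝ := fun y => fderivWithin ℝ f S (onBoundary y) (EuclideanSpace.single 2 1)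
    with hbdef
  have hBn : ∀ x ∈ subfluid, subfluid ∈ 𝓝 x := fun x hx => isOpen_subfluid.mem_nhds hx
  have hfd : ∀ x ∈ subfluid, DifferentiableAt ℝ f x := fun x hx =>
    (hf2.contDiffAt (hBn x hx)).differentiableAt two_ne_zero
  have hfw : ContinuousOn (fderivWithin ℝ f S) S :=
    hf1.continuousOn_fderivWithin (uniqueDiffOn_closedSubfluidDiff hγ.isCompact_range) le_rfl
  have hGw : ContinuousOn (gradientWithin f S) S :=
    (InnerProductSpace.toDual ℝ Space).symm.continuous.comp_continuousOn hfw
  have hGe : ∀ x ∈ subfluid, gradientWithin f S x = gradient f x := fun x hx => by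
    simp only [gradientWithin, gradient]
    rw [fderivWithin_eq_fderiv_of_mem_subfluid _ _ hx]
  have hμ : ∀ {E : Type} {F G : Space → E}, (∀ x ∈ subfluid, F x = G x) →
      F =ᵐ[volume.restrict subfluid] G := fun h => by
    filter_upwards [ae_restrict_mem measurableSet_subfluid] with x hx using h x hx
  -- The gradient within `closure B \ Γ` agrees with the gradient in `B` and is continuous up to the
  -- boundary.
  set Y : ℕ → Space → Space := fun n x => trunc n (f x) • gradientWithin f S x with hY
  have htc : ∀ n, Continuous (trunc n) := fun n => (contDiff_trunc n).continuous
  have htd : ∀ n, Continuous (deriv (trunc n)) :=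
    fun n => (contDiff_trunc n).continuous_deriv le_rfl
  have hdiv : ∀ n, ∀ x ∈ subfluid, DifferentiableAt ℝ (Y n) x ∧ divergence (Y n) x =
      deriv (trunc n) (f x) * ‖gradient f x‖ ^ 2 + trunc n (f x) * k x := by
    intro n x hx
    obtain ⟨hg, hgd⟩ := divergence_gradient (hf2.contDiffAt (hBn x hx))
    have hev : Y n =ᶠ[𝓝 x] fun x => trunc n (f x) • gradient f x := by
      filter_upwards [hBn x hx] with z hz
      simp only [hY, hGe z hz]
    have htf : HasFDerivAt (fun x => trunc n (f x)) _ x :=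
      (hasDerivAt_trunc n (f x)).comp_hasFDerivAt x (hfd x hx).hasFDerivAt
    refine ⟨(htf.differentiableAt.smul hg).congr_of_eventuallyEq hev, ?_⟩
    have : divergence (Y n) x = divergence (fun x => trunc n (f x) • gradient f x) x := by
      simp only [divergence, hev.fderiv_eq]
    rw [this, divergence_smul htf.differentiableAt hg, hgd, hΔ x hx, htf.fderiv,
      (hasDerivAt_trunc n (f x)).deriv, smul_apply, ← inner_gradient_left,
      real_inner_self_eq_norm_sq, smul_eq_mul]
    ring
  have hG2 : Integrable (fun x => ‖gradient f x‖ ^ 2) (volume.restrict subfluid) :=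
    (memLp_two_iff_integrable_sq_norm hG.1).1 hG
  have htfm : ∀ n, AEStronglyMeasurable (fun x => trunc n (f x)) (volume.restrict subfluid) :=
    fun n => (htc n).comp_aestronglyMeasurable hf.1
  have htfL : ∀ n, MemLp (fun x => trunc n (f x)) 2 (volume.restrict subfluid) := fun n =>
    hf.mono (htfm n) (Eventually.of_forall fun x => abs_trunc_le_abs n (f x))
  have hi1 : ∀ n, Integrable (fun x => deriv (trunc n) (f x) * ‖gradient f x‖ ^ 2)
      (volume.restrict subfluid) := fun n =>
    hG2.bdd_mul ((htd n).comp_aestronglyMeasurable hf.1)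
      (Eventually.of_forall fun x => abs_deriv_trunc_le n (f x))
  have hi2 : ∀ n, Integrable (fun x => trunc n (f x) * k x) (volume.restrict subfluid) := fun n =>
    (htfL n).integrable_mul hk
  have hYL : ∀ n, MemLp (Y n) 2 (volume.restrict subfluid) := by
    intro n
    refine hG.of_le_mul (c := (n + 1) * (Real.pi / 2)) ?_ ?_
    · refine ((htfm n).smul hG.1).congr (hμ fun x hx => ?_)
      simp only [hY, hGe x hx, Pi.smul_apply']
    · filter_upwards [ae_restrict_mem measurableSet_subfluid] with x hx
      rw [hY, norm_smul, hGe x hx]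
      exact mul_le_mul_of_nonneg_right (abs_trunc_le n (f x)) (norm_nonneg _)
  have hmaps : MapsTo onBoundary (range γ)ᶜ S := fun y hy => onBoundary_mem hy
  have hmeas : ∀ {F : Plane → ℝ}, ContinuousOn F (range γ)ᶜ → AEStronglyMeasurable F volume := by
    intro F hF
    rw [← hγ.restrict_compl]
    exact hF.aestronglyMeasurable hγ.isOpen_compl.measurableSet
  have hfb : AEStronglyMeasurable (fun y => f (onBoundary y)) volume :=
    hmeas (hf1.continuousOn.comp continuous_onBoundary.continuousOn hmaps)
  have hbb : AEStronglyMeasurable b volume :=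
    hmeas ((hfw.comp continuous_onBoundary.continuousOn hmaps).clm_apply continuousOn_const)
  have hθb : AEStronglyMeasurable (fun y => θ (onBoundary y)) volume :=
    (hθ.continuous.comp continuous_onBoundary).aestronglyMeasurable
  have hY2 : ∀ n y, Y n (onBoundary y) 2 = trunc n (f (onBoundary y)) * b y := fun n y => by
    simp only [hY, PiLp.smul_apply, smul_eq_mul, gradientWithin_apply, hbdef]
  have hble : ∀ n y, ‖θ (onBoundary y) * (trunc n (f (onBoundary y)) * b y)‖ ≤
      ‖θ (onBoundary y) * (f (onBoundary y) * b y)‖ := fun n y => by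
    simp only [norm_mul]
    gcongr
    exact abs_trunc_le_abs n _
  have hbn : ∀ n, AEStronglyMeasurable
      (fun y => θ (onBoundary y) * (trunc n (f (onBoundary y)) * b y)) volume := fun n =>
    hθb.mul (((htc n).comp_aestronglyMeasurable hfb).mul hbb)
  have hid : ∀ n, ∫ x in subfluid, (θ x * (deriv (trunc n) (f x) * ‖gradient f x‖ ^ 2 +
      trunc n (f x) * k x) + fderiv ℝ θ x (trunc n (f x) • gradient f x)) =
      ∫ y, θ (onBoundary y) * (trunc n (f (onBoundary y)) * b y) := by
    intro n
    have key := integral_subfluid_divergence_of_memLp hγ (Y := Y n)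
      (((htc n).comp_continuousOn hf1.continuousOn).smul hGw) (fun x hx => (hdiv n x hx).1) (hYL n)
      (((hi1 n).add (hi2 n)).congr (hμ fun x hx => ((hdiv n x hx).2).symm)) hθ hθc
      (by simp only [hY2]; exact hb.mono (hbn n) (Eventually.of_forall (hble n)))
    simp only [hY2] at key
    rw [← key]
    refine setIntegral_congr_fun measurableSet_subfluid fun x hx => ?_
    simp only [(hdiv n x hx).2]
    rw [hY]
    simp only [hGe x hx]
  obtain ⟨Cθ, hCθ⟩ := hθc.exists_bound_of_continuous hθ.continuous
  have hθ'c : Continuous (fderiv ℝ θ) := hθ.continuous_fderiv one_ne_zero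
  obtain ⟨Cθ', hCθ'⟩ := (hθc.fderiv ℝ).exists_bound_of_continuous hθ'c
  have hfk : Integrable (fun x => ‖f x‖ * ‖k x‖) (volume.restrict subfluid) :=
    hf.norm.integrable_mul hk.norm
  have hfG : Integrable (fun x => ‖f x‖ * ‖gradient f x‖) (volume.restrict subfluid) :=
    hf.norm.integrable_mul hG.norm
  have hl1 : Tendsto (fun n => ∫ x in subfluid, (θ x * (deriv (trunc n) (f x) * ‖gradient f x‖ ^ 2 +
      trunc n (f x) * k x) + fderiv ℝ θ x (trunc n (f x) • gradient f x))) atTop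
      (𝓝 (∫ x in subfluid, (θ x * (‖gradient f x‖ ^ 2 + f x * k x) +
        fderiv ℝ θ x (f x • gradient f x)))) := by
    refine tendsto_integral_of_dominated_convergence (fun x => Cθ * (‖gradient f x‖ ^ 2 +
      ‖f x‖ * ‖k x‖) + Cθ' * (‖f x‖ * ‖gradient f x‖)) (fun n => ?_)
      (((hG2.add hfk).const_mul _).add (hfG.const_mul _))
      (fun n => Eventually.of_forall fun x => ?_) (Eventually.of_forall fun x => ?_)
    · exact (hθ.continuous.aestronglyMeasurable.mul ((hi1 n).1.add (hi2 n).1)).add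
        (aestronglyMeasurable_clm_apply hθ'c.aestronglyMeasurable ((htfm n).smul hG.1))
    · have hC0 : 0 ≤ Cθ := (norm_nonneg _).trans (hCθ x)
      have hC0' : 0 ≤ Cθ' := (norm_nonneg _).trans (hCθ' x)
      refine (norm_add_le _ _).trans (add_le_add ?_ ?_)
      · rw [norm_mul]
        refine mul_le_mul (hCθ x) ((norm_add_le _ _).trans (add_le_add ?_ ?_)) (norm_nonneg _) hC0
        · rw [norm_mul, Real.norm_of_nonneg (sq_nonneg _)]
          exact mul_le_of_le_one_left (sq_nonneg _) (abs_deriv_trunc_le n (f x))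
        · rw [norm_mul]
          exact mul_le_mul_of_nonneg_right (abs_trunc_le_abs n (f x)) (norm_nonneg _)
      · refine ((fderiv ℝ θ x).le_opNorm _).trans ?_
        rw [norm_smul]
        refine mul_le_mul (hCθ' x) ?_ (by positivity) hC0'
        exact mul_le_mul_of_nonneg_right (abs_trunc_le_abs n (f x)) (norm_nonneg _)
    · have t1 := ((((tendsto_deriv_trunc (f x)).mul_const (‖gradient f x‖ ^ 2)).add
        ((tendsto_trunc (f x)).mul_const (k x))).const_mul (θ x)).add
        (((fderiv ℝ θ x).continuous.tendsto _).comp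
          ((tendsto_trunc (f x)).smul_const (gradient f x)))
      rwa [one_mul] at t1
  have hl2 : Tendsto (fun n => ∫ y, θ (onBoundary y) * (trunc n (f (onBoundary y)) * b y)) atTop
      (𝓝 (∫ y, θ (onBoundary y) * (f (onBoundary y) * b y))) :=
    tendsto_integral_of_dominated_convergence _ hbn hb.norm
      (fun n => Eventually.of_forall (hble n))
      (Eventually.of_forall fun y => ((tendsto_trunc _).mul_const _).const_mul _)
  exact tendsto_nhds_unique (hl1.congr hid) hl2

/-- The pressure does no work, up to the cut-off term. The field `q v` is truncated as in
`integral_green`; its divergence is `∇q · v` because `div v = 0`, and its flux is zero because `v₃ =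
0` on `∂B \ Γ`. -/
theorem integral_pressure {γ : ℝ → Plane} (hγ : IsC2Jordan γ) {v : Space → Space} {q : Space → ℝ}
    (hv1 : ContinuousOn v (closedSubfluidDiff (range γ)))
    (hvd : ∀ x ∈ subfluid, DifferentiableAt ℝ v x) (hv0 : ∀ x ∈ subfluid, divergence v x = 0)
    (hvb : ∀ y ∈ (range γ)ᶜ, v (onBoundary y) 2 = 0)
    (hq1 : ContinuousOn q (closedSubfluidDiff (range γ)))
    (hqd : ∀ x ∈ subfluid, DifferentiableAt ℝ q x)
    (hv : MemLp v 2 (volume.restrict subfluid)) (hq : MemLp q 2 (volume.restrict subfluid))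
    (hG : MemLp (gradient q) 2 (volume.restrict subfluid)) {θ : Space → ℝ} (hθ : ContDiff ℝ 1 θ)
    (hθc : HasCompactSupport θ) :
    ∫ x in subfluid, (θ x * fderiv ℝ q x (v x) + fderiv ℝ θ x (q x • v x)) = 0 := by
  set S := closedSubfluidDiff (range γ) with hS
  set Y : ℕ → Space → Space := fun n x => trunc n (q x) • v x with hY
  have htc : ∀ n, Continuous (trunc n) := fun n => (contDiff_trunc n).continuous
  have htd : ∀ n, Continuous (deriv (trunc n)) :=
    fun n => (contDiff_trunc n).continuous_deriv le_rfl
  have hdiv : ∀ n, ∀ x ∈ subfluid, DifferentiableAt ℝ (Y n) x ∧ divergence (Y n) x =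
      deriv (trunc n) (q x) * fderiv ℝ q x (v x) := by
    intro n x hx
    have htf : HasFDerivAt (fun x => trunc n (q x)) _ x :=
      (hasDerivAt_trunc n (q x)).comp_hasFDerivAt x (hqd x hx).hasFDerivAt
    refine ⟨htf.differentiableAt.smul (hvd x hx), ?_⟩
    rw [hY, divergence_smul htf.differentiableAt (hvd x hx), hv0 x hx, htf.fderiv,
      (hasDerivAt_trunc n (q x)).deriv, smul_apply, smul_eq_mul, mul_zero, zero_add]
  have hqv : Integrable (fun x => fderiv ℝ q x (v x)) (volume.restrict subfluid) := by
    simp only [← inner_gradient_left]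
    refine (hG.norm.integrable_mul hv.norm).mono' (hG.1.inner hv.1)
      (Eventually.of_forall fun x => ?_)
    exact norm_inner_le_norm _ _
  have htfm : ∀ n, AEStronglyMeasurable (fun x => trunc n (q x)) (volume.restrict subfluid) :=
    fun n => (htc n).comp_aestronglyMeasurable hq.1
  have hi1 : ∀ n, Integrable (fun x => deriv (trunc n) (q x) * fderiv ℝ q x (v x))
      (volume.restrict subfluid) := fun n =>
    hqv.bdd_mul ((htd n).comp_aestronglyMeasurable hq.1)
      (Eventually.of_forall fun x => abs_deriv_trunc_le n (q x))
  have hYL : ∀ n, MemLp (Y n) 2 (volume.restrict subfluid) := by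
    intro n
    refine hv.of_le_mul (c := (n + 1) * (Real.pi / 2)) ((htfm n).smul hv.1)
      (Eventually.of_forall fun x => ?_)
    rw [hY, norm_smul]
    exact mul_le_mul_of_nonneg_right (abs_trunc_le n (q x)) (norm_nonneg _)
  have hae : ∀ n, (fun y => θ (onBoundary y) * Y n (onBoundary y) 2) =ᵐ[volume]
      fun _ : Plane => (0 : ℝ) := by
    intro n
    have hnull : ∀ᵐ y : Plane, y ∉ range γ := measure_eq_zero_iff_ae_notMem.1
      (volume_range_eq_zero (hγ.contDiff.differentiable two_ne_zero))
    filter_upwards [hnull] with y hy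
    simp [hY, hvb y hy]
  have hid : ∀ n, ∫ x in subfluid, (θ x * (deriv (trunc n) (q x) * fderiv ℝ q x (v x)) +
      fderiv ℝ θ x (trunc n (q x) • v x)) = 0 := by
    intro n
    have key := integral_subfluid_divergence_of_memLp hγ (Y := Y n)
      (((htc n).comp_continuousOn hq1).smul hv1) (fun x hx => (hdiv n x hx).1) (hYL n)
      ((hi1 n).congr (by
        filter_upwards [ae_restrict_mem measurableSet_subfluid] with x hx
        exact ((hdiv n x hx).2).symm)) hθ hθc
      ((integrable_zero _ _ _).congr (hae n).symm)
    rw [integral_congr_ae (hae n), integral_zero] at key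
    rw [← key]
    refine setIntegral_congr_fun measurableSet_subfluid fun x hx => ?_
    simp only [(hdiv n x hx).2]
    rfl
  obtain ⟨Cθ, hCθ⟩ := hθc.exists_bound_of_continuous hθ.continuous
  have hθ'c : Continuous (fderiv ℝ θ) := hθ.continuous_fderiv one_ne_zero
  obtain ⟨Cθ', hCθ'⟩ := (hθc.fderiv ℝ).exists_bound_of_continuous hθ'c
  have hqv' : Integrable (fun x => ‖q x‖ * ‖v x‖) (volume.restrict subfluid) :=
    hq.norm.integrable_mul hv.norm
  have hl1 : Tendsto (fun n => ∫ x in subfluid, (θ x * (deriv (trunc n) (q x) *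
      fderiv ℝ q x (v x)) + fderiv ℝ θ x (trunc n (q x) • v x))) atTop
      (𝓝 (∫ x in subfluid, (θ x * fderiv ℝ q x (v x) + fderiv ℝ θ x (q x • v x)))) := by
    refine tendsto_integral_of_dominated_convergence (fun x => Cθ * ‖fderiv ℝ q x (v x)‖ +
      Cθ' * (‖q x‖ * ‖v x‖)) (fun n => ?_)
      ((hqv.norm.const_mul _).add (hqv'.const_mul _))
      (fun n => Eventually.of_forall fun x => ?_) (Eventually.of_forall fun x => ?_)
    · exact (hθ.continuous.aestronglyMeasurable.mul (hi1 n).1).add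
        (aestronglyMeasurable_clm_apply hθ'c.aestronglyMeasurable ((htfm n).smul hv.1))
    · have hC0 : 0 ≤ Cθ := (norm_nonneg _).trans (hCθ x)
      have hC0' : 0 ≤ Cθ' := (norm_nonneg _).trans (hCθ' x)
      refine (norm_add_le _ _).trans (add_le_add ?_ ?_)
      · rw [norm_mul, norm_mul]
        refine mul_le_mul (hCθ x) ?_ (by positivity) hC0
        exact mul_le_of_le_one_left (norm_nonneg _) (abs_deriv_trunc_le n (q x))
      · refine ((fderiv ℝ θ x).le_opNorm _).trans ?_
        rw [norm_smul]
        refine mul_le_mul (hCθ' x) ?_ (by positivity) hC0'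
        exact mul_le_mul_of_nonneg_right (abs_trunc_le_abs n (q x)) (norm_nonneg _)
    · have t1 := (((tendsto_deriv_trunc (q x)).mul_const (fderiv ℝ q x (v x))).const_mul
        (θ x)).add (((fderiv ℝ θ x).continuous.tendsto _).comp
          ((tendsto_trunc (q x)).smul_const (v x)))
      rwa [one_mul] at t1
  simp only [hid] at hl1
  exact tendsto_nhds_unique hl1 tendsto_const_nhds

/-! ### Rigidity -/

lemma eq_zero_of_eqOn_const {E F : Type*} [NormedAddCommGroup E] [NormedAddCommGroup F]
    {C : Set E} (hC : ¬ Bornology.IsBounded C) {f : E → F} {c : F} (hf : ∀ x ∈ C, f x = c)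
    (hlim : Tendsto f (Bornology.cobounded E ⊓ 𝓟 C) (𝓝 0)) : c = 0 := by
  have hne : (Bornology.cobounded E ⊓ 𝓟 C).NeBot := by
    rw [inf_principal_neBot_iff]
    intro U hU
    by_contra h
    refine hC ((Bornology.isBounded_def.2 (by rwa [compl_compl]) :
      Bornology.IsBounded Uᶜ).subset fun x hx hxU => h ⟨x, hxU, hx⟩)
  have h1 : Tendsto f (Bornology.cobounded E ⊓ 𝓟 C) (𝓝 c) := by
    refine tendsto_const_nhds.congr' ?_
    filter_upwards [mem_inf_of_right (mem_principal_self C)] with x hx using (hf x hx).symm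
  exact tendsto_nhds_unique h1 hlim

lemma tendsto_norm_zpow_neg_two {E : Type*} [NormedAddCommGroup E] :
    Tendsto (fun x : E => ‖x‖ ^ (-2 : ℤ)) (Bornology.cobounded E) (𝓝 0) := by
  have h := (tendsto_pow_atTop (α := ℝ) two_ne_zero).comp (tendsto_norm_cobounded_atTop (E := E))
  refine h.inv_tendsto_atTop.congr fun x => ?_
  simp [zpow_neg]

lemma norm_zpow_neg_three_isBigO {l : Filter Space} (hl : l ≤ Bornology.cobounded Space) :
    (fun x : Space => ‖x‖ ^ (-3 : ℤ)) =O[l] fun x => ‖x‖ ^ (-2 : ℤ) := by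
  refine IsBigO.of_bound 1 (hl ?_)
  filter_upwards [tendsto_norm_cobounded_atTop.eventually_ge_atTop 1] with x hx
  have hx' : 1 ≤ ‖x‖ := hx
  rw [one_mul, Real.norm_of_nonneg (by positivity), Real.norm_of_nonneg (by positivity)]
  exact zpow_le_zpow_right₀ hx' (by norm_num)

lemma not_isBounded_subfluid : ¬ Bornology.IsBounded subfluid := by
  intro h
  obtain ⟨R, hR⟩ := h.exists_norm_le
  have hm : EuclideanSpace.single 2 (-(|R| + 1)) ∈ subfluid := by
    rw [mem_subfluid]
    simp only [PiLp.single_apply, if_true]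
    linarith [abs_nonneg R]
  have := hR _ hm
  rw [PiLp.norm_single, Real.norm_eq_abs, abs_neg,
    abs_of_nonneg (by positivity)] at this
  linarith [le_abs_self R]

/-- A decaying function with vanishing gradient is zero. -/
lemma eqOn_zero_of_fderiv_eq_zero {E : Type*} [NormedAddCommGroup E] [NormedSpace ℝ E]
    {f : Space → E} (hd : ∀ x ∈ subfluid, DifferentiableAt ℝ f x)
    (h0 : ∀ x ∈ subfluid, fderiv ℝ f x = 0)
    (hO : f =O[Bornology.cobounded Space ⊓ 𝓟 subfluid] fun x => ‖x‖ ^ (-2 : ℤ)) :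
    EqOn f (fun _ => 0) subfluid := by
  intro x hx
  refine eq_zero_of_eqOn_const not_isBounded_subfluid (fun y hy => ?_)
    (hO.trans_tendsto (tendsto_norm_zpow_neg_two.mono_left inf_le_left))
  exact isOpen_subfluid.is_const_of_fderiv_eq_zero convex_subfluid.isPreconnected
    (fun x hx => (hd x hx).differentiableWithinAt) h0 hy hx

/-- Each bounded component of the complement of the curve has a piece of the curve in its
boundary. -/
lemma exists_inward_mem_component {γ : ℝ → Plane} (hγ : IsC2Jordan γ) {ν : Plane → Plane}
    (hν : IsOutwardNormal γ ν) {y : Plane} (hy : y ∈ interiorDomain (range γ)) :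
    ∃ x ∈ range γ, ∀ᶠ ε in 𝓝[>] (0 : ℝ), x - ε • ν x ∈ connectedComponentIn (range γ)ᶜ y := by
  set C := connectedComponentIn (range γ)ᶜ y with hC
  have hCo : IsOpen C := hγ.isOpen_compl.connectedComponentIn
  have hCne : C.Nonempty := ⟨y, mem_connectedComponentIn hy.1⟩
  have hCu : C ≠ univ := fun h =>
    connectedComponentIn_subset (range γ)ᶜ y (show γ 0 ∈ C from h ▸ mem_univ _) ⟨0, rfl⟩
  obtain ⟨x, hx⟩ := nonempty_frontier_iff.2 ⟨hCne, hCu⟩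
  have hxC : x ∉ C := by
    rw [hCo.frontier_eq] at hx
    exact hx.2
  have hxcl : x ∈ closure C := frontier_subset_closure hx
  -- Off the curve, a limit point of the component has a component that is an open neighbourhood
  -- meeting `C`, hence equals `C`. A frontier point of the open set `C` cannot belong to it.
  have hxr : x ∈ range γ := by
    by_contra hxn
    have hn : connectedComponentIn (range γ)ᶜ x ∈ 𝓝 x :=
      hγ.isOpen_compl.connectedComponentIn.mem_nhds (mem_connectedComponentIn hxn)
    obtain ⟨z, hz1, hz2⟩ := mem_closure_iff_nhds.1 hxcl _ hn
    have h1 := connectedComponentIn_eq hz1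
    have h2 : C = _ := connectedComponentIn_eq hz2
    exact hxC (by rw [h2, ← h1]; exact mem_connectedComponentIn hxn)
  obtain ⟨t₀, rfl⟩ := hxr
  refine ⟨γ t₀, ⟨t₀, rfl⟩, ?_⟩
  obtain ⟨r, hr, -, hopen, -, hext, hint⟩ := exists_strip_box hγ hν t₀
  set n := ν (γ t₀) with hn
  have hsc := continuous_strip hγ.contDiff.continuous n
  have hmem : γ t₀ ∈ strip γ n '' (Ioo (t₀ - r) (t₀ + r) ×ˢ Ioo (-r) r) :=
    ⟨(t₀, 0), ⟨⟨by simp [hr], by simp [hr]⟩, by simp [hr]⟩, by simp [strip]⟩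
  obtain ⟨_, ⟨z, hz, rfl⟩, hzC⟩ := mem_closure_iff_nhds.1 hxcl _ (hopen.mem_nhds hmem)
  have hzb : z ∈ Icc (t₀ - r) (t₀ + r) ×ˢ Icc (-r) r :=
    ⟨Ioo_subset_Icc_self hz.1, Ioo_subset_Icc_self hz.2⟩
  -- The component avoids `Γ` and is bounded, so it cannot meet the upper half of the box, which is
  -- in the exterior domain. It thus contains the whole lower half.
  have hz2 : z.2 < 0 := by
    rcases lt_trichotomy z.2 0 with h | h | h
    · exact h
    · refine absurd ⟨z.1, ?_⟩ (connectedComponentIn_subset _ _ hzC)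
      simp [strip, h]
    · exact absurd (mem_interiorDomain_of_component hy hzC).2 (hext z hzb h).2
  have hconv : Convex ℝ ((Icc (t₀ - r) (t₀ + r) ×ˢ Icc (-r) r) ∩ {z : ℝ × ℝ | z.2 < 0}) :=
    ((convex_Icc _ _).prod (convex_Icc _ _)).inter
      ((convex_Iio (0 : ℝ)).linear_preimage (LinearMap.snd ℝ ℝ ℝ))
  have hsub := (hconv.isPreconnected.image _ hsc.continuousOn).subset_connectedComponentIn
    ⟨z, ⟨hzb, hz2⟩, rfl⟩ (by
      rintro _ ⟨z', hz', rfl⟩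
      exact (hint z' hz'.1 hz'.2).1)
  filter_upwards [Ioc_mem_nhdsGT hr] with ε hε
  have hC' : C = _ := connectedComponentIn_eq hzC
  rw [hC']
  refine hsub ⟨(t₀, -ε), ⟨⟨⟨by linarith, by linarith⟩, ⟨by linarith [hε.2], by linarith [hε.1]⟩⟩,
    neg_lt_zero.2 hε.1⟩, by simp [strip, sub_eq_add_neg]⟩

/-- A surface pressure with vanishing gradient, no jump, and decay at infinity is zero. -/
lemma pressure_eq_zero {γ : ℝ → Plane} (hγ : IsC2Jordan γ) {ν : Plane → Plane}
    (hν : IsOutwardNormal γ ν) {p : Plane → ℝ} (hd : ∀ y ∈ (range γ)ᶜ, DifferentiableAt ℝ p y)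
    (h0 : ∀ y ∈ (range γ)ᶜ, fderiv ℝ p y = 0)
    (hO : p =O[Bornology.cobounded Plane] fun y => ‖y‖ ^ (-2 : ℤ))
    (hj : ∀ x ∈ range γ, HasJump ν p x 0) {y : Plane} (hy : y ∈ (range γ)ᶜ) : p y = 0 := by
  have hconst : ∀ y z, z ∈ connectedComponentIn (range γ)ᶜ y → y ∈ (range γ)ᶜ → p z = p y := by
    intro y z hz hy
    have hsub := connectedComponentIn_subset (range γ)ᶜ y
    exact hγ.isOpen_compl.connectedComponentIn.is_const_of_fderiv_eq_zero
      isPreconnected_connectedComponentIn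
      (fun x hx => (hd x (hsub hx)).differentiableWithinAt) (fun x hx => h0 x (hsub hx)) hz
      (mem_connectedComponentIn hy)
  have hext : ∀ y ∈ exteriorDomain (range γ), p y = 0 := fun y hy =>
    eq_zero_of_eqOn_const hy.2 (fun z hz => hconst y z hz hy.1)
      (hO.trans_tendsto tendsto_norm_zpow_neg_two |>.mono_left inf_le_left)
  rcases mem_interior_or_exterior hy with hi | he
  · obtain ⟨x, hx, hev⟩ := exists_inward_mem_component hγ hν hi
    have h1 : Tendsto (fun ε : ℝ => p (x - ε • ν x) - p (x + ε • ν x)) (𝓝[>] 0) (𝓝 (p y)) := by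
      refine tendsto_const_nhds.congr' ?_
      filter_upwards [hev, hν.outward x hx] with ε h1 h2
      rw [hconst y _ h1 hy, hext _ h2, sub_zero]
    exact tendsto_nhds_unique h1 (hj x hx)
  · exact hext y he

/-! ### Integrability on the surface -/

lemma integrableOn_smul_of_extension {F : Type*} [NormedAddCommGroup F] [NormedSpace ℝ F]
    {Ω : Set Plane} (hΩ : IsOpen Ω) {f f₀ : Plane → F} (hc : ContinuousOn f₀ (closure Ω))
    (he : EqOn f f₀ Ω) {φ : Plane → ℝ} (hφ : Continuous φ) (hφc : HasCompactSupport φ) :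
    IntegrableOn (fun y => φ y • f y) Ω := by
  have hK : IsCompact (tsupport φ ∩ closure Ω) := IsCompact.inter_right hφc isClosed_closure
  have h1 : IntegrableOn (fun y => φ y • f y) (tsupport φ ∩ Ω) := by
    refine ((((hφ.continuousOn.smul hc).mono inter_subset_right).integrableOn_compact hK).mono_set
      (inter_subset_inter_right _ subset_closure)).congr ?_
    filter_upwards [ae_restrict_mem ((isClosed_tsupport φ).measurableSet.inter hΩ.measurableSet)]
      with y hy
    simp only [he hy.2, Pi.smul_apply']
  refine h1.of_forall_sdiff_eq_zero hΩ.measurableSet fun y hy => ?_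
  rw [image_eq_zero_of_notMem_tsupport fun h => hy.2 ⟨h, hy.1⟩, zero_smul]

/-- Near `Γ` both factors extend continuously from each side; far away the product is `O(|y|⁻⁴)`,
integrable in the plane. -/
lemma integrable_smul_of_decay {γ : ℝ → Plane} (hγ : IsC2Jordan γ) {p : Plane → ℝ}
    {u : Plane → Plane} (hpi : C1UpToBoundary (interiorDomain (range γ)) p)
    (hpe : C1UpToBoundary (exteriorDomain (range γ)) p)
    (hui : C1UpToBoundary (interiorDomain (range γ)) u)
    (hue : C1UpToBoundary (exteriorDomain (range γ)) u)
    (hp : p =O[Bornology.cobounded Plane] fun y => ‖y‖ ^ (-2 : ℤ))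
    (hu : u =O[Bornology.cobounded Plane] fun y => ‖y‖ ^ (-2 : ℤ)) :
    Integrable fun y => p y • u y := by
  have hio := isOpen_interiorDomain hγ.isOpen_compl
  have heo := isOpen_exteriorDomain hγ.isOpen_compl
  obtain ⟨hi1, ⟨wi, hi2, ei⟩, -⟩ := hpi.smul hio hui
  obtain ⟨he1, ⟨we, he2, ee⟩, -⟩ := hpe.smul heo hue
  have hloc : ∀ φ : Plane → ℝ, Continuous φ → HasCompactSupport φ →
      Integrable fun y => φ y • (p y • u y) := fun φ hφ hφc =>
    integrable_of_integrableOn_domains hγ (integrableOn_smul_of_extension hio hi2 ei hφ hφc)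
      (integrableOn_smul_of_extension heo he2 ee hφ hφc)
  have hmeas : AEStronglyMeasurable (fun y => p y • u y) volume := by
    have hc : ContinuousOn (fun y => p y • u y) (range γ)ᶜ := by
      intro y hy
      rcases mem_interior_or_exterior hy with h | h
      · exact (hi1.continuousOn.continuousAt (hio.mem_nhds h)).continuousWithinAt
      · exact (he1.continuousOn.continuousAt (heo.mem_nhds h)).continuousWithinAt
    rw [← hγ.restrict_compl]
    exact hc.aestronglyMeasurable hγ.isOpen_compl.measurableSet
  obtain ⟨C, hC⟩ := (hp.smul hu).bound
  obtain ⟨R₀, -, hR₀⟩ := (hasBasis_cobounded_norm.eventually_iff).1 hC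
  set R : ℝ := max R₀ 1 with hR
  have hR1 : 1 ≤ R := le_max_right _ _
  have hnear : IntegrableOn (fun y => p y • u y) (Metric.closedBall 0 R) := by
    let φ : ContDiffBump (0 : Plane) := ⟨R, R + 1, by linarith, by linarith⟩
    refine (hloc φ φ.continuous φ.hasCompactSupport).integrableOn.congr_fun (fun y hy => ?_)
      measurableSet_closedBall
    simp only [φ.one_of_mem_closedBall hy, one_smul]
  have hfar : IntegrableOn (fun y => p y • u y) (Metric.closedBall 0 R)ᶜ := by
    have h1 : Integrable fun y : Plane => |C| * 16 * (1 + ‖y‖) ^ (-(4 : ℝ)) :=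
      (integrable_one_add_norm (by simp; norm_num)).const_mul _
    refine h1.integrableOn.mono' hmeas.restrict ?_
    filter_upwards [ae_restrict_mem measurableSet_closedBall.compl] with y hy
    have hyR : R < ‖y‖ := by simpa using hy
    have h1y : 1 ≤ ‖y‖ := by linarith
    have h2 := hR₀ (show R₀ ≤ ‖y‖ from (le_max_left _ _).trans hyR.le)
    have e4 : (1 + ‖y‖) ^ (-(4 : ℝ)) = ((1 + ‖y‖) ^ 4)⁻¹ := by
      rw [Real.rpow_neg (by positivity)]; norm_cast
    have h5 : (1 + ‖y‖) ^ 4 ≤ (2 * ‖y‖) ^ 4 := pow_le_pow_left₀ (by positivity) (by linarith) 4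
    have e5 : ‖‖y‖ ^ (-2 : ℤ) • ‖y‖ ^ (-2 : ℤ)‖ = 16 * ((2 * ‖y‖) ^ 4)⁻¹ := by
      rw [smul_eq_mul, Real.norm_of_nonneg (by positivity), zpow_neg]
      norm_cast
      field_simp
      norm_num
    rw [e4]
    calc ‖p y • u y‖ ≤ C * ‖‖y‖ ^ (-2 : ℤ) • ‖y‖ ^ (-2 : ℤ)‖ := h2
      _ ≤ |C| * (16 * ((2 * ‖y‖) ^ 4)⁻¹) := by
        rw [e5]; exact mul_le_mul_of_nonneg_right (le_abs_self C) (by positivity)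
      _ ≤ |C| * (16 * ((1 + ‖y‖) ^ 4)⁻¹) := by gcongr
      _ = |C| * 16 * ((1 + ‖y‖) ^ 4)⁻¹ := by ring
  have := hnear.union hfar
  rwa [union_compl_self, integrableOn_univ] at this

/-! ### Uniqueness -/

section

variable {γ : ℝ → Plane} {ν : Plane → Plane} {v : Space → Space} {q : Space → ℝ}
  {u : Plane → Plane} {p : Plane → ℝ}

/-- The squared Frobenius norm of the Jacobian, summed by rows on one side and by columns on the
other. -/
lemma sum_sq_norm_gradient {v : Space → Space} {x : Space} (hv : DifferentiableAt ℝ v x) :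
    ∑ i, ‖gradient (fun x => v x i) x‖ ^ 2 =
      ∑ j : Fin 3, ‖fderiv ℝ v x (EuclideanSpace.single j 1)‖ ^ 2 := by
  have h : ∀ i j : Fin 3, fderiv ℝ (fun x => v x i) x (EuclideanSpace.single j 1) =
      fderiv ℝ v x (EuclideanSpace.single j 1) i := by
    intro i j
    have := ((EuclideanSpace.proj i : Space →L[ℝ] ℝ).hasFDerivAt.comp x hv.hasFDerivAt).fderiv
    exact congrArg (fun L : Space →L[ℝ] ℝ => L (EuclideanSpace.single j 1)) this
  simp only [EuclideanSpace.norm_sq_eq, gradient_apply, h]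
  exact Finset.sum_comm

namespace IsClassicalSolution

/-! ### Integrability of a classical solution, energy identity and vanishing -/

lemma differentiableAt_v {g : Plane → ℝ} (h : IsClassicalSolution γ ν g v q u p) {x : Space}
    (hx : x ∈ subfluid) : DifferentiableAt ℝ v x :=
  (h.v_C2.contDiffAt (isOpen_subfluid.mem_nhds hx)).differentiableAt two_ne_zero

lemma differentiableAt_q {g : Plane → ℝ} (h : IsClassicalSolution γ ν g v q u p) {x : Space}
    (hx : x ∈ subfluid) : DifferentiableAt ℝ q x :=
  (h.q_C1.contDiffAt (isOpen_subfluid.mem_nhds hx)).differentiableAt one_ne_zero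

lemma differentiableAt_surface {F : Type*} [NormedAddCommGroup F] [NormedSpace ℝ F]
    {f : Plane → F} (hγ : IsC2Jordan γ) (hi : C1UpToBoundary (interiorDomain (range γ)) f)
    (he : C1UpToBoundary (exteriorDomain (range γ)) f) {y : Plane} (hy : y ∈ (range γ)ᶜ) :
    DifferentiableAt ℝ f y := by
  rcases mem_interior_or_exterior hy with hy | hy
  · exact hi.differentiableAt (isOpen_interiorDomain hγ.isOpen_compl) hy
  · exact he.differentiableAt (isOpen_exteriorDomain hγ.isOpen_compl) hy

lemma q_decay' {g : Plane → ℝ} (h : IsClassicalSolution γ ν g v q u p) :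
    q =O[Bornology.cobounded Space ⊓ 𝓟 subfluid] fun x => ‖x‖ ^ (-2 : ℤ) :=
  h.q_decay.trans (norm_zpow_neg_three_isBigO inf_le_left)

lemma memLp_v {g : Plane → ℝ} (h : IsClassicalSolution γ ν g v q u p) :
    MemLp v 2 (volume.restrict subfluid) := by
  refine memLp_two_of_decay (h.v_C2.of_le one_le_two) ?_ h.v_decay
  refine h.v_energy.mono' ?_ (Eventually.of_forall fun x => ?_)
  · exact (((h.v_C2.continuousOn_fderiv_of_isOpen isOpen_subfluid one_le_two).clm_apply
      continuousOn_const).norm.pow 2).aestronglyMeasurable measurableSet_subfluid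
  · rw [Real.norm_of_nonneg (by positivity)]
    exact Finset.single_le_sum
      (f := fun i : Fin 3 => ‖fderiv ℝ v x (EuclideanSpace.single i 1)‖ ^ 2)
      (fun i _ => by positivity) (Finset.mem_univ 2)

lemma memLp_gradient_q {g : Plane → ℝ} (h : IsClassicalSolution γ ν g v q u p) :
    MemLp (gradient q) 2 (volume.restrict subfluid) := by
  have hc : ContinuousOn (gradient q) subfluid :=
    (InnerProductSpace.toDual ℝ Space).symm.continuous.comp_continuousOn
      (h.q_C1.continuousOn_fderiv_of_isOpen isOpen_subfluid le_rfl)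
  exact (memLp_two_iff_integrable_sq_norm
    (hc.aestronglyMeasurable measurableSet_subfluid)).2 h.q_energy

lemma memLp_q {g : Plane → ℝ} (h : IsClassicalSolution γ ν g v q u p) :
    MemLp q 2 (volume.restrict subfluid) := by
  refine memLp_two_of_decay h.q_C1 ?_ h.q_decay'
  refine h.q_energy.mono' ?_ (Eventually.of_forall fun x => ?_)
  · exact (((h.q_C1.continuousOn_fderiv_of_isOpen isOpen_subfluid le_rfl).clm_apply
      continuousOn_const).norm.pow 2).aestronglyMeasurable measurableSet_subfluid
  · rw [Real.norm_of_nonneg (by positivity), ← gradient_apply]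
    exact pow_le_pow_left₀ (norm_nonneg _) (PiLp.norm_apply_le _ _) 2

lemma contDiffOn_component {n : WithTop ℕ∞} {s : Set Space} (h : ContDiffOn ℝ n v s) (i : Fin 3) :
    ContDiffOn ℝ n (fun x => v x i) s :=
  (EuclideanSpace.proj i : Space →L[ℝ] ℝ).contDiff.comp_contDiffOn h

lemma memLp_gradient_component {g : Plane → ℝ} (h : IsClassicalSolution γ ν g v q u p)
    (i : Fin 3) : MemLp (gradient fun x => v x i) 2 (volume.restrict subfluid) := by
  have hc : ContinuousOn (gradient fun x => v x i) subfluid :=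
    (InnerProductSpace.toDual ℝ Space).symm.continuous.comp_continuousOn
      ((contDiffOn_component h.v_C2 i).continuousOn_fderiv_of_isOpen isOpen_subfluid one_le_two)
  have hm := hc.aestronglyMeasurable (μ := volume) measurableSet_subfluid
  rw [memLp_two_iff_integrable_sq_norm hm]
  refine h.v_energy.mono' (hm.norm.pow 2) ?_
  filter_upwards [ae_restrict_mem measurableSet_subfluid] with x hx
  rw [Real.norm_of_nonneg (by positivity), ← sum_sq_norm_gradient (h.differentiableAt_v hx)]
  exact Finset.single_le_sum (f := fun i : Fin 3 => ‖gradient (fun x => v x i) x‖ ^ 2)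
    (fun i _ => by positivity) (Finset.mem_univ i)

lemma memLp_component {μ : Measure Space} {w : Space → Space} (h : MemLp w 2 μ) (i : Fin 3) :
    MemLp (fun x => w x i) 2 μ :=
  h.mono ((EuclideanSpace.proj i : Space →L[ℝ] ℝ).continuous.comp_aestronglyMeasurable h.1)
    (Eventually.of_forall fun _ => PiLp.norm_apply_le _ _)

lemma laplacian_component {g : Plane → ℝ} (h : IsClassicalSolution γ ν g v q u p) (i : Fin 3)
    {x : Space} (hx : x ∈ subfluid) :
    Laplacian.laplacian (fun x => v x i) x = gradient q x i := by
  have h1 := (h.v_C2.contDiffAt (isOpen_subfluid.mem_nhds hx)).laplacian_CLM_comp_left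
    (l := (EuclideanSpace.proj i : Space →L[ℝ] ℝ))
  have h2 : Laplacian.laplacian v x = gradient q x := by
    have := h.stokes x hx
    rwa [neg_add_eq_zero] at this
  refine h1.trans ?_
  rw [Function.comp, h2]
  rfl

/-- The jump of the normal component of `p u` vanishes. -/
lemma jump_smul (hν : IsOutwardNormal γ ν) (h : IsClassicalSolution γ ν (fun _ => 0) v q u p)
    {x : Plane} (hx : x ∈ range γ) :
    HasJump ν (fun y => inner ℝ (p y • u y) (ν x)) x 0 := by
  obtain ⟨-, ⟨pi, hpi, epi⟩, -⟩ := h.p_int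
  obtain ⟨-, ⟨pe, hpe, epe⟩, -⟩ := h.p_ext
  obtain ⟨-, ⟨ui, hui, eui⟩, -⟩ := h.u_int
  obtain ⟨-, ⟨ue, hue, eue⟩, -⟩ := h.u_ext
  have hpi' := (hν.tendsto_inward hpi epi hx).2
  have hpe' := (hν.tendsto_outward hpe epe hx).2
  have hui' := ((hν.tendsto_inward hui eui hx).2).inner (𝕜 := ℝ)
    (tendsto_const_nhds (x := ν x))
  have hue' := ((hν.tendsto_outward hue eue hx).2).inner (𝕜 := ℝ)
    (tendsto_const_nhds (x := ν x))
  -- The one-sided limits of `p` agree and so do those of `u · ν`, hence the limits of the products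
  -- agree.
  have e1 := tendsto_nhds_unique (hpi'.sub hpe') (h.jump_p x hx)
  have e2 := tendsto_nhds_unique (hui'.sub hue') (h.jump_u x hx)
  have key := (hpi'.mul hui').sub (hpe'.mul hue')
  rw [sub_eq_zero.1 e1, sub_eq_zero.1 e2, sub_self] at key
  simp only [HasJump, real_inner_smul_left]
  exact key

/-- The power of the surface stress, tested with a cut-off function. -/
lemma integral_surface (hγ : IsC2Jordan γ) (hν : IsOutwardNormal γ ν)
    (h : IsClassicalSolution γ ν (fun _ => 0) v q u p) {φ : Plane → ℝ} (hφ : ContDiff ℝ 1 φ)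
    (hφc : HasCompactSupport φ) :
    (∀ i : Fin 2, Integrable fun y => φ y * (u y i * gradient p y i)) ∧
      ∑ i : Fin 2, ∫ y, φ y * (u y i * -gradient p y i) =
        ∫ y, fderiv ℝ φ y (p y • u y) := by
  have hio := isOpen_interiorDomain hγ.isOpen_compl
  have heo := isOpen_exteriorDomain hγ.isOpen_compl
  have hpc : ∀ {Ω : Set Plane}, IsOpen Ω → C1UpToBoundary Ω p → C1UpToBoundary Ω u →
      ∀ i : Fin 2, IntegrableOn (fun y => φ y * (u y i * gradient p y i)) Ω := by
    intro Ω hΩ hp hu i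
    obtain ⟨-, -, ⟨p₁, hp₁, ep₁⟩⟩ := hp
    obtain ⟨-, ⟨u₀, hu₀, eu₀⟩, -⟩ := hu
    have hc : ContinuousOn (fun y => u₀ y i * (InnerProductSpace.toDual ℝ Plane).symm (p₁ y) i)
        (closure Ω) :=
      ((EuclideanSpace.proj i : Plane →L[ℝ] ℝ).continuous.comp_continuousOn hu₀).mul
        ((EuclideanSpace.proj i : Plane →L[ℝ] ℝ).continuous.comp_continuousOn
          ((InnerProductSpace.toDual ℝ Plane).symm.continuous.comp_continuousOn hp₁))
    refine integrableOn_smul_of_extension hΩ hc (fun y hy => ?_) hφ.continuous hφc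
    simp only [gradient, eu₀ hy, ep₁ hy]
  have hint : ∀ i : Fin 2, Integrable fun y => φ y * (u y i * gradient p y i) := fun i =>
    integrable_of_integrableOn_domains hγ (hpc hio h.p_int h.u_int i) (hpc heo h.p_ext h.u_ext i)
  refine ⟨hint, ?_⟩
  have hpu := integrable_smul_of_decay hγ h.p_int h.p_ext h.u_int h.u_ext h.p_decay h.u_decay
  have hint2 : Integrable fun y => fderiv ℝ φ y (p y • u y) := by
    have hφ' := hφ.continuous_fderiv one_ne_zero
    obtain ⟨C, hC⟩ := (hφc.fderiv ℝ).exists_bound_of_continuous hφ'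
    refine (hpu.norm.const_mul C).mono'
      (aestronglyMeasurable_clm_apply hφ'.aestronglyMeasurable hpu.1)
      (Eventually.of_forall fun y => ?_)
    exact ((fderiv ℝ φ y).le_opNorm _).trans (mul_le_mul_of_nonneg_right (hC y) (norm_nonneg _))
  -- The field is `p u`, and `div u = 0` reduces its divergence to `u · ∇p`.
  have hzero := integral_weightedDivergence hγ hν (h.p_int.smul hio h.u_int)
    (h.p_ext.smul heo h.u_ext) (fun x hx => jump_smul hν h hx) hφ hφc
  have hwd : ∀ y ∈ (range γ)ᶜ, weightedDivergence (fun y => p y • u y) φ y =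
      (∑ i : Fin 2, φ y * (u y i * gradient p y i)) + fderiv ℝ φ y (p y • u y) := by
    intro y hy
    rw [weightedDivergence, divergence_smul (differentiableAt_surface hγ h.p_int h.p_ext hy)
      (differentiableAt_surface hγ h.u_int h.u_ext hy), h.div_u y hy, ← inner_gradient_left,
      inner_plane, Fin.sum_univ_two]
    ring
  have hae : weightedDivergence (fun y => p y • u y) φ =ᵐ[volume] fun y =>
      (∑ i : Fin 2, φ y * (u y i * gradient p y i)) + fderiv ℝ φ y (p y • u y) := by
    rw [← hγ.restrict_compl]
    filter_upwards [ae_restrict_mem hγ.isOpen_compl.measurableSet] with y hy using hwd y hy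
  rw [integral_congr_ae hae, integral_add (integrable_finsetSum _ fun i _ => hint i) hint2,
    integral_finsetSum _ fun i _ => hint i] at hzero
  simp only [mul_neg, integral_neg, Finset.sum_neg_distrib]
  linarith

lemma norm_fderiv_comp_onBoundary_le {θ : Space → ℝ} (hθ : ContDiff ℝ 1 θ) (y : Plane) :
    ‖fderiv ℝ (fun y => θ (onBoundary y)) y‖ ≤ ‖fderiv ℝ θ (onBoundary y)‖ := by
  have : HasFDerivAt (fun y => θ (onBoundary y))
      ((fderiv ℝ θ (onBoundary y)).comp onBoundaryL) y :=
    (hθ.differentiable one_ne_zero (onBoundary y)).hasFDerivAt.comp y onBoundaryL.hasFDerivAt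
  rw [this.fderiv]
  refine ContinuousLinearMap.opNorm_le_bound _ (norm_nonneg _) fun w => ?_
  rw [ContinuousLinearMap.comp_apply]
  refine ((fderiv ℝ θ (onBoundary y)).le_opNorm _).trans_eq ?_
  rw [onBoundaryL_apply, norm_onBoundary]

lemma fderivWithin_component (hγ : IsC2Jordan γ)
    {g : Plane → ℝ} (h : IsClassicalSolution γ ν g v q u p) {y : Plane} (hy : y ∈ (range γ)ᶜ)
    (i : Fin 3) :
    fderivWithin ℝ (fun x => v x i) (closedSubfluidDiff (range γ)) (onBoundary y)
      (EuclideanSpace.single 2 1) = normalDerivTrace (range γ) v y i := by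
  have hy' := onBoundary_mem hy
  have h1 := ((EuclideanSpace.proj i : Space →L[ℝ] ℝ).hasFDerivAt.comp_hasFDerivWithinAt _
    ((h.v_C1 _ hy').differentiableWithinAt one_ne_zero).hasFDerivWithinAt).fderivWithin
    (uniqueDiffOn_closedSubfluidDiff hγ.isCompact_range _ hy')
  exact congrArg (fun L : Space →L[ℝ] ℝ => L (EuclideanSpace.single 2 1)) h1

/-- The energy identity. -/
theorem integral_energy (hγ : IsC2Jordan γ) (hν : IsOutwardNormal γ ν)
    (h : IsClassicalSolution γ ν (fun _ => 0) v q u p) :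
    ∫ x in subfluid, ∑ i, ‖gradient (fun x => v x i) x‖ ^ 2 = 0 := by
  obtain ⟨θ, hθ⟩ := exists_isRadialCutoff
  set S := closedSubfluidDiff (range γ) with hS
  set f : Fin 3 → Space → ℝ := fun i x => v x i with hf
  set b : Fin 3 → Plane → ℝ := fun i y => fderivWithin ℝ (f i) S (onBoundary y)
    (EuclideanSpace.single 2 1) with hb
  set φ : ℕ → Plane → ℝ := fun n y => θ n (onBoundary y) with hφ
  have hφd : ∀ n, ContDiff ℝ 1 (φ n) := fun n => (hθ.contDiff n).comp onBoundaryL.contDiff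
  have hiso : Isometry onBoundaryL :=
    AddMonoidHomClass.isometry_of_norm onBoundaryL norm_onBoundary
  have hφc : ∀ n, HasCompactSupport (φ n) := fun n =>
    (hθ.hasCompactSupport n).comp_isClosedEmbedding hiso.isClosedEmbedding
  -- The coupling: on `∂B \ Γ` the boundary terms `vᵢ ∂₃vᵢ` are `-uᵢ ∂ᵢp` for the tangential
  -- components and zero for the normal one.
  have hbd : ∀ n (i : Fin 3), (fun y => φ n y * (f i (onBoundary y) * b i y)) =ᵐ[volume]
      fun y => φ n y * (![u y 0 * -gradient p y 0, u y 1 * -gradient p y 1, 0] i) := by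
    intro n i
    rw [← hγ.restrict_compl]
    filter_upwards [ae_restrict_mem hγ.isOpen_compl.measurableSet] with y hy
    have hu := h.v_tangential y hy
    have hp := h.grad_p y hy
    have hbi : b i y = normalDerivTrace (range γ) v y i := fderivWithin_component hγ h hy i
    rw [hbi, hp, ← hu]
    fin_cases i
    · simp [hf, tangentialPart]
    · simp [hf, tangentialPart]
    · simp [hf, h.v_normal y hy]
  have hsurf := fun n => integral_surface hγ hν h (hφd n) (hφc n)
  have hneg : ∀ n (i : Fin 2), Integrable fun y => φ n y * (u y i * -gradient p y i) :=
    fun n i => ((hsurf n).1 i).neg.congr (Eventually.of_forall fun y => by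
      simp only [Pi.neg_apply]; ring)
  have hbi : ∀ n i, Integrable fun y => φ n y * (f i (onBoundary y) * b i y) := by
    intro n i
    refine Integrable.congr ?_ (hbd n i).symm
    fin_cases i
    · exact hneg n 0
    · exact hneg n 1
    · simp
  have hfi : ∀ i, MemLp (f i) 2 (volume.restrict subfluid) := fun i => memLp_component h.memLp_v i
  have hGi : ∀ i, MemLp (gradient (f i)) 2 (volume.restrict subfluid) := fun i =>
    h.memLp_gradient_component i
  have hki : ∀ i, MemLp (fun x => gradient q x i) 2 (volume.restrict subfluid) := fun i =>
    memLp_component h.memLp_gradient_q i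
  have hgreen : ∀ n i, ∫ x in subfluid, (θ n x * (‖gradient (f i) x‖ ^ 2 +
      f i x * gradient q x i) + fderiv ℝ (θ n) x (f i x • gradient (f i) x)) =
      ∫ y, φ n y * (f i (onBoundary y) * b i y) := fun n i =>
    integral_green hγ (contDiffOn_component h.v_C2 i) (contDiffOn_component h.v_C1 i) (hfi i)
      (hGi i) (hki i) (fun x hx => h.laplacian_component i hx) (hθ.contDiff n)
      (hθ.hasCompactSupport n) (hbi n i)
  have hG2 : ∀ i, Integrable (fun x => ‖gradient (f i) x‖ ^ 2) (volume.restrict subfluid) :=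
    fun i => (memLp_two_iff_integrable_sq_norm (hGi i).1).1 (hGi i)
  have hfk : ∀ i, Integrable (fun x => f i x * gradient q x i) (volume.restrict subfluid) :=
    fun i => (hfi i).integrable_mul (hki i)
  have hfG : ∀ i, Integrable (fun x => f i x • gradient (f i) x) (volume.restrict subfluid) :=
    fun i => ((hfi i).norm.integrable_mul (hGi i).norm).mono' ((hfi i).1.smul (hGi i).1)
      (Eventually.of_forall fun x => (norm_smul _ _).le)
  have hlim := tendsto_finsetSum (Finset.univ : Finset (Fin 3)) fun i _ =>
    hθ.tendsto_integral ((hG2 i).add (hfk i)) (hfG i)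
  simp only [Pi.add_apply, hgreen] at hlim
  have hpu := integrable_smul_of_decay hγ h.p_int h.p_ext h.u_int h.u_ext h.p_decay h.u_decay
  have hbsum : ∀ n, ∑ i, ∫ y, φ n y * (f i (onBoundary y) * b i y) =
      ∫ y, fderiv ℝ (φ n) y (p y • u y) := by
    intro n
    rw [← (hsurf n).2, Fin.sum_univ_three, Fin.sum_univ_two, integral_congr_ae (hbd n 0),
      integral_congr_ae (hbd n 1), integral_congr_ae (hbd n 2)]
    simp
  simp only [hbsum] at hlim
  -- After integration by parts along the surface only the gradient of the cut-off remains, of size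
  -- `O(1/n)` against the integrable field `p u`.
  have hb0 : Tendsto (fun n => ∫ y, fderiv ℝ (φ n) y (p y • u y)) atTop (𝓝 0) := by
    refine squeeze_zero_norm (a := fun n : ℕ => 1 / ((n : ℝ) + 1) * ∫ y, ‖p y • u y‖)
      (fun n => ?_) ?_
    · rw [← integral_const_mul]
      refine norm_integral_le_of_norm_le (hpu.norm.const_mul _) (Eventually.of_forall fun y => ?_)
      refine ((fderiv ℝ (φ n) y).le_opNorm _).trans
        (mul_le_mul_of_nonneg_right ?_ (norm_nonneg _))
      exact (norm_fderiv_comp_onBoundary_le (hθ.contDiff n) y).trans (hθ.norm_fderiv_le n _)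
    · have := (tendsto_div_add_one 1).mul_const (∫ y, ‖p y • u y‖)
      rwa [zero_mul] at this
  have hsum := tendsto_nhds_unique hlim hb0
  have hqv : Integrable (fun x => fderiv ℝ q x (v x)) (volume.restrict subfluid) := by
    simp only [← inner_gradient_left]
    exact (h.memLp_gradient_q.norm.integrable_mul h.memLp_v.norm).mono'
      (h.memLp_gradient_q.1.inner h.memLp_v.1)
      (Eventually.of_forall fun x => norm_inner_le_norm _ _)
  have hqv2 : Integrable (fun x => q x • v x) (volume.restrict subfluid) :=
    (h.memLp_q.norm.integrable_mul h.memLp_v.norm).mono' (h.memLp_q.1.smul h.memLp_v.1)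
      (Eventually.of_forall fun x => (norm_smul _ _).le)
  have hq0 : ∫ x in subfluid, fderiv ℝ q x (v x) = 0 := by
    have hl := hθ.tendsto_integral hqv hqv2
    have hz : ∀ n, ∫ x in subfluid, (θ n x * fderiv ℝ q x (v x) +
        fderiv ℝ (θ n) x (q x • v x)) = 0 := fun n =>
      integral_pressure hγ h.v_C1.continuousOn (fun x hx => h.differentiableAt_v hx) h.div_v
        h.v_normal h.q_C0 (fun x hx => h.differentiableAt_q hx) h.memLp_v h.memLp_q
        h.memLp_gradient_q (hθ.contDiff n) (hθ.hasCompactSupport n)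
    simp only [hz] at hl
    exact tendsto_nhds_unique hl tendsto_const_nhds
  -- Summed over components, the source terms `vᵢ ∂ᵢq` give `∇q · v`, whose integral has just been
  -- shown to vanish.
  have hsplit : ∑ i, ∫ x in subfluid, (‖gradient (f i) x‖ ^ 2 + f i x * gradient q x i) =
      (∫ x in subfluid, ∑ i, ‖gradient (f i) x‖ ^ 2) +
        ∫ x in subfluid, fderiv ℝ q x (v x) := by
    rw [integral_finsetSum _ fun i _ => hG2 i]
    have e : ∀ x, fderiv ℝ q x (v x) = ∑ i, f i x * gradient q x i := fun x => by
      rw [← inner_gradient_left, PiLp.inner_apply]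
      simp [hf]
    simp only [e]
    rw [integral_finsetSum _ fun i _ => hfk i, ← Finset.sum_add_distrib]
    exact Finset.sum_congr rfl fun i _ => integral_add (hG2 i) (hfk i)
  rw [hsplit, hq0, add_zero] at hsum
  exact hsum

/-- Vanishing energy makes `∇v` zero almost everywhere, and by continuity everywhere in `B`. The
remaining unknowns then fall in the order `v`, `q`, `u`, `p`, each by the equation linking it to
those before. -/
theorem eq_zero (hγ : IsC2Jordan γ) (hν : IsOutwardNormal γ ν)
    (h : IsClassicalSolution γ ν (fun _ => 0) v q u p) :
    EqOn v (fun _ => 0) (closedSubfluidDiff (range γ)) ∧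
      EqOn q (fun _ => 0) (closedSubfluidDiff (range γ)) ∧
      EqOn u (fun _ => 0) (range γ)ᶜ ∧ EqOn p (fun _ => 0) (range γ)ᶜ := by
  have hfc : ∀ i : Fin 3, ContinuousOn (fun x => fderiv ℝ v x (EuclideanSpace.single i 1))
      subfluid := fun i =>
    (h.v_C2.continuousOn_fderiv_of_isOpen isOpen_subfluid one_le_two).clm_apply continuousOn_const
  have hsum0 : ∀ x ∈ subfluid,
      ∑ i : Fin 3, ‖fderiv ℝ v x (EuclideanSpace.single i 1)‖ ^ 2 = 0 := by
    have hE : ∫ x in subfluid, ∑ i : Fin 3, ‖fderiv ℝ v x (EuclideanSpace.single i 1)‖ ^ 2 = 0 := by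
      rw [← h.integral_energy hγ hν]
      exact setIntegral_congr_fun measurableSet_subfluid fun x hx =>
        (sum_sq_norm_gradient (h.differentiableAt_v hx)).symm
    have hae := (integral_eq_zero_iff_of_nonneg (fun x => by positivity) h.v_energy).1 hE
    exact Measure.eqOn_open_of_ae_eq hae isOpen_subfluid
      (continuousOn_finsetSum _ fun i _ => (hfc i).norm.pow 2) continuousOn_const
  have hdv : ∀ x ∈ subfluid, fderiv ℝ v x = 0 := by
    intro x hx
    have h1 := (Finset.sum_eq_zero_iff_of_nonneg (fun i _ => by positivity)).1 (hsum0 x hx)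
    refine ContinuousLinearMap.coe_injective
      ((EuclideanSpace.basisFun (Fin 3) ℝ).toBasis.ext fun i => ?_)
    simpa using h1 i (Finset.mem_univ i)
  have hvB := eqOn_zero_of_fderiv_eq_zero (fun x hx => h.differentiableAt_v hx) hdv h.v_decay
  have hclos := closedSubfluidDiff_subset_closure (range γ)
  have hv : EqOn v (fun _ => 0) (closedSubfluidDiff (range γ)) :=
    hvB.of_subset_closure h.v_C1.continuousOn continuousOn_const (subfluid_subset _) hclos
  have hdq : ∀ x ∈ subfluid, fderiv ℝ q x = 0 := by
    intro x hx
    have hl : Laplacian.laplacian v x = 0 := by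
      have hev : v =ᶠ[𝓝 x] fun _ => 0 := by
        filter_upwards [isOpen_subfluid.mem_nhds hx] with z hz using hvB hz
      rw [(laplacian_congr_nhds hev).eq_of_nhds]
      simp
    have hs := h.stokes x hx
    rw [hl, neg_zero, zero_add] at hs
    rw [← toDual_gradient, hs, map_zero]
  have hqB := eqOn_zero_of_fderiv_eq_zero (fun x hx => h.differentiableAt_q hx) hdq h.q_decay'
  have hq : EqOn q (fun _ => 0) (closedSubfluidDiff (range γ)) :=
    hqB.of_subset_closure h.q_C0 continuousOn_const (subfluid_subset _) hclos
  have htan : tangentialPart 0 = 0 := by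
    ext i; fin_cases i <;> simp [tangentialPart]
  refine ⟨hv, hq, fun y hy => ?_, fun y hy => ?_⟩
  · rw [← h.v_tangential y hy, hv (onBoundary_mem hy), htan]
  · refine pressure_eq_zero hγ hν
      (fun y hy => differentiableAt_surface hγ h.p_int h.p_ext hy) (fun y hy => ?_) h.p_decay
      h.jump_p hy
    -- The trace is a derivative within `closure B \ Γ`, so the vanishing of `v` on that set
    -- suffices.
    have hn : normalDerivTrace (range γ) v y = 0 := by
      rw [normalDerivTrace, fderivWithin_congr hv (hv (onBoundary_mem hy))]
      simp
    have hg := h.grad_p y hy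
    rw [hn, htan, neg_zero] at hg
    rw [← toDual_gradient, hg, map_zero]

end IsClassicalSolution

end

end Langmuir

theorem theorem2p3
    (γ : ℝ → Langmuir.Plane) (hγ : Langmuir.IsC2Jordan γ)
    (ν : Langmuir.Plane → Langmuir.Plane) (hν : Langmuir.IsOutwardNormal γ ν)
    (g : Langmuir.Plane → ℝ) (hg : ContinuousOn g (Set.range γ))
    (hforce : Langmuir.lineIntegral γ (fun y => g y • ν y) = 0)
    (v₁ v₂ : Langmuir.Space → Langmuir.Space) (q₁ q₂ : Langmuir.Space → ℝ)
    (u₁ u₂ : Langmuir.Plane → Langmuir.Plane) (p₁ p₂ : Langmuir.Plane → ℝ)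
    (h₁ : Langmuir.IsClassicalSolution γ ν g v₁ q₁ u₁ p₁)
    (h₂ : Langmuir.IsClassicalSolution γ ν g v₂ q₂ u₂ p₂) :
    Set.EqOn v₁ v₂ (Langmuir.closedSubfluidDiff (Set.range γ)) ∧
      Set.EqOn q₁ q₂ (Langmuir.closedSubfluidDiff (Set.range γ)) ∧
      Set.EqOn u₁ u₂ (Set.range γ)ᶜ ∧
      Set.EqOn p₁ p₂ (Set.range γ)ᶜ := by
  obtain ⟨hv, hq, hu, hp⟩ := (Langmuir.IsClassicalSolution.sub hγ h₁ h₂).eq_zero hγ hν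
  exact ⟨fun x hx => sub_eq_zero.1 (hv hx), fun x hx => sub_eq_zero.1 (hq hx),
    fun y hy => sub_eq_zero.1 (hu hy), fun y hy => sub_eq_zero.1 (hp hy)⟩
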